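/- **Setting.** Let $d\ge 0$. A *substitution rule* consists of a finite set of (labelled) prototiles $p$, with supports in $\mathbb{R}^d$ homeomorphic to a closed ball, an inflation factor $\lambda>1$, and for every $p$ a subdivision of the inflated support $\lambda\,\mathrm{supp}(p)$ into translates of prototiles with pairwise disjoint interiors. Assume that it is primitive (some power sends every prototile to a patch containing all prototiles). Let $T$ be a tiling of $\mathbb{R}^d$ arising from the rule, together with its tilings $T_n$ by level-$n$ supertiles ($T_0=T$; each level-$(n+1)$ supertile is subdivided into level-$n$ supertiles; every patch of $T_n$ occurs, up to translation, in a supertile). Assume that $T$ has finite local complexity and is strongly aperiodic (no tiling in its tiling space has a nonzero period). The collared Anderson–Putnam complex $AP_n$ is the quotient of $\mathbb{R}^d$ that identifies points having the same position in two level-$n$ supertiles of $T_n$ that agree, together with all the supertiles that meet them, up to translation; $\sigma:AP_{n+1}\to AP_n$ is the map induced by subdividing supertiles. Assume that each $AP_n$ is a finite CW complex whose open cells are the images of the connected components of the sets of points of $\mathbb{R}^d$ that lie in exactly the same level-$n$ supertiles, and that $\sigma$ subdivides each $k$-cell of $AP_{n+1}$ into $k$-cells of $AP_n$. A $k$-cell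 is *flat* if it lies in a $k$-dimensional affine subspace (in $\mathbb{R}^d$). The $d$-cells carry the standard orientation of $\mathbb{R}^d$; for $k<d$, if $\sigma$ sends part of a flat open $k$-cell of $AP_{n+1}$ into an open $k$-cell of $AP_n$, then both cells carry the same orientation; otherwise orientations are arbitrary. Let $C_n^k$ be the group of integral cellular $k$-cochains of $AP_n$, let $\sigma^\top:C_n^k\to C_{n+1}^k$ be the map dual to the cellular chain map of $\sigma$, and let $C^k=\varinjlim_n(C_n^k,\sigma^\top)$. Choose one point, a $k$-puncture, in each open $k$-cell of $AP_0$, $0\le k\le d$. The $k$-punctures of $AP_n$ are the points of open $k$-cells of $AP_n$ that $\sigma^n$ sends to $k$-punctures of $AP_0$. Let $\dot G_{AF,n}^{(k)}$ be the finite discrete groupoid of the equivalence relation "in the same $k$-cell of $AP_n$" on the $k$-punctures of $AP_n$; for punctures $t,t'$ in a $k$-cell $P$ write $[P,t',t]$ for the arrow from $t$ to $t'$, and $e[P,t]$ for the projection that is the characteristic function of $[P,t,t]$. Let $\dot G_{AF}^{(k)}$ be the groupoid of the following equivalence relation on the sequences $(p_m)_m$ of $k$-punctures $p_m\in AP_m$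 with $\sigma(p_{m+1})=p_m$: two sequences $(p_m)$ and $(q_m)$ are equivalent if for some $n$ they are tail equivalent from level $n$ on, i.e. for all $m\ge n$ the points $p_m$ and $q_m$ lie in the same copy in $AP_m$ of an open level-$n$ cell. Its topology is generated by the sets $[P,t',t]$ of all pairs that are tail equivalent from level $n$ on with $p_n=t'$ and $q_n=t$, over all $n$ and all $t,t'\in AP_n$. Write $\dot G_{AF}=\dot G_{AF}^{(d)}$, and let $C_r^\ast$ denote the reduced groupoid $C^\ast$-algebra. The *boundary hyperplane condition* says that for all $k<d$ and all $n$, every $k$-cell of $AP_n$ is flat. **Lemma (Cochain–Finite-dimensional Algebra isomorphism, CF).** 1. $K_0(C_r^\ast(\dot G_{AF}))\cong C^d$. 2. For every $k<d$ and every $n$ there is an isomorphism $c_n:C_n^k\to K_0(C_r^\ast(\dot G_{AF,n}^{(k)}))$ that sends the dual basis element of each $k$-cell $P$ to the class of $e[P,t]$, for every puncture $t$ in $P$; and $$\varinjlim_n\bigl(K_0(C_r^\ast(\dot G_{AF,n}^{(k)})),\ c_{n+1}\circ\sigma^\top\circ c_n^{-1}\bigr)\cong C^k .$$ 3. If the boundary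 hyperplane condition holds, then $K_0(C_r^\ast(\dot G_{AF}^{(k)}))\cong C^k$ for every $k<d$. -/

import Mathlib

open Set Metric

noncomputable section

namespace SubstTiling

/-! ## Direct limits of sequences of abelian groups -/

section Limits

universe u

/-- The composite `A i → A (i + 1) → ⋯ → A j` of consecutive bonding maps. -/
def seqMap {A : ℕ → Type u} [∀ n, AddCommGroup (A n)] (f : ∀ n, A n →+ A (n + 1))
    (i j : ℕ) (h : i ≤ j) : A i →+ A j :=
  Nat.leRecOn (C := fun m => A i →+ A m) h (fun {m} g => (f m).comp g) (AddMonoidHom.id (A i))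

/-- The direct limit of `A 0 → A 1 → A 2 → ⋯`. -/
abbrev SeqLim {A : ℕ → Type u} [∀ n, AddCommGroup (A n)] (f : ∀ n, A n →+ A (n + 1)) : Type u :=
  AddCommGroup.DirectLimit A (seqMap f)

end Limits

/-! ## The group `K₀`

`K₀(A)` is the Grothendieck group of the semigroup of Murray-von Neumann classes of projections in
matrix algebras over `A`. The construction does not mention the unit of `A`, so that it can be
applied to a subalgebra whose unit is not singled out; for a C*-algebra that has a unit it is the
usual `K₀`. -/

section KTheory

universe u
variable (A : Type u) [NonUnitalRing A] [StarRing A]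

/-- Projections in the matrix algebras `M_n(A)`, for all `n`. -/
structure MatProj where
  size : ℕ
  mat : Matrix (Fin size) (Fin size) A
  isProj : IsStarProjection mat

variable {A}

open scoped Matrix

/-- Murray-von Neumann equivalence: `v*v = p` and `vv* = q` for a (rectangular) matrix `v`. -/
def MatProj.Equiv (p q : MatProj A) : Prop :=
  ∃ v : Matrix (Fin q.size) (Fin p.size) A, vᴴ * v = p.mat ∧ v * vᴴ = q.mat

theorem MatProj.star_mat (p : MatProj A) : p.matᴴ = p.mat := p.isProj.isSelfAdjoint
theorem MatProj.mul_mat (p : MatProj A) : p.mat * p.mat = p.mat := p.isProj.isIdempotentElem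

variable (A) in
/-- Murray-von Neumann equivalence as a setoid. -/
def MatProj.setoid : Setoid (MatProj A) where
  r := MatProj.Equiv
  iseqv :=
    { refl := fun p => ⟨p.mat, by rw [p.star_mat, p.mul_mat], by rw [p.star_mat, p.mul_mat]⟩
      symm := fun {p q} ⟨v, h1, h2⟩ =>
        ⟨vᴴ, by rw [Matrix.conjTranspose_conjTranspose, h2],
          by rw [Matrix.conjTranspose_conjTranspose, h1]⟩
      trans := by
        rintro p q r ⟨v, h1, h2⟩ ⟨w, h3, h4⟩
        refine ⟨w * v, ?_, ?_⟩
        · rw [Matrix.conjTranspose_mul, Matrix.mul_assoc, ← Matrix.mul_assoc wᴴ, h3, ← h2,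
            Matrix.mul_assoc v, h1, ← Matrix.mul_assoc, h1, p.mul_mat]
        · rw [Matrix.conjTranspose_mul, Matrix.mul_assoc, ← Matrix.mul_assoc v, h2, ← h3,
            Matrix.mul_assoc wᴴ, h4, ← Matrix.mul_assoc, h4, r.mul_mat] }

/-- The direct sum `diag(p, q)`. -/
def MatProj.add (p q : MatProj A) : MatProj A where
  size := p.size + q.size
  mat := (Matrix.fromBlocks p.mat 0 0 q.mat).submatrix finSumFinEquiv.symm finSumFinEquiv.symm
  isProj := by
    refine ⟨?_, ?_⟩
    · change _ * _ = _
      rw [Matrix.submatrix_mul_equiv, Matrix.fromBlocks_multiply]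
      simp [p.mul_mat, q.mul_mat]
    · change Matrix.conjTranspose _ = _
      rw [Matrix.conjTranspose_submatrix, Matrix.fromBlocks_conjTranspose]
      simp [p.star_mat, q.star_mat]

/-- The `0 × 0` projection. -/
def MatProj.zero : MatProj A where
  size := 0
  mat := 0
  isProj := ⟨by change _ * _ = _; simp, by change star _ = _; simp⟩

theorem MatProj.equiv_of_reindex {ι : Type} [Fintype ι] (p q : MatProj A) (M : Matrix ι ι A)
    (e : Fin p.size ≃ ι) (f : Fin q.size ≃ ι)
    (hp : p.mat = M.submatrix e e) (hq : q.mat = M.submatrix f f) : p.Equiv q := by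
  have hM : M = p.mat.submatrix e.symm e.symm := by rw [hp]; ext i j; simp
  have h1 : Mᴴ = M := by rw [hM, Matrix.conjTranspose_submatrix, p.star_mat]
  have h2 : M * M = M := by rw [hM, Matrix.submatrix_mul_equiv, p.mul_mat]
  refine ⟨M.submatrix f e, ?_, ?_⟩
  · rw [Matrix.conjTranspose_submatrix, Matrix.submatrix_mul_equiv, h1, h2, hp]
  · rw [Matrix.conjTranspose_submatrix, Matrix.submatrix_mul_equiv, h1, h2, hq]

theorem MatProj.add_congr {p p' q q' : MatProj A} (h : p.Equiv p') (h' : q.Equiv q') :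
    (p.add q).Equiv (p'.add q') := by
  obtain ⟨v, h1, h2⟩ := h
  obtain ⟨w, h3, h4⟩ := h'
  let V : Matrix (Fin (p'.size + q'.size)) (Fin (p.size + q.size)) A :=
    (Matrix.fromBlocks v 0 0 w).submatrix finSumFinEquiv.symm finSumFinEquiv.symm
  have e1 : Vᴴ * V = (Matrix.fromBlocks p.mat 0 0 q.mat).submatrix
      finSumFinEquiv.symm finSumFinEquiv.symm := by
    rw [Matrix.conjTranspose_submatrix, Matrix.submatrix_mul_equiv,
      Matrix.fromBlocks_conjTranspose, Matrix.fromBlocks_multiply]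
    simp [h1, h3]
  have e2 : V * Vᴴ = (Matrix.fromBlocks p'.mat 0 0 q'.mat).submatrix
      finSumFinEquiv.symm finSumFinEquiv.symm := by
    rw [Matrix.conjTranspose_submatrix, Matrix.submatrix_mul_equiv,
      Matrix.fromBlocks_conjTranspose, Matrix.fromBlocks_multiply]
    simp [h2, h4]
  exact ⟨V, e1, e2⟩

section Blocks

variable {a b c : ℕ} (P : Matrix (Fin a) (Fin a) A) (Q : Matrix (Fin b) (Fin b) A)
  (R : Matrix (Fin c) (Fin c) A)

theorem blocks_zero : (Matrix.fromBlocks (0 : Matrix (Fin 0) (Fin 0) A) 0 0 P).submatrix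
    finSumFinEquiv.symm finSumFinEquiv.symm =
    P.submatrix (finSumFinEquiv.symm.trans (Equiv.emptySum (Fin 0) (Fin a)))
      (finSumFinEquiv.symm.trans (Equiv.emptySum (Fin 0) (Fin a))) := by
  ext i j
  simp only [Matrix.submatrix_apply, Equiv.coe_trans, Function.comp_apply]
  generalize finSumFinEquiv.symm i = i'
  generalize finSumFinEquiv.symm j = j'
  rcases i' with i' | i'
  · exact i'.elim0
  rcases j' with j' | j'
  · exact j'.elim0
  rfl

theorem blocks_comm : (Matrix.fromBlocks Q 0 0 P).submatrix
    (finSumFinEquiv (m := b) (n := a)).symm finSumFinEquiv.symm =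
    (Matrix.fromBlocks P 0 0 Q).submatrix (finSumFinEquiv.symm.trans (Equiv.sumComm _ _))
      (finSumFinEquiv.symm.trans (Equiv.sumComm _ _)) := by
  ext i j
  simp only [Matrix.submatrix_apply, Equiv.coe_trans, Function.comp_apply]
  generalize finSumFinEquiv.symm i = i'
  generalize finSumFinEquiv.symm j = j'
  rcases i' with i | i <;> rcases j' with j | j <;> rfl

theorem blocks_assoc_left : (Matrix.fromBlocks ((Matrix.fromBlocks P 0 0 Q).submatrix
      finSumFinEquiv.symm finSumFinEquiv.symm) 0 0 R).submatrix
        (finSumFinEquiv (m := a + b) (n := c)).symm finSumFinEquiv.symm =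
    (Matrix.fromBlocks P 0 0 (Matrix.fromBlocks Q 0 0 R)).submatrix
      ((finSumFinEquiv.symm.trans (Equiv.sumCongr finSumFinEquiv.symm (Equiv.refl _))).trans
        (Equiv.sumAssoc _ _ _))
      ((finSumFinEquiv.symm.trans (Equiv.sumCongr finSumFinEquiv.symm (Equiv.refl _))).trans
        (Equiv.sumAssoc _ _ _)) := by
  ext i j
  simp only [Matrix.submatrix_apply, Equiv.coe_trans, Function.comp_apply]
  generalize finSumFinEquiv.symm i = i'
  generalize finSumFinEquiv.symm j = j'
  rcases i' with i | i <;> rcases j' with j | j <;>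
    simp only [Equiv.sumCongr_apply, Sum.map_inl, Sum.map_inr, Matrix.fromBlocks_apply₁₁,
      Matrix.fromBlocks_apply₁₂, Matrix.fromBlocks_apply₂₁, Matrix.fromBlocks_apply₂₂,
      Matrix.submatrix_apply]
  · generalize finSumFinEquiv.symm i = i'
    generalize finSumFinEquiv.symm j = j'
    rcases i' with i | i <;> rcases j' with j | j <;> rfl
  · generalize finSumFinEquiv.symm i = i'
    rcases i' with i | i <;> rfl
  · generalize finSumFinEquiv.symm j = j'
    rcases j' with j | j <;> rfl
  · rfl

theorem blocks_assoc_right : (Matrix.fromBlocks P 0 0 ((Matrix.fromBlocks Q 0 0 R).submatrix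
      finSumFinEquiv.symm finSumFinEquiv.symm)).submatrix
        (finSumFinEquiv (m := a) (n := b + c)).symm finSumFinEquiv.symm =
    (Matrix.fromBlocks P 0 0 (Matrix.fromBlocks Q 0 0 R)).submatrix
      (finSumFinEquiv.symm.trans (Equiv.sumCongr (Equiv.refl _) finSumFinEquiv.symm))
      (finSumFinEquiv.symm.trans (Equiv.sumCongr (Equiv.refl _) finSumFinEquiv.symm)) := by
  ext i j
  simp only [Matrix.submatrix_apply, Equiv.coe_trans, Function.comp_apply]
  generalize finSumFinEquiv.symm i = i'
  generalize finSumFinEquiv.symm j = j'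
  rcases i' with i | i <;> rcases j' with j | j <;> rfl

end Blocks

theorem MatProj.zero_add (p : MatProj A) : (MatProj.zero.add p).Equiv p :=
  MatProj.equiv_of_reindex _ _ p.mat _ (Equiv.refl _) (blocks_zero p.mat) rfl

theorem MatProj.add_comm (p q : MatProj A) : (p.add q).Equiv (q.add p) :=
  MatProj.equiv_of_reindex _ _ (Matrix.fromBlocks p.mat 0 0 q.mat) finSumFinEquiv.symm _ rfl
    (blocks_comm p.mat q.mat)

theorem MatProj.add_assoc (p q r : MatProj A) :
    ((p.add q).add r).Equiv (p.add (q.add r)) :=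
  MatProj.equiv_of_reindex _ _ _ _ _ (blocks_assoc_left p.mat q.mat r.mat)
    (blocks_assoc_right p.mat q.mat r.mat)

variable (A) in
/-- The semigroup of Murray-von Neumann classes of projections in matrices over `A`. -/
def ProjClass : Type u := Quotient (MatProj.setoid A)

theorem ProjClass.add_comm_aux (p q : MatProj A) :
    (Quotient.mk (MatProj.setoid A) (p.add q)) = Quotient.mk (MatProj.setoid A) (q.add p) :=
  Quotient.sound (MatProj.add_comm p q)

instance : Add (ProjClass A) :=
  ⟨Quotient.map₂ MatProj.add fun _ _ h _ _ h' => MatProj.add_congr h h'⟩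

instance : Zero (ProjClass A) := ⟨Quotient.mk _ MatProj.zero⟩

instance : AddCommMonoid (ProjClass A) where
  nsmul := nsmulRec
  zero_add := by
    rintro ⟨p⟩
    exact Quotient.sound (MatProj.zero_add p)
  add_zero := by
    rintro ⟨p⟩
    exact (ProjClass.add_comm_aux p MatProj.zero).trans (Quotient.sound (MatProj.zero_add p))
  add_comm := by
    rintro ⟨p⟩ ⟨q⟩
    exact ProjClass.add_comm_aux p q
  add_assoc := by
    rintro ⟨p⟩ ⟨q⟩ ⟨r⟩
    exact Quotient.sound (MatProj.add_assoc p q r)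

variable (A) in
/-- The group `K₀(A)`. -/
def K0 : Type u := Algebra.GrothendieckAddGroup (ProjClass A)

instance : AddCommGroup (K0 A) :=
  inferInstanceAs (AddCommGroup (Algebra.GrothendieckAddGroup (ProjClass A)))

/-- The class in `K₀(A)` of a projection of `A`. -/
def K0.ofProj (p : A) (hp : IsStarProjection p) : K0 A :=
  Algebra.GrothendieckAddGroup.of (Quotient.mk (MatProj.setoid A)
    { size := 1
      mat := Matrix.of fun _ _ => p
      isProj := ⟨by
          change _ * _ = _
          ext i j
          simpa [Matrix.mul_apply] using hp.isIdempotentElem.eq, by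
          change Matrix.conjTranspose _ = _
          ext i j
          simpa [Matrix.conjTranspose_apply] using hp.isSelfAdjoint.star_eq⟩ })

end KTheory

/-! ## Reduced C*-algebras of equivalence relations

All discrete groupoids below are equivalence relations, with a topology on the set of arrows. -/

/-- An equivalence relation, seen as a groupoid, with a topology on its set of arrows. -/
structure EqGroupoid where
  Unit : Type
  rel : Setoid Unit
  top : TopologicalSpace {a : Unit × Unit // rel a.1 a.2}

namespace EqGroupoid

variable (G : EqGroupoid)

/-- Arrows: the arrow `(x, y)` has range `x` and source `y`. -/
def Arrow : Type := {a : G.Unit × G.Unit // G.rel a.1 a.2}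

instance : TopologicalSpace G.Arrow := G.top

variable {G}
def Arrow.range (a : G.Arrow) : G.Unit := a.1.1
def Arrow.source (a : G.Arrow) : G.Unit := a.1.2

/-- The arrow `c a⁻¹`, for arrows `c` and `a` with the same source. -/
def Arrow.mulInv (c a : G.Arrow) (h : c.source = a.source) : G.Arrow :=
  ⟨(c.range, a.range), G.rel.trans c.2
    (G.rel.symm (by have h2 := a.2; change c.1.2 = a.1.2 at h; rw [← h] at h2; exact h2))⟩

variable (G)

/-- The Hilbert space `ℓ²(G)`, which is the direct sum of the `ℓ²(s⁻¹(x))` over the units `x`. -/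
abbrev L2 : Type := lp (fun _ : G.Arrow => ℂ) 2

variable {G}

open Classical in
/-- The bounded operator `S` is the direct sum over all units `x` of the regular representations
`π_x(f)`, where `π_x(f) δ_a = ∑ f(b) δ_{ba}`, the sum over the arrows `b` with `s(b) = r(a)`.
The coefficient of `π_x(f) δ_a` at `c` is `f(c a⁻¹)` if `s(c) = s(a)`, and `0` otherwise. -/
def IsRegularRep (f : G.Arrow → ℂ) (S : G.L2 →L[ℂ] G.L2) : Prop :=
  ∀ a c : G.Arrow, (S (lp.single 2 a (1 : ℂ)) : G.Arrow → ℂ) c =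
    if h : c.source = a.source then f (c.mulInv a h) else 0

variable (G)

/-- The reduced C*-algebra of `G`: the norm closure of the `*`-algebra of the operators by which
the continuous compactly supported functions on `G` act in the regular representations. -/
def reducedCStar : NonUnitalStarSubalgebra ℂ (G.L2 →L[ℂ] G.L2) :=
  (NonUnitalStarAlgebra.adjoin ℂ {S : G.L2 →L[ℂ] G.L2 |
    ∃ f : G.Arrow → ℂ, Continuous f ∧ HasCompactSupport f ∧ IsRegularRep f S}).topologicalClosure

end EqGroupoid

/-! ## Orientations -/

/-- A map `h` that is continuous and injective near `x` preserves the orientation of `ℝᵏ` at `x`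
(its local degree at `x` is `1` and not `-1`): on every small sphere around `x`, the map
`u ↦ h(x + ru) - h(x)` is homotopic to the identity of the unit sphere, in `ℝᵏ ∖ {0}`. -/
def PreservesOrientationAt {k : ℕ} (h : (Fin k → ℝ) → (Fin k → ℝ)) (x : Fin k → ℝ) : Prop :=
  ∃ R > 0, ∀ r : ℝ, 0 < r → r < R → ∃ H : ℝ × (Fin k → ℝ) → (Fin k → ℝ),
    ContinuousOn H (Icc 0 1 ×ˢ sphere 0 1) ∧
    ∀ u ∈ sphere (0 : Fin k → ℝ) 1,
      H (0, u) = h (x + r • u) - h x ∧ H (1, u) = u ∧ ∀ t ∈ Icc (0 : ℝ) 1, H (t, u) ≠ 0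

/-! ## Substitution rules -/

/-- Euclidean space. -/
abbrev Euc (d : ℕ) : Type := EuclideanSpace ℝ (Fin d)

/-- A substitution rule on finitely many (labelled) prototiles in `ℝᵈ`: the prototile `p`, inflated
by the factor `scale`, is subdivided into the tiles `y + supp q`, `(q, y) ∈ sub p`. -/
structure Substitution (d : ℕ) where
  Proto : Type
  finite_proto : Finite Proto
  supp : Proto → Set (Euc d)
  supp_ball : ∀ p, Nonempty (supp p ≃ₜ closedBall (0 : Euc d) 1)
  scale : ℝ
  one_lt_scale : 1 < scale
  sub : Proto → Finset (Proto × Euc d)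
  sub_cover : ∀ p, (⋃ s ∈ sub p, (fun z => s.2 + z) '' supp s.1) = (fun z => scale • z) '' supp p
  sub_disjoint : ∀ p, ∀ s ∈ sub p, ∀ s' ∈ sub p, s ≠ s' →
    Disjoint (interior ((fun z => s.2 + z) '' supp s.1))
      (interior ((fun z => s'.2 + z) '' supp s'.1))

namespace Substitution

variable {d : ℕ} (S : Substitution d)

/-- Tiles, and supertiles of any level: a prototile and a position. -/
abbrev Tile : Type := S.Proto × Euc d

/-- The support of the level-`n` supertile `t`. -/
def tileSupp (n : ℕ) (t : S.Tile) : Set (Euc d) := (fun z => t.2 + S.scale ^ n • z) '' S.supp t.1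

/-- The translate `t + v`. -/
def shift (v : Euc d) (t : S.Tile) : S.Tile := (t.1, t.2 + v)

/-- The level-`n` supertiles into which the level-`(n + 1)` supertile `t` is subdivided. -/
def subTiles (n : ℕ) (t : S.Tile) : Set S.Tile :=
  {s | ∃ q ∈ S.sub t.1, s = (q.1, t.2 + S.scale ^ n • q.2)}

/-- The level-`n` supertiles into which the level-`(n + m)` supertile `(p, 0)` is subdivided. -/
def superPatch : ℕ → ℕ → S.Proto → Set S.Tile
  | _, 0, p => {(p, 0)}
  | n, m + 1, p => ⋃ s ∈ superPatch (n + 1) m p, S.subTiles n s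

/-- A patch of level-`n` supertiles. -/
def IsPatch (n : ℕ) (F : Set S.Tile) : Prop :=
  F.Finite ∧ Nonempty ((⋃ t ∈ F, S.tileSupp n t : Set (Euc d)) ≃ₜ closedBall (0 : Euc d) 1)

/-- Some power of the substitution sends every prototile to a patch with all prototiles. -/
def IsPrimitive : Prop := ∃ m, ∀ p q, ∃ x, (q, x) ∈ S.superPatch 0 m p

/-- The tiles that meet the set `B`. -/
def meeting (T : Set S.Tile) (B : Set (Euc d)) : Set S.Tile :=
  {t ∈ T | (S.tileSupp 0 t ∩ B).Nonempty}

/-- `T₁` and `T₂` are less than `ε` apart in the tiling metric. -/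
def Close (ε : ℝ) (T₁ T₂ : Set S.Tile) : Prop :=
  ∃ x₁ ∈ ball (0 : Euc d) ε, ∃ x₂ ∈ ball (0 : Euc d) ε,
    S.meeting (S.shift (-x₁) '' T₁) (ball 0 (1 / ε)) =
      S.meeting (S.shift (-x₂) '' T₂) (ball 0 (1 / ε))

/-- The tiling space of `T`: the closure, in the tiling metric, of the set of its translates. -/
def tilingSpace (T : Set S.Tile) : Set (Set S.Tile) :=
  {T' | ∀ ε > 0, ∃ x, S.Close ε T' (S.shift (-x) '' T)}

end Substitution

/-- A tiling `tiles 0` of `ℝᵈ` that arises from the substitution rule `S`, together with its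
decompositions `tiles n` into level-`n` supertiles. -/
structure Tiling {d : ℕ} (S : Substitution d) where
  tiles : ℕ → Set S.Tile
  cover : ∀ n, (⋃ t ∈ tiles n, S.tileSupp n t) = univ
  disjoint : ∀ n, ∀ t ∈ tiles n, ∀ t' ∈ tiles n, t ≠ t' →
    Disjoint (interior (S.tileSupp n t)) (interior (S.tileSupp n t'))
  subdivide : ∀ n, tiles n = ⋃ t ∈ tiles (n + 1), S.subTiles n t
  arises : ∀ n F, F ⊆ tiles n → S.IsPatch n F →
    ∃ m p v, S.shift v '' F ⊆ S.superPatch n m p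

namespace Tiling

variable {d : ℕ} {S : Substitution d} (T : Tiling S)

/-- Finite local complexity: for every `r`, finitely many patches of radius `r` up to translation. -/
def HasFLC : Prop :=
  ∀ r > 0, ∃ 𝓕 : Set (Set S.Tile), 𝓕.Finite ∧
    ∀ x, ∃ F ∈ 𝓕, ∃ v, S.meeting (T.tiles 0) (ball x r) = S.shift v '' F

/-- Strong aperiodicity: no tiling in the tiling space has a nonzero period. -/
def IsAperiodic : Prop :=
  ∀ T' ∈ S.tilingSpace (T.tiles 0), ∀ x : Euc d, x ≠ 0 → S.shift (-x) '' T' ≠ T'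

/-! ### Collared Anderson-Putnam complexes -/

/-- The collar of `t`: the level-`n` supertiles that meet `t` (including `t`). -/
def collar (n : ℕ) (t : S.Tile) : Set S.Tile :=
  {s ∈ T.tiles n | (S.tileSupp n s ∩ S.tileSupp n t).Nonempty}

/-- The points `x` and `y` have the same position in two level-`n` supertiles that agree, with
their collars, up to translation. -/
def apRel (n : ℕ) (x y : Euc d) : Prop :=
  ∃ t ∈ T.tiles n, x ∈ S.tileSupp n t ∧ S.shift (y - x) t ∈ T.tiles n ∧
    T.collar n (S.shift (y - x) t) = S.shift (y - x) '' T.collar n t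

/-- The (collared) Anderson-Putnam complex of level `n`: the supports of the collared level-`n`
supertiles up to translation, glued along their boundaries as in the tiling. -/
def AP (n : ℕ) : Type := Quot (T.apRel n)

instance (n : ℕ) : TopologicalSpace (T.AP n) := inferInstanceAs (TopologicalSpace (Quot _))

/-- The projection of the tiled space `ℝᵈ` to the Anderson-Putnam complex. -/
def proj (n : ℕ) (x : Euc d) : T.AP n := Quot.mk _ x

theorem shift_tileSupp (n : ℕ) (t : S.Tile) (v y : Euc d) :
    y ∈ S.tileSupp n (S.shift v t) ↔ y - v ∈ S.tileSupp n t := by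
  simp only [Substitution.tileSupp, Substitution.shift, mem_image]
  constructor
  · rintro ⟨z, hz, rfl⟩
    exact ⟨z, hz, by abel⟩
  · rintro ⟨z, hz, h⟩
    exact ⟨z, hz, by rw [eq_sub_iff_add_eq] at h; rw [← h]; abel⟩

theorem mem_tileSupp_succ (n : ℕ) (t : S.Tile) (y : Euc d) :
    y ∈ S.tileSupp (n + 1) t ↔ ∃ s ∈ S.subTiles n t, y ∈ S.tileSupp n s := by
  have key := S.sub_cover t.1
  constructor
  · rintro ⟨z, hz, rfl⟩
    have h1 : S.scale • z ∈ (fun z => S.scale • z) '' S.supp t.1 := ⟨z, hz, rfl⟩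
    rw [← key] at h1
    simp only [mem_iUnion] at h1
    obtain ⟨q, hq, w, hw, hwz⟩ := h1
    refine ⟨_, ⟨q, hq, rfl⟩, w, hw, ?_⟩
    simp only at hwz ⊢
    rw [pow_succ, mul_smul, ← hwz, smul_add, add_assoc]
  · rintro ⟨_, ⟨q, hq, rfl⟩, w, hw, rfl⟩
    have h1 : q.2 + w ∈ ⋃ s ∈ S.sub t.1, (fun z => s.2 + z) '' S.supp s.1 := by
      simp only [mem_iUnion]
      exact ⟨q, hq, w, hw, rfl⟩
    rw [key] at h1
    obtain ⟨z, hz, hzw⟩ := h1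
    refine ⟨z, hz, ?_⟩
    simp only at hzw ⊢
    rw [pow_succ, mul_smul, hzw, smul_add, add_assoc]

theorem mem_tiles_iff (n : ℕ) (s : S.Tile) :
    s ∈ T.tiles n ↔ ∃ t ∈ T.tiles (n + 1), s ∈ S.subTiles n t := by
  conv_lhs => rw [T.subdivide n]
  simp

theorem shift_subTiles {n : ℕ} {t s : S.Tile} (v : Euc d) (h : s ∈ S.subTiles n t) :
    S.shift v s ∈ S.subTiles n (S.shift v t) := by
  obtain ⟨q, hq, rfl⟩ := h
  exact ⟨q, hq, by simp only [Substitution.shift, Prod.mk.injEq, true_and]; abel⟩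

theorem collar_step {n : ℕ} {t s : S.Tile} (hs : s ∈ S.subTiles n t)
    {v : Euc d} (hc : S.shift v '' T.collar (n + 1) t ⊆ T.tiles (n + 1)) :
    S.shift v '' T.collar n s ⊆ T.collar n (S.shift v s) := by
  rintro _ ⟨s', ⟨hs', y, hy', hy⟩, rfl⟩
  obtain ⟨t', ht', hst'⟩ := (T.mem_tiles_iff n s').1 hs'
  have h1 : S.shift v t' ∈ T.tiles (n + 1) :=
    hc ⟨t', ⟨ht', y, (mem_tileSupp_succ n t' y).2 ⟨s', hst', hy'⟩,
      (mem_tileSupp_succ n t y).2 ⟨s, hs, hy⟩⟩, rfl⟩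
  refine ⟨(T.mem_tiles_iff n _).2 ⟨_, h1, shift_subTiles v hst'⟩, y + v, ?_, ?_⟩
  · rw [shift_tileSupp]; simpa using hy'
  · rw [shift_tileSupp]; simpa using hy

theorem shift_neg_shift (v : Euc d) (t : S.Tile) : S.shift v (S.shift (-v) t) = t := by
  simp [Substitution.shift]

theorem shift_shift_neg (v : Euc d) (t : S.Tile) : S.shift (-v) (S.shift v t) = t := by
  simp [Substitution.shift]

theorem collar_subset (n : ℕ) (t : S.Tile) : T.collar n t ⊆ T.tiles n := fun _ h => h.1

/-- Points that are identified at level `n + 1` are identified at level `n`. -/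
theorem apRel_of_succ {n : ℕ} {x y : Euc d} (h : T.apRel (n + 1) x y) : T.apRel n x y := by
  obtain ⟨t, ht, hx, ht', hc⟩ := h
  obtain ⟨s, hs, hxs⟩ := (mem_tileSupp_succ n t x).1 hx
  set v := y - x
  refine ⟨s, (T.mem_tiles_iff n s).2 ⟨t, ht, hs⟩, hxs,
    (T.mem_tiles_iff n _).2 ⟨_, ht', shift_subTiles v hs⟩, Subset.antisymm ?_ ?_⟩
  · have h2 : S.shift (-v) '' T.collar (n + 1) (S.shift v t) ⊆ T.tiles (n + 1) := by
      rw [hc]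
      rintro _ ⟨_, ⟨r, hr, rfl⟩, rfl⟩
      rw [shift_shift_neg]
      exact hr.1
    intro r hr
    have h3 := T.collar_step (shift_subTiles v hs) h2 ⟨r, hr, rfl⟩
    rw [shift_shift_neg] at h3
    exact ⟨_, h3, shift_neg_shift v r⟩
  · exact T.collar_step hs (by rw [← hc]; exact T.collar_subset _ _)

/-- The map `AP (n + 1) → AP n` induced by the substitution: a level-`(n + 1)` supertile is
subdivided into level-`n` supertiles. -/
def σ (n : ℕ) : T.AP (n + 1) → T.AP n := Quot.map id fun _ _ => T.apRel_of_succ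

/-- The composite `σⁿ : AP n → AP 0`. -/
def descend : ∀ n, T.AP n → T.AP 0
  | 0, p => p
  | n + 1, p => descend n (T.σ n p)

/-! ### Cells -/

/-- The points that lie in exactly the same level-`n` supertiles as `x`. -/
def stratum (n : ℕ) (x : Euc d) : Set (Euc d) :=
  {y | ∀ t ∈ T.tiles n, y ∈ S.tileSupp n t ↔ x ∈ S.tileSupp n t}

/-- The open cell of the level-`n` supertiling of `ℝᵈ` that contains `x`: the component of `x` in
the set of points common to exactly the level-`n` supertiles that contain `x`. So the cells are
the interiors of the supertiles, and the pieces of the intersections of several supertiles. -/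
def openCellAt (n : ℕ) (x : Euc d) : Set (Euc d) := connectedComponentIn (T.stratum n x) x

theorem mem_openCellAt (n : ℕ) (x : Euc d) : x ∈ T.openCellAt n x :=
  mem_connectedComponentIn fun _ _ => Iff.rfl

theorem stratum_subset_succ (n : ℕ) (x : Euc d) : T.stratum n x ⊆ T.stratum (n + 1) x := by
  intro y hy t ht
  rw [mem_tileSupp_succ, mem_tileSupp_succ]
  have h : ∀ s ∈ S.subTiles n t, s ∈ T.tiles n := fun s hs => (T.mem_tiles_iff n s).2 ⟨t, ht, hs⟩
  exact ⟨fun ⟨s, hs, h1⟩ => ⟨s, hs, (hy s (h s hs)).1 h1⟩,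
    fun ⟨s, hs, h1⟩ => ⟨s, hs, (hy s (h s hs)).2 h1⟩⟩

theorem openCellAt_subset_succ (n : ℕ) (x : Euc d) :
    T.openCellAt n x ⊆ T.openCellAt (n + 1) x :=
  connectedComponentIn_mono x (T.stratum_subset_succ n x)

theorem openCellAt_eq {n : ℕ} {x y : Euc d} (h : y ∈ T.openCellAt n x) :
    T.openCellAt n y = T.openCellAt n x := by
  have h1 : y ∈ T.stratum n x := connectedComponentIn_subset _ _ h
  have h2 : T.stratum n y = T.stratum n x := by
    ext z
    exact ⟨fun hz t ht => (hz t ht).trans (h1 t ht), fun hz t ht => (hz t ht).trans (h1 t ht).symm⟩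
  rw [openCellAt, h2]
  exact (connectedComponentIn_eq h).symm

end Tiling

/-! ## The cellular structure of the Anderson-Putnam complexes -/

/-- The structure of a finite CW complex on each `AP n`, the open cells of which are the images of
the cells of the level-`n` supertiling, such that `σ` subdivides every `k`-cell of `AP (n + 1)` into
`k`-cells of `AP n`. The orientation of a cell is that of its characteristic map. -/
structure CellStructure {d : ℕ} {S : Substitution d} (T : Tiling S) where
  cw : ∀ n, Topology.CWComplex (univ : Set (T.AP n))
  finite : ∀ n, letI := cw n; Topology.RelCWComplex.Finite (univ : Set (T.AP n))
  openCell_iff : ∀ n (A : Set (T.AP n)), letI := cw n;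
    (∃ k e, A = Topology.RelCWComplex.openCell (C := (univ : Set (T.AP n))) k e) ↔
      ∃ x, A = T.proj n '' T.openCellAt n x
  subdivides : ∀ n k (e : (cw (n + 1)).cell k), ∃ s : Set ((cw n).cell k),
    T.σ n '' ((cw (n + 1)).map k e '' closedBall 0 1) =
      ⋃ e' ∈ s, (cw n).map k e' '' closedBall 0 1

namespace CellStructure

variable {d : ℕ} {S : Substitution d} {T : Tiling S} (X : CellStructure T)

/-- The `k`-cells of `AP n`. -/
def Cell (n k : ℕ) : Type := (X.cw n).cell k

instance (n k : ℕ) : Finite (X.Cell n k) :=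
  letI := X.cw n
  letI := X.finite n
  Topology.RelCWComplex.FiniteType.finite_cell (C := (univ : Set (T.AP n))) k

instance (n k : ℕ) : Fintype (X.Cell n k) := Fintype.ofFinite _

instance (n k : ℕ) : DecidableEq (X.Cell n k) := Classical.decEq _

/-- The characteristic map of a cell, defined on the open unit ball of `ℝᵏ`. -/
def chart {n k : ℕ} (e : X.Cell n k) : PartialEquiv (Fin k → ℝ) (T.AP n) := (X.cw n).map k e

/-- The open cell. -/
def openCell {n k : ℕ} (e : X.Cell n k) : Set (T.AP n) := X.chart e '' ball 0 1

/-! ### Cochains -/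

/-- The group `C_n^k` of integral cellular `k`-cochains of `AP n`. -/
abbrev Cochain (n k : ℕ) : Type := X.Cell n k → ℤ

open Classical in
/-- The coefficient of `e'` in the image of `e` under the cellular chain map
`σ_* : C_k(AP (n + 1)) → C_k(AP n)`: the degree of `σ` from `e` to `e'`, that is, the sum of the
local degrees of `σ` at the points of `e` over the centre of `e'`. -/
def incidence {n k : ℕ} (e : X.Cell (n + 1) k) (e' : X.Cell n k) : ℤ :=
  ∑ᶠ (x : Fin k → ℝ) (_ : x ∈ ball (0 : Fin k → ℝ) 1 ∧ T.σ n (X.chart e x) = X.chart e' 0),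
    if PreservesOrientationAt (fun y => (X.chart e').symm (T.σ n (X.chart e y))) x then 1 else -1

/-- The map `σᵀ : C_n^k → C_{n+1}^k`. -/
def sigmaT (n k : ℕ) : X.Cochain n k →+ X.Cochain (n + 1) k :=
  (Matrix.mulVecLin (Matrix.of fun (e : X.Cell (n + 1) k) (e' : X.Cell n k) =>
    X.incidence e e')).toAddMonoidHom

/-- The group `C^k`, the direct limit of the `C_n^k` under `σᵀ`. -/
abbrev CochainLim (k : ℕ) : Type := SeqLim fun n => X.sigmaT n k

/-! ### Orientations and the boundary hyperplane condition -/

/-- The `k`-cell `e` is flat: it lies in a `k`-dimensional affine subspace. -/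
def IsFlat {n k : ℕ} (e : X.Cell n k) : Prop :=
  ∃ x, X.openCell e = T.proj n '' T.openCellAt n x ∧
    ∃ Q : AffineSubspace ℝ (Euc d), Module.finrank ℝ Q.direction = k ∧
      T.openCellAt n x ⊆ (Q : Set (Euc d))

/-- The boundary hyperplane condition: all `k`-cells with `k < d` are flat. -/
def BoundaryHyperplane : Prop :=
  ∀ n k, k < d → ∀ e : X.Cell n k, X.IsFlat e

/-- The flat `k`-cell `e` is oriented as the image of `ℝᵏ` under the linear map `L`: a lift of its
characteristic map to `ℝᵈ` is `x ↦ a + L (g x)` with an orientation preserving map `g`. -/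
def OrientedBy {n k : ℕ} (e : X.Cell n k) (L : (Fin k → ℝ) →ₗ[ℝ] Euc d) : Prop :=
  Function.Injective L ∧ ∃ (a x₀ : Euc d) (g : (Fin k → ℝ) → (Fin k → ℝ)),
    ContinuousOn g (ball 0 1) ∧ PreservesOrientationAt g 0 ∧
    ∀ x ∈ ball (0 : Fin k → ℝ) 1,
      a + L (g x) ∈ T.openCellAt n x₀ ∧ T.proj n (a + L (g x)) = X.chart e x

/-- The conventions on orientations: `d`-cells have the standard (right-handed) orientation of
`ℝᵈ`; for `k < d`, the `k`-cells contained in a flat `k`-cell carry the same orientation as that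
cell. The orientations of the cells that are not flat are arbitrary. -/
structure IsOriented : Prop where
  top : ∀ n (e : X.Cell n d),
    X.OrientedBy e ((WithLp.linearEquiv 2 ℝ (Fin d → ℝ)).symm : (Fin d → ℝ) →ₗ[ℝ] Euc d)
  flat : ∀ n k, k < d → ∀ (e : X.Cell (n + 1) k) (e' : X.Cell n k), X.IsFlat e →
    (∃ p ∈ X.openCell e, T.σ n p ∈ X.openCell e') →
    ∃ L, X.OrientedBy e L ∧ X.OrientedBy e' L

/-! ### Punctures and `AF`-groupoids -/

/-- A choice of punctures: `pun k` consists of one point in each open `k`-cell of `AP 0`. -/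
def IsPuncturing (pun : ℕ → Set (T.AP 0)) : Prop :=
  ∀ k ≤ d, (∀ p ∈ pun k, ∃ e : X.Cell 0 k, p ∈ X.openCell e) ∧
    ∀ e : X.Cell 0 k, ∃! p, p ∈ X.openCell e ∧ p ∈ pun k

/-- The `k`-punctures of `AP n`: the points of the open `k`-cells that `σⁿ` sends to `k`-punctures
of `AP 0`. -/
def punctures (pun : ℕ → Set (T.AP 0)) (n k : ℕ) : Set (T.AP n) :=
  {p | (∃ e : X.Cell n k, p ∈ X.openCell e) ∧ T.descend n p ∈ pun k}

/-- The finite-dimensional groupoid of level `n` of the `k`-skeleton: its units are the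
`k`-punctures of `AP n`, with one arrow from `t` to `t'` (the partial homeomorphism `[P, t', t]`
supported on a `k`-cell `P`) when `t` and `t'` lie in the same `k`-cell of `AP n`. -/
def afLevel (pun : ℕ → Set (T.AP 0)) (n k : ℕ) : EqGroupoid where
  Unit := X.punctures pun n k
  rel :=
    { r := fun p q => ∀ e : X.Cell n k, p.1 ∈ X.openCell e ↔ q.1 ∈ X.openCell e
      iseqv := ⟨fun _ _ => Iff.rfl, fun h e => (h e).symm, fun h h' e => (h e).trans (h' e)⟩ }
  top := ⊥

/-- The `k`-punctures of the `k`-skeleton of the inverse limit of the `AP n`. -/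
def LimPuncture (pun : ℕ → Set (T.AP 0)) (k : ℕ) : Type :=
  {p : ∀ n, T.AP n // (∀ n, T.σ n (p (n + 1)) = p n) ∧ ∀ n, p n ∈ X.punctures pun n k}

variable {X}

/-- `p` and `q` are tail equivalent from level `n` on: in every `AP m` with `m ≥ n`, the points
`p m` and `q m` lie in the same copy `U_m` of an open cell of level `n`. -/
def TailRel {pun : ℕ → Set (T.AP 0)} {k : ℕ} (n : ℕ) (p q : X.LimPuncture pun k) : Prop :=
  ∀ m ≥ n, ∀ x : Euc d,
    p.1 m ∈ T.proj m '' T.openCellAt n x ↔ q.1 m ∈ T.proj m '' T.openCellAt n x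

theorem TailRel.symm {pun : ℕ → Set (T.AP 0)} {k n : ℕ} {p q : X.LimPuncture pun k}
    (h : TailRel n p q) : TailRel n q p := fun m hm x => (h m hm x).symm

theorem TailRel.trans {pun : ℕ → Set (T.AP 0)} {k n : ℕ} {p q r : X.LimPuncture pun k}
    (h : TailRel n p q) (h' : TailRel n q r) : TailRel n p r :=
  fun m hm x => (h m hm x).trans (h' m hm x)

theorem TailRel.succ {pun : ℕ → Set (T.AP 0)} {k n : ℕ} {p q : X.LimPuncture pun k}
    (h : TailRel n p q) : TailRel (n + 1) p q := by
  have key : ∀ {p q : X.LimPuncture pun k}, TailRel n p q → ∀ m ≥ n + 1, ∀ x : Euc d,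
      p.1 m ∈ T.proj m '' T.openCellAt (n + 1) x →
        q.1 m ∈ T.proj m '' T.openCellAt (n + 1) x := by
    rintro p q h m hm x ⟨y, hy, hyp⟩
    obtain ⟨z, hz, hzq⟩ := (h m (by omega) y).1 ⟨y, T.mem_openCellAt n y, hyp⟩
    refine ⟨z, ?_, hzq⟩
    rw [← T.openCellAt_eq hy]
    exact T.openCellAt_subset_succ n y hz
  exact fun m hm x => ⟨key h m hm x, key h.symm m hm x⟩

theorem TailRel.mono {pun : ℕ → Set (T.AP 0)} {k n m : ℕ} {p q : X.LimPuncture pun k}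
    (hnm : n ≤ m) (h : TailRel n p q) : TailRel m p q := by
  induction hnm with
  | refl => exact h
  | step _ ih => exact ih.succ

variable (X)

/-- The `AF`-groupoid of the `k`-skeleton: the union over `n` of the tail equivalence relations of
level `n` on the `k`-punctures, with the topology generated by the partial homeomorphisms
`[P, t', t]` supported on single `k`-cells `P` of all levels `n`, where `t` and `t'` are
`k`-punctures in `P`. -/
def afGroupoid (pun : ℕ → Set (T.AP 0)) (k : ℕ) : EqGroupoid where
  Unit := X.LimPuncture pun k
  rel :=
    { r := fun p q => ∃ n, TailRel n p q
      iseqv := ⟨fun _ => ⟨0, fun _ _ _ => Iff.rfl⟩, fun ⟨n, h⟩ => ⟨n, h.symm⟩,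
        fun ⟨n, h⟩ ⟨m, h'⟩ =>
          ⟨max n m, (h.mono (le_max_left n m)).trans (h'.mono (le_max_right n m))⟩⟩ }
  top := TopologicalSpace.generateFrom
    {B | ∃ (n : ℕ) (t' t : T.AP n), B = {a | TailRel n a.1.1 a.1.2 ∧ a.1.1.1 n = t' ∧
      a.1.2.1 n = t}}

/-! ### The identification of cochains with `K₀`-classes at a finite level -/

open Classical in
/-- The isomorphism `c` from `C_n^k` to `K₀` of the finite-dimensional algebra of level `n` sends
(the dual basis element of) each `k`-cell `e` of `AP n` to the class of the projection `e[P, t]`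
(the characteristic function of `[P, t, t]`) with support `P` the cell `e`, for every puncture `t`
in `e`. -/
def IsCF (pun : ℕ → Set (T.AP 0)) {n k : ℕ}
    (c : X.Cochain n k ≃+ K0 (X.afLevel pun n k).reducedCStar) : Prop :=
  ∀ (e : X.Cell n k) (t : X.punctures pun n k), t.1 ∈ X.openCell e →
    ∃ (P : (X.afLevel pun n k).reducedCStar) (hP : IsStarProjection P),
      EqGroupoid.IsRegularRep (G := X.afLevel pun n k)
        (fun a => if a.range = t ∧ a.source = t then 1 else 0) P.1 ∧
      c (Pi.single e 1) = K0.ofProj P hP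

end CellStructure

end SubstTiling

end

noncomputable section

namespace SubstTiling

/-! ## Embedded balls have interior -/

/-! ### Non-existence of smooth retractions of the ball onto the sphere -/

section Retraction

open MeasureTheory

variable {E : Type*} [NormedAddCommGroup E] [InnerProductSpace ℝ E] [FiniteDimensional ℝ E]

/-! Points of `ℝᵈ` with the same image in an Anderson-Putnam complex lie in the same supertiles up
to translation, so cells of lower levels are translated along with them (`add_mem_openCellAt`),
while two distinct points of one stratum are never identified (`eq_of_mem_stratum`). Hence a point
of an open `k`-cell `e` of `AP (n + 1)` over an open `k`-cell `e'` of `AP n` lies in a whole copy of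
`e'` inside `e`, and `σ` maps this copy bijectively to `e'`. The number of points of `e` over a
point of `e'` is therefore independent of that point (`ncard_fiber_eq`). If the cells are coherently
oriented then all local degrees of `σ` are `1`, because lifts of `σ` to `ℝᵈ` are locally
translations, and this number is the entry of the cellular chain map (`IsCoherent.incidence_eq`). So
`σᵀ` sends the dual of a cell to the sum of the duals of the cells of the punctures over any one
puncture of the cell: these are the multiplicities of a Bratteli diagram.

On the operator side, the sets of arrows `[P, s, t]` are compact open bisections (`isCompact_box`,
`eq_of_mem_box`). Their characteristic functions are matrix units of level `n`, each level embeds in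
the next one with the same multiplicities, and the union of the levels is dense
(`isDense_unitSystem`). The group `K₀` of such a limit is computed in
`UnitSystem.nonempty_K0_equiv`: projections and partial isometries over the limit are perturbed into
a finite level, every projection of a finite level is a sum of diagonal units, and traces on the
cells recover the multiplicities. One point needs care: a puncture through which no sequence of
punctures passes gives the operator `0`, and its class has to vanish in the limit of the cochains;
this is a compactness argument (`TailSystem.exists_seqMap_eq_zero`).

Orientations are coherent for `k = d` by convention, and for `k < d` under the boundary hyperplane
condition, which gives the first and the third claim. The second claim needs no coherence: a single
level is a constant system, whose map to `K₀` is bijective (`bijective_toK0`), and conjugating the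
maps of a sequence by isomorphisms does not change its limit.

The geometry rests on local finiteness of the supertilings. It holds because supports homeomorphic
to a ball contain a ball (`interior_nonempty_of_homeomorph_closedBall`), which is deduced from the
non-existence of smooth retractions. -/

theorem exists_polynomial_eval_det_one_add_smul (A : E →L[ℝ] E) :
    ∃ p : Polynomial ℝ, p.natDegree ≤ Module.finrank ℝ E ∧
      ∀ t : ℝ, p.eval t = (ContinuousLinearMap.id ℝ E + t • A).det := by
  let b := Module.finBasis ℝ E
  let M := LinearMap.toMatrix b b (A : E →ₗ[ℝ] E)
  refine ⟨Matrix.det ((Polynomial.X : Polynomial ℝ) • M.map Polynomial.C +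
    (1 : Matrix _ _ ℝ).map Polynomial.C), ?_, fun t => ?_⟩
  · simpa using Polynomial.natDegree_det_X_add_C_le M 1
  · rw [ContinuousLinearMap.det, ← LinearMap.det_toMatrix b, ← Polynomial.coe_evalRingHom,
      RingHom.map_det]
    congr 1
    ext i j
    simp [M, LinearMap.toMatrix_apply, Matrix.one_apply, Finsupp.single_apply, add_comm, eq_comm]
    split_ifs <;> simp [mul_comm]

/-- For `s` in `[0, t]` the operator `s • A` has norm less than `1`, so `1 + s • A` is injective and
its determinant does not vanish. The determinant is continuous in `s` and equal to `1` at `0`, so it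
stays positive. -/
theorem det_one_add_smul_pos {A : E →L[ℝ] E} {t : ℝ} (ht : 0 ≤ t) (h : t * ‖A‖ < 1) :
    0 < (ContinuousLinearMap.id ℝ E + t • A).det := by
  obtain ⟨p, -, hp⟩ := exists_polynomial_eval_det_one_add_smul A
  have hne : ∀ s ∈ Icc 0 t, p.eval s ≠ 0 := by
    intro s hs h0
    rw [hp, ContinuousLinearMap.det] at h0
    obtain ⟨v, hv, hv0⟩ := Submodule.exists_mem_ne_zero_of_ne_bot (LinearMap.bot_lt_ker_of_det_eq_zero h0).ne'
    have h1 : v + s • A v = 0 := by simpa using hv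
    have h2 : ‖v‖ ≤ s * ‖A‖ * ‖v‖ := by
      calc ‖v‖ = ‖s • A v‖ := by
            rw [← norm_neg (s • A v), ← eq_neg_of_add_eq_zero_left h1]
        _ = s * ‖A v‖ := by rw [norm_smul, Real.norm_of_nonneg hs.1]
        _ ≤ s * (‖A‖ * ‖v‖) := by gcongr; exact hs.1; exact A.le_opNorm v
        _ = _ := by ring
    have h3 : s * ‖A‖ < 1 := lt_of_le_of_lt (by gcongr; exact hs.2) h
    have h4 := norm_pos_iff.2 hv0
    nlinarith
  rw [← hp]
  by_contra hcon
  have h0 : p.eval 0 = 1 := by rw [hp]; simp [ContinuousLinearMap.det]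
  obtain ⟨s, hs, hs0⟩ := intermediate_value_Icc' ht p.continuous.continuousOn
    (show (0 : ℝ) ∈ Icc (p.eval t) (p.eval 0) from ⟨not_lt.1 hcon, by rw [h0]; exact zero_le_one⟩)
  exact hne s hs hs0

omit [FiniteDimensional ℝ E] in
/-- Extending by zero a map that vanishes on the unit sphere keeps a Lipschitz bound. -/
theorem lipschitzWith_indicator_closedBall {g : E → E} {L : NNReal}
    (hg : LipschitzOnWith L g (closedBall 0 1)) (h0 : ∀ x, ‖x‖ = 1 → g x = 0) :
    LipschitzWith L ((closedBall (0 : E) 1).indicator g) := by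
  have key : ∀ x ∈ closedBall (0 : E) 1, ∀ y ∉ closedBall (0 : E) 1, dist (g x) 0 ≤ L * dist x y := by
    intro x hx y hy
    obtain ⟨z, hz, hz1⟩ : ∃ z ∈ segment ℝ x y, ‖z‖ = 1 := by
      have hc := (convex_segment (𝕜 := ℝ) x y).isPreconnected
      exact hc.intermediate_value (left_mem_segment ℝ x y) (right_mem_segment ℝ x y)
        continuous_norm.continuousOn ⟨by simpa using hx, by simpa using (not_le.1 (by simpa using hy)).le⟩
    have h1 := hg.dist_le_mul x hx z (by simp [hz1])
    rw [h0 z hz1] at h1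
    refine h1.trans ?_
    gcongr
    have := dist_add_dist_of_mem_segment hz
    linarith [dist_nonneg (x := z) (y := y)]
  refine LipschitzWith.of_dist_le_mul fun x y => ?_
  by_cases hx : x ∈ closedBall (0 : E) 1 <;> by_cases hy : y ∈ closedBall (0 : E) 1
  · rw [indicator_of_mem hx, indicator_of_mem hy]; exact hg.dist_le_mul x hx y hy
  · rw [indicator_of_mem hx, indicator_of_notMem hy]; exact key x hx y hy
  · rw [indicator_of_notMem hx, indicator_of_mem hy, dist_comm, dist_comm x]; exact key y hy x hx
  · rw [indicator_of_notMem hx, indicator_of_notMem hy, dist_self]; positivity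

/-- There is no `C¹` retraction of the ball to the sphere. -/
theorem no_smooth_retraction {r : E → E} (hr : ContDiff ℝ 1 r) (h1 : ∀ x, ‖r x‖ = 1)
    (h2 : ∀ x, ‖x‖ = 1 → r x = x) : False := by
  let _ : MeasurableSpace E := borel E
  have : BorelSpace E := ⟨rfl⟩
  set B := closedBall (0 : E) 1
  let g : E → E := fun x => r x - x
  have hg : ContDiff ℝ 1 g := hr.sub contDiff_id
  have hgc : Continuous (fderiv ℝ g) := hg.continuous_fderiv one_ne_zero
  obtain ⟨M, hM⟩ := (isCompact_closedBall (0 : E) 1).exists_bound_of_continuousOn hgc.continuousOn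
  have hM0 : 0 ≤ M := (norm_nonneg _).trans (hM 0 (by simp))
  set L : NNReal := ⟨M, hM0⟩
  have hgL : LipschitzOnWith L g B :=
    (convex_closedBall (0 : E) 1).lipschitzOnWith_of_nnnorm_fderiv_le (𝕜 := ℝ)
      (fun x _ => (hg.differentiable one_ne_zero).differentiableAt) fun x hx => hM x hx
  have hgi := lipschitzWith_indicator_closedBall hgL fun x hx => by simp [g, h2 x hx]
  have hfd : ∀ (t : ℝ) (x : E), HasFDerivAt (fun x => x + t • g x)
      (ContinuousLinearMap.id ℝ E + t • fderiv ℝ g x) x := fun t x =>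
    (hasFDerivAt_id x).add
      (((hg.differentiable one_ne_zero).differentiableAt (x := x)).hasFDerivAt.fun_const_smul t)
  -- For small `t` the map `x + t • g x` is a bijection of the ball, so its Jacobian integrates to
  -- the volume of the ball. The integrand is polynomial in `t`, which carries this identity to `t =
  -- 1`, where the Jacobian vanishes.
  have vol : ∀ t : ℝ, 0 ≤ t → t ≤ 1 → t * M < 1 →
      ∫ x in B, (ContinuousLinearMap.id ℝ E + t • fderiv ℝ g x).det = volume.real B := by
    intro t ht ht1 htM
    -- A solution of `x + t • g x = y` is a fixed point of a contraction of the whole space once `g`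
    -- is cut off outside the ball. A fixed point outside the ball would have to be `y` itself.
    have hcontr : ∀ y : E, ContractingWith (t.toNNReal * L) fun x => y - t • B.indicator g x := by
      refine fun y => ⟨by rw [← NNReal.coe_lt_coe, NNReal.coe_mul, Real.coe_toNNReal t ht]; exact htM,
        LipschitzWith.of_dist_le_mul fun a b => ?_⟩
      rw [dist_sub_left, dist_smul₀, Real.norm_of_nonneg ht]
      have := hgi.dist_le_mul a b
      calc t * _ ≤ t * (L * dist a b) := by gcongr
        _ = _ := by rw [NNReal.coe_mul, Real.coe_toNNReal t ht, mul_assoc]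
    have hinj : InjOn (fun x => x + t • g x) B := by
      intro a ha b hb hab
      refine (hcontr (a + t • g a)).fixedPoint_unique' ?_ ?_
      · simp [Function.IsFixedPt, indicator_of_mem ha]
      · simp only at hab
        simp [Function.IsFixedPt, indicator_of_mem hb, hab]
    have himg : (fun x => x + t • g x) '' B = B := by
      apply Subset.antisymm
      · rintro _ ⟨x, hx, rfl⟩
        have : x + t • g x = (1 - t) • x + t • r x := by simp only [g]; module
        simp only [this]
        exact (convex_closedBall (0 : E) 1) hx (by simp [h1]) (by linarith) ht (by ring)
      · intro y hy
        obtain ⟨x, hx, -⟩ := (hcontr y).exists_fixedPoint y (edist_ne_top _ _)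
        have hx' : x + t • B.indicator g x = y := by
          have := hx.eq
          rw [← eq_sub_iff_add_eq]; exact this.symm
        by_cases hxB : x ∈ B
        · exact ⟨x, hxB, by rwa [indicator_of_mem hxB] at hx'⟩
        · rw [indicator_of_notMem hxB, smul_zero, add_zero] at hx'
          exact absurd (hx' ▸ hy) hxB
    have hcv := integral_image_eq_integral_abs_det_fderiv_smul (volume : Measure E)
      measurableSet_closedBall (fun x _ => (hfd t x).hasFDerivWithinAt) hinj (fun _ => (1 : ℝ))
    rw [himg] at hcv
    simp only [smul_eq_mul, mul_one, integral_const, MeasurableSet.univ, measureReal_restrict_apply,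
      univ_inter] at hcv
    rw [hcv]
    refine setIntegral_congr_fun measurableSet_closedBall fun x hx => ?_
    have : 0 < (ContinuousLinearMap.id ℝ E + t • fderiv ℝ g x).det :=
      det_one_add_smul_pos ht (lt_of_le_of_lt (by gcongr; exact hM x hx) htM)
    rw [abs_of_pos this]
  -- If the derivative of `r` were invertible, some direction would be sent to `r x`; in that
  -- direction the constant function `‖r‖ ^ 2` would have derivative `2`.
  have hzero : ∀ x, (ContinuousLinearMap.id ℝ E + (1 : ℝ) • fderiv ℝ g x).det = 0 := by
    intro x
    by_contra hne
    have hr' : HasFDerivAt r (ContinuousLinearMap.id ℝ E + (1 : ℝ) • fderiv ℝ g x) x := by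
      have := hfd 1 x
      simpa [g] using this
    have hsq : HasFDerivAt (fun y => ‖r y‖ ^ 2) _ x := hr'.norm_sq
    have hc : (fun y => ‖r y‖ ^ 2) = fun _ => (1 : ℝ) := by ext y; simp [h1]
    rw [hc] at hsq
    have h0 := hsq.unique (hasFDerivAt_const (1 : ℝ) x)
    let e := LinearMap.equivOfDetNeZero _ hne
    have h3 := DFunLike.congr_fun h0 (e.symm (r x))
    have h4 : (ContinuousLinearMap.id ℝ E + (1 : ℝ) • fderiv ℝ g x) (e.symm (r x)) = r x :=
      e.apply_symm_apply (r x)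
    simp only [smul_apply, ContinuousLinearMap.comp_apply, h4] at h3
    simp [h1] at h3
  obtain ⟨δ, hδ, hδ1, hδM⟩ : ∃ δ : ℝ, 0 < δ ∧ δ ≤ 1 ∧ δ * M < 1 :=
    ⟨1 / (M + 1), by positivity, by rw [div_le_one (by positivity)]; linarith,
      by rw [div_mul_eq_mul_div, div_lt_one (by positivity)]; linarith⟩
  set n := Module.finrank ℝ E
  -- A polynomial of degree at most `n` is determined by its values at `n + 1` distinct nodes. The
  -- nodes are taken in `(0, δ]`, where `vol` applies, and the interpolation formula is evaluated at
  -- `1`.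
  let v : ℕ → ℝ := fun i => δ / (i + 1)
  have hv0 : ∀ i, 0 ≤ v i := fun i => by positivity
  have hvδ : ∀ i, v i ≤ δ := fun i => div_le_self hδ.le (by linarith [Nat.cast_nonneg (α := ℝ) i])
  have hvinj : InjOn v (Finset.range (n + 1)) := by
    intro i _ j _ hij
    simp only [v] at hij
    rw [div_eq_div_iff (by positivity) (by positivity)] at hij
    have := mul_left_cancel₀ hδ.ne' hij
    have : (i : ℝ) = j := by linarith
    exact_mod_cast this
  have hint : ∀ x, (0 : ℝ) = ∑ i ∈ Finset.range (n + 1),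
      (ContinuousLinearMap.id ℝ E + v i • fderiv ℝ g x).det *
        (Lagrange.basis (Finset.range (n + 1)) v i).eval 1 := by
    intro x
    obtain ⟨p, hp, hpe⟩ := exists_polynomial_eval_det_one_add_smul (fderiv ℝ g x)
    have hdeg : p.degree < (Finset.range (n + 1)).card := by
      rw [Finset.card_range]
      exact lt_of_le_of_lt Polynomial.degree_le_natDegree (by exact_mod_cast Nat.lt_succ_of_le hp)
    have h := congrArg (Polynomial.eval 1) (Lagrange.eq_interpolate hvinj hdeg)
    rw [hpe, hzero, Lagrange.interpolate_apply, Polynomial.eval_finsetSum] at h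
    rw [h]
    refine Finset.sum_congr rfl fun i _ => ?_
    rw [Polynomial.eval_mul, Polynomial.eval_C, hpe]
  have hcont : ∀ t : ℝ, Continuous fun x => (ContinuousLinearMap.id ℝ E + t • fderiv ℝ g x).det :=
    fun t => ContinuousLinearMap.continuous_det.comp (continuous_const.add (hgc.const_smul t))
  have hI : (0 : ℝ) = volume.real B := by
    calc (0 : ℝ) = ∫ x in B, (0 : ℝ) := by simp
      _ = ∫ x in B, ∑ i ∈ Finset.range (n + 1),
        (ContinuousLinearMap.id ℝ E + v i • fderiv ℝ g x).det *
          (Lagrange.basis (Finset.range (n + 1)) v i).eval 1 := by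
            exact integral_congr_ae (Filter.Eventually.of_forall hint)
      _ = ∑ i ∈ Finset.range (n + 1), volume.real B *
          (Lagrange.basis (Finset.range (n + 1)) v i).eval 1 := by
        rw [integral_finsetSum]
        · refine Finset.sum_congr rfl fun i _ => ?_
          rw [integral_mul_const, vol _ (hv0 i) ((hvδ i).trans hδ1)
            (lt_of_le_of_lt (by gcongr; exact hvδ i) hδM)]
        · intro i _
          exact (((hcont (v i)).mul continuous_const).continuousOn.integrableOn_compact
            (isCompact_closedBall _ _))
      _ = volume.real B := by
        rw [← Finset.mul_sum, ← Polynomial.eval_finsetSum,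
          Lagrange.sum_basis hvinj ⟨0, by simp⟩]
        simp
  have hpos : 0 < volume.real B := by
    rw [Measure.real, ENNReal.toReal_pos_iff]
    exact ⟨measure_closedBall_pos _ _ one_pos, (isCompact_closedBall _ _).measure_lt_top⟩
  linarith

/-- A smooth self-map of Euclidean space that is the identity outside the unit ball has a zero. -/
theorem exists_zero_of_eq_id_outside_ball {H : E → E} (hH : ContDiff ℝ 1 H)
    (h1 : ∀ x, 1 ≤ ‖x‖ → H x = x) : ∃ x, H x = 0 := by
  by_contra! hne
  refine no_smooth_retraction (r := fun x => ‖H x‖⁻¹ • H x)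
    (((hH.norm ℝ hne).inv fun x => by simpa using hne x).smul hH) (fun x => ?_) fun x hx => ?_
  · rw [norm_smul, norm_inv, norm_norm, inv_mul_cancel₀ (by simpa using hne x)]
  · simp [h1 x hx.ge, hx]

end Retraction

/-! ### Interior points of embedded balls -/

section EmbeddedBall

open MeasureTheory Topology

variable {E : Type*} [NormedAddCommGroup E] [InnerProductSpace ℝ E] [FiniteDimensional ℝ E]

/-- A smooth map sends compact sets without interior to sets without interior. -/
theorem interior_image_eq_empty {F : E → E} (hF : ContDiff ℝ 1 F) {K : Set E} (hK : IsCompact K)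
    (hint : interior K = ∅) : interior (F '' K) = ∅ := by
  let _ : MeasurableSpace E := borel E
  have : BorelSpace E := ⟨rfl⟩
  by_contra hne
  have hdet : Continuous fun x => (fderiv ℝ F x).det :=
    ContinuousLinearMap.continuous_det.comp (hF.continuous_fderiv one_ne_zero)
  -- The critical points in `K` have a null image, so an open part of `F '' K` contains a closed
  -- ball that avoids this image. Over the ball, `F` is a local diffeomorphism at the points of `K`,
  -- so small pieces of `K` have closed images without interior, and finitely many of these cannot
  -- cover the ball.
  set C := K ∩ {x | (fderiv ℝ F x).det = 0}
  have hC : IsCompact C := hK.inter_right (isClosed_eq hdet continuous_const)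
  have hnull : (volume : Measure E) (F '' C) = 0 :=
    addHaar_image_eq_zero_of_det_fderivWithin_eq_zero (volume : Measure E)
      (fun x _ => ((hF.differentiable one_ne_zero) x).hasFDerivAt.hasFDerivWithinAt)
      fun x hx => hx.2
  obtain ⟨c, hcU, hcC⟩ : (interior (F '' K) \ F '' C).Nonempty := by
    by_contra hem
    rw [not_nonempty_iff_eq_empty, sdiff_eq_empty] at hem
    exact (isOpen_interior.measure_pos volume (nonempty_iff_ne_empty.2 hne)).ne'
      (measure_mono_null hem hnull)
  obtain ⟨ρ, hρ, hball⟩ := nhds_basis_closedBall.mem_iff.1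
    ((isOpen_interior.sdiff (hC.image hF.continuous).isClosed).mem_nhds ⟨hcU, hcC⟩)
  set K' := K ∩ F ⁻¹' closedBall c ρ
  have hK' : IsCompact K' := hK.inter_right (isClosed_closedBall.preimage hF.continuous)
  obtain ⟨Z, hZ, hZi, hKZ⟩ : ∃ Z, IsClosed Z ∧ interior Z = ∅ ∧ F '' K' ⊆ Z := by
    refine hK'.induction_on (p := fun s => ∃ Z, IsClosed Z ∧ interior Z = ∅ ∧ F '' s ⊆ Z)
      ⟨∅, isClosed_empty, interior_empty, by simp⟩ ?_ ?_ ?_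
    · rintro s t hst ⟨Z, h1, h2, h3⟩
      exact ⟨Z, h1, h2, (image_mono hst).trans h3⟩
    · rintro s t ⟨Z, h1, h2, h3⟩ ⟨Z', h1', h2', h3'⟩
      exact ⟨Z ∪ Z', h1.union h1', by rw [interior_union_isClosed_of_interior_empty h1 h2', h2],
        by rw [image_union]; exact union_subset_union h3 h3'⟩
    · intro x hx
      have hx0 : (fderiv ℝ F x).det ≠ 0 := fun h0 => (hball hx.2).2 ⟨x, ⟨hx.1, h0⟩, rfl⟩
      let e' := (LinearMap.equivOfDetNeZero _ hx0).toContinuousLinearEquiv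
      have he' : (e' : E →L[ℝ] E) = fderiv ℝ F x := by ext v; rfl
      have hst : HasStrictFDerivAt F (e' : E →L[ℝ] E) x := by
        rw [he']; exact hF.contDiffAt.hasStrictFDerivAt one_ne_zero
      let e := hst.toOpenPartialHomeomorph F
      have hes : x ∈ e.source := hst.mem_toOpenPartialHomeomorph_source
      obtain ⟨r, hr, hrs⟩ := nhds_basis_closedBall.mem_iff.1 (e.open_source.mem_nhds hes)
      refine ⟨K' ∩ closedBall x r, inter_mem_nhdsWithin _ (closedBall_mem_nhds x hr),
        F '' (K' ∩ closedBall x r),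
        ((hK'.inter_right isClosed_closedBall).image hF.continuous).isClosed, ?_, subset_rfl⟩
      by_contra hV
      obtain ⟨_, hw⟩ := nonempty_iff_ne_empty.2 hV
      obtain ⟨y, hy, rfl⟩ := interior_subset hw
      have hsub : e.source ∩ F ⁻¹' interior (F '' (K' ∩ closedBall x r)) ⊆ K := by
        rintro z ⟨hz, hzV⟩
        obtain ⟨y', hy', hyz⟩ := interior_subset hzV
        have : y' = z := e.injOn (hrs hy'.2) hz hyz
        exact this ▸ hy'.1.1
      have hopen := e.open_source.inter (isOpen_interior.preimage hF.continuous
        (t := interior (F '' (K' ∩ closedBall x r))))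
      have : y ∈ interior K := interior_maximal hsub hopen ⟨hrs hy.2, hw⟩
      rw [hint] at this
      exact this
  have hsub : ball c ρ ⊆ Z := by
    intro y hy
    obtain ⟨x, hx, rfl⟩ := interior_subset (hball (ball_subset_closedBall hy)).1
    exact hKZ ⟨x, ⟨hx, ball_subset_closedBall hy⟩, rfl⟩
  have : c ∈ interior Z := interior_maximal hsub isOpen_ball (mem_ball_self hρ)
  rw [hZi] at this
  exact this

/-- A subset of Euclidean space that is homeomorphic to the closed unit ball has interior points. -/
theorem interior_nonempty_of_homeomorph_closedBall {K : Set E} (φ : K ≃ₜ closedBall (0 : E) 1) :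
    (interior K).Nonempty := by
  by_contra hne
  rw [not_nonempty_iff_eq_empty] at hne
  have hKc : CompactSpace K := φ.symm.compactSpace
  have hK : IsCompact K := isCompact_iff_compactSpace.2 hKc
  have : TietzeExtension E := TietzeExtension.of_tvs ℝ
  -- `G` and `Φ` extend the homeomorphism and its inverse to the whole space, so that `G ∘ Φ` is the
  -- identity on the ball.
  obtain ⟨G, hG⟩ := ContinuousMap.exists_restrict_eq hK.isClosed
    ⟨fun x => (φ x : E), continuous_subtype_val.comp φ.continuous⟩
  obtain ⟨Φ, hΦ⟩ := ContinuousMap.exists_restrict_eq (isClosed_closedBall (x := (0 : E)) (ε := 1))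
    ⟨fun x => (φ.symm x : E), continuous_subtype_val.comp φ.symm.continuous⟩
  have hGΦ : ∀ x ∈ closedBall (0 : E) 1, Φ x ∈ K ∧ G (Φ x) = x := by
    intro x hx
    have h1 : Φ x = φ.symm ⟨x, hx⟩ := DFunLike.congr_fun hΦ ⟨x, hx⟩
    have h2 : G (φ.symm ⟨x, hx⟩ : E) = φ (φ.symm ⟨x, hx⟩) := DFunLike.congr_fun hG (φ.symm ⟨x, hx⟩)
    rw [h1, h2]
    exact ⟨Subtype.coe_prop _, by simp⟩
  obtain ⟨F, hF, hFG, -⟩ := G.continuous.exists_contDiff_approx 1 (ε := fun _ => 1 / 8)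
    continuous_const (fun _ => by norm_num)
  -- As `F '' K` has no interior, it misses some `c` close to `0`, so `F - c` has no zero on `K`.
  -- Composing with a smooth approximation `ψ` of `Φ` gives a map without zeros on the ball that
  -- stays within `1 / 8 + 1 / 8 + 1 / 4 = 1 / 2` of the identity.
  obtain ⟨c, hc, hcK⟩ : ∃ c : E, ‖c‖ < 1 / 8 ∧ c ∉ F '' K := by
    by_contra! hcon
    have : (0 : E) ∈ interior (F '' K) := interior_maximal (s := F '' K) (t := ball 0 (1 / 8))
      (fun x hx => hcon x (by simpa using hx)) isOpen_ball (mem_ball_self (by norm_num))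
    rw [interior_image_eq_empty (by exact_mod_cast hF) hK hne] at this
    exact this
  have hFc := hF.continuous
  have hopen : IsOpen {p : E × E | F p.2 - c ≠ 0 ∧ ‖F p.2 - F (Φ p.1)‖ < 1 / 4} :=
    (isOpen_ne_fun (show Continuous fun p : E × E => F p.2 - c by fun_prop) continuous_const).inter
      (isOpen_lt (show Continuous fun p : E × E => ‖F p.2 - F (Φ p.1)‖ by fun_prop)
        continuous_const)
  have hcomp : IsCompact ((fun x => (x, Φ x)) '' closedBall (0 : E) 1) :=
    (isCompact_closedBall _ _).image (by fun_prop)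
  obtain ⟨η, hη, hηsub⟩ := hcomp.exists_thickening_subset_open hopen (by
    rintro _ ⟨x, hx, rfl⟩
    refine ⟨fun h0 => hcK ⟨Φ x, (hGΦ x hx).1, sub_eq_zero.1 h0⟩, by simp⟩)
  obtain ⟨ψ, hψ, hψΦ, -⟩ := Φ.continuous.exists_contDiff_approx 1 (ε := fun _ => η)
    continuous_const (fun _ => hη)
  have hH1 : ∀ x ∈ closedBall (0 : E) 1, F (ψ x) - c ≠ 0 ∧ ‖F (ψ x) - c - x‖ < 1 / 2 := by
    intro x hx
    have h1 : (x, ψ x) ∈ thickening η ((fun x => (x, Φ x)) '' closedBall (0 : E) 1) :=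
      mem_thickening_iff.2 ⟨_, ⟨x, hx, rfl⟩, by simpa [Prod.dist_eq, hη] using hψΦ x⟩
    obtain ⟨h2, h3⟩ := hηsub h1
    refine ⟨h2, ?_⟩
    have h4 : ‖F (Φ x) - x‖ < 1 / 8 := by
      have := hFG (Φ x)
      rwa [(hGΦ x hx).2, dist_eq_norm] at this
    simp only at h3
    calc ‖F (ψ x) - c - x‖ = ‖(F (ψ x) - F (Φ x)) + (F (Φ x) - x) - c‖ := by congr 1; abel
      _ ≤ ‖(F (ψ x) - F (Φ x)) + (F (Φ x) - x)‖ + ‖c‖ := norm_sub_le _ _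
      _ ≤ ‖F (ψ x) - F (Φ x)‖ + ‖F (Φ x) - x‖ + ‖c‖ := by gcongr; exact norm_add_le _ _
      _ < 1 / 2 := by linarith
  -- Interpolation with the identity between the radii `3 / 4` and `1` creates no zero, since the
  -- perturbation has norm less than `1 / 2` there.
  let χ : ContDiffBump (0 : E) := ⟨3 / 4, 1, by norm_num, by norm_num⟩
  obtain ⟨x, hx⟩ := exists_zero_of_eq_id_outside_ball
    (H := fun x => x + χ x • (F (ψ x) - c - x))
    (contDiff_id.add (χ.contDiff.smul (((hF.comp hψ).sub contDiff_const).sub contDiff_id))) (by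
      intro x hx
      have : χ x = 0 := χ.zero_of_le_dist (by simpa [χ] using hx)
      simp [this])
  by_cases hx1 : ‖x‖ ≤ 3 / 4
  · have h1 : χ x = 1 := χ.one_of_mem_closedBall (by simpa [χ] using hx1)
    have h2 := (hH1 x (by simp; linarith)).1
    simp only [h1, one_smul, add_sub_cancel] at hx
    exact h2 hx
  · by_cases hx2 : ‖x‖ ≤ 1
    · have h2 := (hH1 x (by simpa using hx2)).2
      have h3 : ‖x‖ = ‖χ x • (F (ψ x) - c - x)‖ := by
        rw [← norm_neg (χ x • _), ← eq_neg_of_add_eq_zero_left hx]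
      rw [norm_smul, Real.norm_of_nonneg χ.nonneg] at h3
      have h4 := χ.le_one (x := x)
      nlinarith [χ.nonneg (x := x), norm_nonneg (F (ψ x) - c - x)]
    · have : χ x = 0 := χ.zero_of_le_dist (by simpa [χ] using (not_le.1 hx2).le)
      simp only [this, zero_smul, add_zero] at hx
      simp [hx] at hx2

end EmbeddedBall

/-! ## Local finiteness of the supertilings -/

theorem finite_of_separated {E : Type*} [PseudoMetricSpace E] [ProperSpace E] {ι : Type*} {s : Set ι}
    (c : ι → E) {ε : ℝ} (hε : 0 < ε) (hb : Bornology.IsBounded (c '' s))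
    (hs : ∀ i ∈ s, ∀ j ∈ s, i ≠ j → ε ≤ dist (c i) (c j)) : s.Finite := by
  rcases s.eq_empty_or_nonempty with rfl | ⟨i₀, -⟩
  · exact finite_empty
  have : Nonempty E := ⟨c i₀⟩
  obtain ⟨F, -, hF, hcov⟩ := hb.isCompact_closure.finite_cover_balls (half_pos hε)
  have h1 : ∀ i ∈ s, ∃ x ∈ F, c i ∈ ball x (ε / 2) := fun i hi => by
    simpa using hcov (subset_closure ⟨i, hi, rfl⟩)
  choose! f hfF hf using h1
  refine Finite.of_injOn (f := f) (t := F) hfF (fun i hi j hj hij => ?_) hF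
  by_contra hne
  have h2 := hs i hi j hj hne
  have h3 := hf i hi
  have h4 := hf j hj
  rw [← hij] at h4
  rw [mem_ball] at h3 h4
  have := dist_triangle_right (c i) (c j) (f i)
  linarith

namespace Substitution

variable {d : ℕ} (S : Substitution d)

theorem isCompact_supp (p : S.Proto) : IsCompact (S.supp p) := by
  obtain ⟨φ⟩ := S.supp_ball p
  have : CompactSpace (S.supp p) := φ.symm.compactSpace
  exact isCompact_iff_compactSpace.2 this

theorem scale_pow_pos (n : ℕ) : 0 < S.scale ^ n := pow_pos (zero_lt_one.trans S.one_lt_scale) n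

theorem isCompact_tileSupp (n : ℕ) (t : S.Tile) : IsCompact (S.tileSupp n t) :=
  (S.isCompact_supp t.1).image (by fun_prop)

/-- Each support contains a ball because it is homeomorphic to one. There are finitely many
prototiles, so one radius serves for all, and inflation scales it. -/
theorem exists_ball_subset_tileSupp : ∃ ρ > 0, ∃ c : S.Proto → Euc d, ∀ n (t : S.Tile),
    ball (t.2 + S.scale ^ n • c t.1) (S.scale ^ n * ρ) ⊆ S.tileSupp n t := by
  have h1 : ∀ p, ∃ c, ∃ ρ > 0, ball c ρ ⊆ S.supp p := by
    intro p
    obtain ⟨φ⟩ := S.supp_ball p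
    obtain ⟨c, hc⟩ := interior_nonempty_of_homeomorph_closedBall φ
    exact ⟨c, mem_nhds_iff.1 (mem_interior_iff_mem_nhds.1 hc)⟩
  choose c ρ hρ hc using h1
  have := S.finite_proto
  obtain ⟨r, hr, hrρ⟩ : ∃ r > 0, ∀ p, r ≤ ρ p := by
    rcases isEmpty_or_nonempty S.Proto with h | h
    · exact ⟨1, one_pos, fun p => (h.false p).elim⟩
    · obtain ⟨p, hp⟩ := Finite.exists_min ρ
      exact ⟨ρ p, hρ p, hp⟩
  refine ⟨r, hr, c, fun n t y hy => ?_⟩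
  have hn := S.scale_pow_pos n
  refine ⟨(S.scale ^ n)⁻¹ • (y - t.2), hc _ ?_, ?_⟩
  · rw [mem_ball, dist_eq_norm] at hy ⊢
    have : y - (t.2 + S.scale ^ n • c t.1) =
        S.scale ^ n • ((S.scale ^ n)⁻¹ • (y - t.2) - c t.1) := by
      rw [smul_sub, smul_inv_smul₀ hn.ne']; abel
    rw [this, norm_smul, Real.norm_of_nonneg hn.le] at hy
    exact (lt_of_mul_lt_mul_left hy hn.le).trans_le (hrρ _)
  · simp only [smul_inv_smul₀ hn.ne']; abel

theorem exists_tileSupp_subset_closedBall (n : ℕ) :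
    ∃ R, ∀ t : S.Tile, S.tileSupp n t ⊆ closedBall t.2 R := by
  have := S.finite_proto
  have h1 : ∀ p, ∃ R, S.supp p ⊆ closedBall 0 R := fun p =>
    (S.isCompact_supp p).isBounded.subset_closedBall 0
  choose R hR using h1
  obtain ⟨M, hM⟩ := (Set.finite_range R).bddAbove
  refine ⟨S.scale ^ n * M, ?_⟩
  rintro t _ ⟨z, hz, rfl⟩
  have h2 := hR _ hz
  rw [mem_closedBall, dist_zero_right] at h2
  rw [mem_closedBall, dist_eq_norm]
  simp only [add_sub_cancel_left, norm_smul, Real.norm_of_nonneg (S.scale_pow_pos n).le]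
  have := S.scale_pow_pos n
  gcongr
  exact h2.trans (hM ⟨_, rfl⟩)

end Substitution

namespace Tiling

variable {d : ℕ} {S : Substitution d} (T : Tiling S)

/-- The level-`n` supertiling is locally finite. -/
theorem finite_tiles_meeting (n : ℕ) {D : Set (Euc d)} (hD : Bornology.IsBounded D) :
    {t ∈ T.tiles n | (S.tileSupp n t ∩ D).Nonempty}.Finite := by
  obtain ⟨ρ, hρ, c, hc⟩ := S.exists_ball_subset_tileSupp
  obtain ⟨R, hR⟩ := S.exists_tileSupp_subset_closedBall n
  have hn := S.scale_pow_pos n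
  have hmem : ∀ t : S.Tile, t.2 + S.scale ^ n • c t.1 ∈ interior (S.tileSupp n t) := fun t =>
    interior_maximal (hc n t) isOpen_ball (mem_ball_self (by positivity))
  refine finite_of_separated (fun t : S.Tile => t.2 + S.scale ^ n • c t.1)
    (ε := S.scale ^ n * ρ) (by positivity) ?_ ?_
  · refine (hD.cthickening (δ := 2 * R)).subset ?_
    rintro _ ⟨t, ⟨-, y, hy, hyD⟩, rfl⟩
    have h1 := hR t hy
    have h2 := hR t (interior_subset (hmem t))
    refine mem_cthickening_of_dist_le _ y _ _ hyD ?_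
    rw [mem_closedBall] at h1 h2
    have := dist_triangle_right (t.2 + S.scale ^ n • c t.1) y t.2
    linarith
  -- If the centres of two inner balls were closer than their radius, one centre would be interior
  -- to both supertiles.
  · intro t ht s hs hts
    by_contra hlt
    refine (T.disjoint n t ht.1 s hs.1 hts).le_bot ⟨?_, hmem s⟩
    exact interior_maximal (hc n t) isOpen_ball (by rw [mem_ball, dist_comm]; exact not_le.1 hlt)

theorem exists_tile_mem (n : ℕ) (x : Euc d) : ∃ t ∈ T.tiles n, x ∈ S.tileSupp n t := by
  have : x ∈ ⋃ t ∈ T.tiles n, S.tileSupp n t := by rw [T.cover n]; trivial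
  simpa using this

/-- The level-`n` supertiles that contain `x`. -/
def tilesAt (n : ℕ) (x : Euc d) : Set S.Tile := {t ∈ T.tiles n | x ∈ S.tileSupp n t}

theorem tilesAt_finite (n : ℕ) (x : Euc d) : (T.tilesAt n x).Finite :=
  (T.finite_tiles_meeting n (Bornology.isBounded_singleton (x := x))).subset
    fun _ ht => ⟨ht.1, x, ht.2, rfl⟩

theorem mem_stratum {n : ℕ} {x y : Euc d} : y ∈ T.stratum n x ↔ T.tilesAt n y = T.tilesAt n x := by
  simp only [stratum, tilesAt, mem_ofPred_eq, Set.ext_iff, and_congr_right_iff]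

/-- Near `x` there are only supertiles that contain `x`. -/
theorem eventually_tilesAt_subset (n : ℕ) (x : Euc d) :
    ∀ᶠ y in nhds x, T.tilesAt n y ⊆ T.tilesAt n x := by
  have hfin := (T.finite_tiles_meeting n (isBounded_ball (x := x) (r := 1)))
  have h1 : ∀ᶠ y in nhds x, ∀ t ∈ {t ∈ T.tiles n | (S.tileSupp n t ∩ ball x 1).Nonempty},
      y ∈ S.tileSupp n t → x ∈ S.tileSupp n t := by
    rw [Filter.eventually_all_finite hfin]
    intro t _
    by_cases hx : x ∈ S.tileSupp n t
    · exact Filter.Eventually.of_forall fun _ _ => hx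
    · filter_upwards [(S.isCompact_tileSupp n t).isClosed.isOpen_compl.mem_nhds hx] with y hy hy'
      exact absurd hy' hy
  filter_upwards [h1, ball_mem_nhds x one_pos] with y hy hyx t ht
  exact ⟨ht.1, hy t ⟨ht.1, y, ht.2, hyx⟩ ht.2⟩

/-! ## Points with the same image in the Anderson-Putnam complex -/

theorem shift_image_shift (v w : Euc d) (A : Set S.Tile) :
    S.shift v '' (S.shift w '' A) = S.shift (w + v) '' A := by
  rw [image_image]
  refine image_congr fun t _ => ?_
  simp [Substitution.shift, add_assoc]

theorem shift_zero_image (A : Set S.Tile) : S.shift 0 '' A = A := by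
  have : S.shift 0 = id := by ext t <;> simp [Substitution.shift]
  rw [this, image_id]

theorem apRel.symm {n : ℕ} {x y : Euc d} (h : T.apRel n x y) : T.apRel n y x := by
  obtain ⟨t, ht, hx, ht', hc⟩ := h
  have e : x - y = -(y - x) := by abel
  refine ⟨S.shift (y - x) t, ht', (shift_tileSupp n t _ _).2 (by simpa using hx), ?_, ?_⟩
  · rw [e, shift_shift_neg]; exact ht
  · rw [e, shift_shift_neg, hc, shift_image_shift, add_neg_cancel, shift_zero_image]

/-- A supertile that contains `x` meets the supertile `t` that witnesses `apRel`, so it belongs to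
the collar of `t`, which is translated along with `t`. -/
theorem apRel.tilesAt_subset {n : ℕ} {x y : Euc d} (h : T.apRel n x y) :
    S.shift (y - x) '' T.tilesAt n x ⊆ T.tilesAt n y := by
  obtain ⟨t, ht, hx, ht', hc⟩ := h
  rintro _ ⟨s, ⟨hs, hxs⟩, rfl⟩
  have h1 : S.shift (y - x) s ∈ T.collar n (S.shift (y - x) t) := by
    rw [hc]; exact ⟨s, ⟨hs, x, hxs, hx⟩, rfl⟩
  exact ⟨h1.1, (shift_tileSupp n s _ _).2 (by simpa using hxs)⟩

theorem apRel.tilesAt_eq {n : ℕ} {x y : Euc d} (h : T.apRel n x y) :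
    T.tilesAt n y = S.shift (y - x) '' T.tilesAt n x := by
  refine Subset.antisymm ?_ (apRel.tilesAt_subset T h)
  have h1 := image_mono (f := S.shift (y - x)) (apRel.tilesAt_subset T (apRel.symm T h))
  rwa [shift_image_shift, show x - y + (y - x) = (0 : Euc d) by abel, shift_zero_image] at h1

/-- Translating the stratum of `x` along with `x` to a point `y` that is identified with `x` at
level `m ≥ n`. -/
def Parallel (n m : ℕ) (x y : Euc d) : Prop :=
  T.tilesAt n y = S.shift (y - x) '' T.tilesAt n x ∧
    ∀ z ∈ T.stratum n x, z + (y - x) ∈ T.stratum n y ∧ T.proj m z = T.proj m (z + (y - x))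

theorem stratum_subset_of_le {n m : ℕ} (h : n ≤ m) (x : Euc d) :
    T.stratum n x ⊆ T.stratum m x := by
  induction h with
  | refl => exact subset_rfl
  | step _ ih => exact ih.trans (T.stratum_subset_succ _ x)

theorem apRel_of_le {n m : ℕ} (h : n ≤ m) {x y : Euc d} (hxy : T.apRel m x y) : T.apRel n x y := by
  induction h with
  | refl => exact hxy
  | step _ ih => exact ih (T.apRel_of_succ hxy)

theorem Parallel.refl (n m : ℕ) (x : Euc d) : T.Parallel n m x x := by
  simp [Parallel, shift_zero_image]

theorem Parallel.trans {n m : ℕ} {x y z : Euc d} (h : T.Parallel n m x y) (h' : T.Parallel n m y z) :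
    T.Parallel n m x z := by
  refine ⟨?_, fun w hw => ?_⟩
  · rw [h'.1, h.1, shift_image_shift]; congr 2; abel
  · obtain ⟨h1, h2⟩ := h.2 w hw
    obtain ⟨h3, h4⟩ := h'.2 _ h1
    rw [show w + (y - x) + (z - y) = w + (z - x) by abel] at h3 h4
    exact ⟨h3, h2.trans h4⟩

/-- A point `z` of the level-`n` stratum of `x` also lies in the level-`m` stratum, hence in the
level-`m` supertile that witnesses `apRel m x y`. The same supertile identifies `z` with its
translate. -/
theorem apRel.parallel {n m : ℕ} (hnm : n ≤ m) {x y : Euc d} (h : T.apRel m x y) :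
    T.Parallel n m x y := by
  refine ⟨apRel.tilesAt_eq T (T.apRel_of_le hnm h), fun z hz => ?_⟩
  have h1 : T.apRel m z (z + (y - x)) := by
    obtain ⟨t, ht, hx, ht', hc⟩ := h
    refine ⟨t, ht, (T.stratum_subset_of_le hnm x hz t ht).2 hx, ?_⟩
    rw [add_sub_cancel_left]
    exact ⟨ht', hc⟩
  refine ⟨?_, Quot.sound h1⟩
  rw [mem_stratum, apRel.tilesAt_eq T (T.apRel_of_le hnm h1), add_sub_cancel_left,
    apRel.tilesAt_eq T (T.apRel_of_le hnm h), T.mem_stratum.1 hz]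

/-- `proj m` divides by the equivalence relation generated by `apRel`, so `Parallel` is extended
along chains of identifications. Both directions are carried along to make the symmetric case of the
induction work. -/
theorem parallel_of_proj_eq {n m : ℕ} (hnm : n ≤ m) {x y : Euc d} (h : T.proj m x = T.proj m y) :
    T.Parallel n m x y ∧ T.Parallel n m y x := by
  induction Quot.eqvGen_exact h with
  | rel x y hxy =>
    exact ⟨apRel.parallel T hnm hxy, apRel.parallel T hnm (apRel.symm T hxy)⟩
  | refl x => exact ⟨.refl T n m x, .refl T n m x⟩
  | symm x y hxy ih => exact (ih (Quot.eqvGen_sound hxy)).symm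
  | trans x y z hxy hyz ih ih' =>
    have h1 := ih (Quot.eqvGen_sound hxy)
    have h2 := ih' (Quot.eqvGen_sound hyz)
    exact ⟨h1.1.trans T h2.1, h2.2.trans T h1.2⟩

theorem tilesAt_eq_of_proj_eq {n m : ℕ} (hnm : n ≤ m) {x y : Euc d} (h : T.proj m x = T.proj m y) :
    T.tilesAt n y = S.shift (y - x) '' T.tilesAt n x := (T.parallel_of_proj_eq hnm h).1.1

/-- The open cell of `x` is translated along with `x`. -/
theorem add_mem_openCellAt {n m : ℕ} (hnm : n ≤ m) {x y z : Euc d} (h : T.proj m x = T.proj m y)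
    (hz : z ∈ T.openCellAt n x) :
    z + (y - x) ∈ T.openCellAt n y ∧ T.proj m z = T.proj m (z + (y - x)) := by
  have hP := (T.parallel_of_proj_eq hnm h).1.2
  refine ⟨?_, (hP z (connectedComponentIn_subset _ _ hz)).2⟩
  have h1 : (fun w => w + (y - x)) '' T.openCellAt n x ⊆ T.openCellAt n y := by
    refine IsPreconnected.subset_connectedComponentIn
      (isPreconnected_connectedComponentIn.image _ (by fun_prop)) ⟨x, T.mem_openCellAt n x, by simp⟩ ?_
    rintro _ ⟨w, hw, rfl⟩
    exact (hP w (connectedComponentIn_subset _ _ hw)).1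
  exact h1 ⟨z, hz, rfl⟩

/-- Two points of a stratum have different images in the Anderson-Putnam complex. -/
theorem eq_of_mem_stratum {n m : ℕ} (hnm : n ≤ m) {x y : Euc d} (hy : y ∈ T.stratum n x)
    (h : T.proj m x = T.proj m y) : x = y := by
  have h1 := T.tilesAt_eq_of_proj_eq hnm h
  rw [T.mem_stratum.1 hy] at h1
  obtain ⟨t, ht, hxt⟩ := T.exists_tile_mem n x
  -- Translation by `y - x` maps the finite set of supertiles at `x` to itself, so the multiples of
  -- a nonzero `y - x` would produce infinitely many supertiles at `x`.
  have h2 : ∀ k : ℕ, S.shift (k • (y - x)) t ∈ T.tilesAt n x := by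
    intro k
    induction k with
    | zero =>
      rw [zero_smul, show S.shift (0 : Euc d) t = t by simp [Substitution.shift]]
      exact ⟨ht, hxt⟩
    | succ k ih =>
      rw [h1]
      exact ⟨_, ih, by simp [Substitution.shift, add_assoc, succ_nsmul]⟩
  obtain ⟨i, j, hij, he⟩ := (T.tilesAt_finite n x).exists_lt_map_eq_of_forall_mem h2
  simp only [Substitution.shift, Prod.mk.injEq, true_and, add_right_inj] at he
  by_contra hne
  have hv : y - x ≠ 0 := sub_ne_zero.2 (Ne.symm hne)
  rw [← Nat.cast_smul_eq_nsmul ℝ, ← Nat.cast_smul_eq_nsmul ℝ j] at he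
  exact hij.ne (by exact_mod_cast smul_left_injective ℝ hv he)

theorem mem_stratum_of_mem_openCellAt {n : ℕ} {x y z : Euc d} (hy : y ∈ T.openCellAt n x)
    (hz : z ∈ T.openCellAt n x) : z ∈ T.stratum n y := by
  have h1 := connectedComponentIn_subset _ _ hy
  have h2 := connectedComponentIn_subset _ _ hz
  rw [mem_stratum] at *
  rw [h1, h2]

theorem proj_injOn_openCellAt {n m : ℕ} (hnm : n ≤ m) (x : Euc d) :
    InjOn (T.proj m) (T.openCellAt n x) := fun _ hy _ hz h =>
  T.eq_of_mem_stratum hnm (T.mem_stratum_of_mem_openCellAt hy hz) h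

/-- If the image of an open cell contains `proj m y` then it is the image of the open cell of `y`. -/
theorem image_openCellAt_eq {n m : ℕ} (hnm : n ≤ m) {x y : Euc d}
    (h : T.proj m y ∈ T.proj m '' T.openCellAt n x) :
    T.proj m '' T.openCellAt n x = T.proj m '' T.openCellAt n y := by
  have key : ∀ {a b : Euc d}, T.proj m a = T.proj m b →
      T.proj m '' T.openCellAt n a ⊆ T.proj m '' T.openCellAt n b := by
    rintro a b hab _ ⟨z, hz, rfl⟩
    obtain ⟨h1, h2⟩ := T.add_mem_openCellAt hnm hab hz
    exact ⟨_, h1, h2.symm⟩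
  obtain ⟨w, hw, hwy⟩ := h
  rw [← T.openCellAt_eq hw]
  exact Subset.antisymm (key hwy) (key hwy.symm)

theorem openCellAt_subset_of_le {n m : ℕ} (h : n ≤ m) (x : Euc d) :
    T.openCellAt n x ⊆ T.openCellAt m x := by
  induction h with
  | refl => exact subset_rfl
  | step _ ih => exact ih.trans (T.openCellAt_subset_succ _ x)

theorem isBounded_openCellAt (n : ℕ) (x : Euc d) : Bornology.IsBounded (T.openCellAt n x) := by
  obtain ⟨t, ht, hx⟩ := T.exists_tile_mem n x
  exact (S.isCompact_tileSupp n t).isBounded.subset fun y hy =>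
    (connectedComponentIn_subset _ _ hy t ht).2 hx

/-- A bounded set contains only finitely many points with a given image in `AP n`. -/
theorem finite_proj_fiber (n : ℕ) {D : Set (Euc d)} (hD : Bornology.IsBounded D) (p : T.AP n) :
    {y ∈ D | T.proj n y = p}.Finite := by
  induction p using Quot.ind with | mk x => ?_
  obtain ⟨t, ht, hx⟩ := T.exists_tile_mem n x
  refine Finite.of_injOn (f := fun y => S.shift (y - x) t) (t := {t ∈ T.tiles n |
    (S.tileSupp n t ∩ D).Nonempty}) ?_ ?_ (T.finite_tiles_meeting n hD)
  · rintro y ⟨hy, hyx⟩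
    have h1 : S.shift (y - x) t ∈ T.tilesAt n y := by
      rw [T.tilesAt_eq_of_proj_eq le_rfl hyx.symm]
      exact ⟨t, ⟨ht, hx⟩, rfl⟩
    exact ⟨h1.1, y, h1.2, hy⟩
  · intro y _ z _ h
    simpa [Substitution.shift] using h

theorem proj_surjective (n : ℕ) : Function.Surjective (T.proj n) := Quot.mk_surjective

theorem continuous_proj (n : ℕ) : Continuous (T.proj n) := continuous_quot_mk

theorem sigma_proj (n : ℕ) (x : Euc d) : T.σ n (T.proj (n + 1) x) = T.proj n x := rfl

theorem continuous_sigma (n : ℕ) : Continuous (T.σ n) :=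
  continuous_quot_lift _ (T.continuous_proj n)

/-! ## The Anderson-Putnam complexes are Hausdorff -/

/-- The points that are `ε`-close to a point `x'` identified with `x`, in supertiles that
contain `x'`. -/
def saturatedBall (n : ℕ) (x : Euc d) (ε : ℝ) : Set (Euc d) :=
  {y | ∃ x', T.proj n x' = T.proj n x ∧ dist y x' < ε ∧ T.tilesAt n y ⊆ T.tilesAt n x'}

theorem isOpen_saturatedBall (n : ℕ) (x : Euc d) (ε : ℝ) : IsOpen (T.saturatedBall n x ε) := by
  rw [isOpen_iff_mem_nhds]
  rintro y ⟨x', h1, h2, h3⟩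
  filter_upwards [T.eventually_tilesAt_subset n y, (isOpen_ball (x := x') (ε := ε)).mem_nhds h2]
    with z hz hz2
  exact ⟨x', h1, hz2, hz.trans h3⟩

/-- The supertile that identifies `y` with `z` contains `y`, hence also the centre `x'`; so `x'`
moves along with `y` to another point identified with `x`. -/
theorem mem_saturatedBall_of_apRel {n : ℕ} {x y z : Euc d} {ε : ℝ}
    (hy : y ∈ T.saturatedBall n x ε) (h : T.apRel n y z) : z ∈ T.saturatedBall n x ε := by
  obtain ⟨x', h1, h2, h3⟩ := hy
  have hz := apRel.tilesAt_eq T h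
  obtain ⟨t, ht, hyt, ht', hc⟩ := h
  have h4 : T.apRel n x' (x' + (z - y)) :=
    ⟨t, ht, (h3 ⟨ht, hyt⟩).2, by rw [add_sub_cancel_left]; exact ⟨ht', hc⟩⟩
  refine ⟨x' + (z - y), (Quot.sound h4).symm.trans h1, ?_, ?_⟩
  · rw [dist_eq_norm] at h2 ⊢
    rwa [show z - (x' + (z - y)) = y - x' by abel]
  · rw [hz, apRel.tilesAt_eq T h4, add_sub_cancel_left]
    exact image_mono h3

theorem mem_saturatedBall_congr {n : ℕ} {x a b : Euc d} {ε : ℝ} (h : T.proj n a = T.proj n b) :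
    a ∈ T.saturatedBall n x ε ↔ b ∈ T.saturatedBall n x ε := by
  have := Quot.eqvGen_exact h
  clear h
  induction this with
  | rel a b h => exact ⟨fun ha => T.mem_saturatedBall_of_apRel ha h,
      fun hb => T.mem_saturatedBall_of_apRel hb (apRel.symm T h)⟩
  | refl a => rfl
  | symm a b _ ih => exact ih.symm
  | trans a b c _ _ ih ih' => exact ih.trans ih'

theorem isOpen_image_saturatedBall (n : ℕ) (x : Euc d) (ε : ℝ) :
    IsOpen (T.proj n '' T.saturatedBall n x ε) := by
  have h1 : T.proj n ⁻¹' (T.proj n '' T.saturatedBall n x ε) = T.saturatedBall n x ε := by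
    refine Subset.antisymm ?_ (subset_preimage_image _ _)
    rintro z ⟨y, hy, hyz⟩
    exact (T.mem_saturatedBall_congr hyz).1 hy
  refine isQuotientMap_quot_mk.isOpen_preimage.1 ?_
  change IsOpen (T.proj n ⁻¹' _)
  rw [h1]
  exact T.isOpen_saturatedBall n x ε

/-- If saturated balls around `x` and `y` overlap, their centres `x'` and `y''` can be chosen in one
common supertile. Then `x' - y''` belongs to the finite set of differences of relative positions of
`x` and `y`. A radius smaller than half of all nonzero norms in this set forces `x' = y''`, so `x`
and `y` are identified. -/
instance instT2SpaceAP (n : ℕ) : T2Space (T.AP n) := by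
  refine ⟨fun p q hpq => ?_⟩
  obtain ⟨x, rfl⟩ := T.proj_surjective n p
  obtain ⟨y, rfl⟩ := T.proj_surjective n q
  -- the differences of the positions of `x` and `y` in their supertiles
  set Δ : Set (Euc d) := (fun s : S.Tile × S.Tile => (x - s.1.2) - (y - s.2.2)) ''
    (T.tilesAt n x ×ˢ T.tilesAt n y)
  have hΔ : Δ.Finite := ((T.tilesAt_finite n x).prod (T.tilesAt_finite n y)).image _
  obtain ⟨ε, hε, hεΔ⟩ : ∃ ε > 0, ∀ v ∈ Δ, v ≠ 0 → ε ≤ ‖v‖ := by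
    have h1 : (Δ \ {0})ᶜ ∈ nhds (0 : Euc d) :=
      (hΔ.sdiff (t := {0})).isClosed.isOpen_compl.mem_nhds (by simp)
    obtain ⟨ε, hε, h2⟩ := Metric.mem_nhds_iff.1 h1
    refine ⟨ε, hε, fun v hv hv0 => ?_⟩
    by_contra hlt
    exact h2 (show v ∈ ball 0 ε by simpa using hlt) ⟨hv, hv0⟩
  refine ⟨_, _, T.isOpen_image_saturatedBall n x (ε / 2), T.isOpen_image_saturatedBall n y (ε / 2),
    ⟨x, ⟨x, rfl, by simpa using hε, subset_rfl⟩, rfl⟩,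
    ⟨y, ⟨y, rfl, by simpa using hε, subset_rfl⟩, rfl⟩, ?_⟩
  rw [disjoint_left]
  rintro _ ⟨a, ⟨x', hx1, hx2, hx3⟩, rfl⟩ ⟨b, ⟨y', hy1, hy2, hy3⟩, hab⟩
  -- move `b` to `a`
  obtain ⟨y'', hy1, hy2, hy3⟩ : a ∈ T.saturatedBall n y (ε / 2) :=
    (T.mem_saturatedBall_congr hab).1 ⟨y', hy1, hy2, hy3⟩
  obtain ⟨s, hs, has⟩ := T.exists_tile_mem n a
  have hsx := hx3 ⟨hs, has⟩
  have hsy := hy3 ⟨hs, has⟩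
  rw [T.tilesAt_eq_of_proj_eq le_rfl hx1.symm] at hsx
  rw [T.tilesAt_eq_of_proj_eq le_rfl hy1.symm] at hsy
  obtain ⟨s1, hs1, h1⟩ := hsx
  obtain ⟨s2, hs2, h2⟩ := hsy
  have hv : x' - y'' ∈ Δ := by
    refine ⟨(s1, s2), ⟨hs1, hs2⟩, ?_⟩
    have h3 := congrArg Prod.snd (h1.trans h2.symm)
    simp only [Substitution.shift] at h3 ⊢
    rw [show x - s1.2 - (y - s2.2) = (s2.2 + (y'' - y)) - (s1.2 + (x' - x)) + (x' - y'') by abel,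
      h3, sub_self, zero_add]
  have hd : ‖x' - y''‖ < ε := by
    rw [← dist_eq_norm]
    have := dist_triangle_left x' y'' a
    linarith
  have h0 : x' = y'' := by
    by_contra hne
    exact absurd (hεΔ _ hv (sub_ne_zero.2 hne)) (not_le.2 hd)
  exact hpq (hx1.symm.trans ((congrArg _ h0).trans hy1))

end Tiling

namespace Tiling

variable {d : ℕ} {S : Substitution d} (T : Tiling S)

/-! ## The maps between Anderson-Putnam complexes of different levels -/

/-- The map `AP m → AP n` for `n ≤ m`. -/
def down {n m : ℕ} (h : n ≤ m) : T.AP m → T.AP n := Quot.map id fun _ _ => T.apRel_of_le h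

theorem down_proj {n m : ℕ} (h : n ≤ m) (x : Euc d) : T.down h (T.proj m x) = T.proj n x := rfl

theorem down_self {n : ℕ} (p : T.AP n) : T.down le_rfl p = p := by
  obtain ⟨x, rfl⟩ := T.proj_surjective n p; rfl

theorem down_down {n m l : ℕ} (h : n ≤ m) (h' : m ≤ l) (p : T.AP l) :
    T.down h (T.down h' p) = T.down (h.trans h') p := by
  obtain ⟨x, rfl⟩ := T.proj_surjective l p; rfl

theorem sigma_eq_down (n : ℕ) (p : T.AP (n + 1)) : T.σ n p = T.down n.le_succ p := by
  obtain ⟨x, rfl⟩ := T.proj_surjective _ p; rfl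

theorem descend_proj (n : ℕ) (x : Euc d) : T.descend n (T.proj n x) = T.proj 0 x := by
  induction n with
  | zero => rfl
  | succ n ih => exact ih

theorem descend_eq_down (n : ℕ) (p : T.AP n) : T.descend n p = T.down n.zero_le p := by
  obtain ⟨x, rfl⟩ := T.proj_surjective _ p; exact T.descend_proj n x

/-- The points `a` and `b` of `AP m` lie in the same copies of open level-`n` cells. -/
def Copy (n m : ℕ) (a b : T.AP m) : Prop :=
  ∀ x, a ∈ T.proj m '' T.openCellAt n x ↔ b ∈ T.proj m '' T.openCellAt n x

variable {T}

theorem Copy.symm {n m : ℕ} {a b : T.AP m} (h : T.Copy n m a b) : T.Copy n m b a :=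
  fun x => (h x).symm

theorem Copy.trans {n m : ℕ} {a b c : T.AP m} (h : T.Copy n m a b) (h' : T.Copy n m b c) :
    T.Copy n m a c := fun x => (h x).trans (h' x)

/-- Two copies of open level-`n` cells in `AP m` are equal or disjoint by `image_openCellAt_eq`, so
only the copy around `y` has to be tested. -/
theorem copy_iff {n m : ℕ} (hnm : n ≤ m) {y : Euc d} {b : T.AP m} :
    T.Copy n m (T.proj m y) b ↔ b ∈ T.proj m '' T.openCellAt n y := by
  refine ⟨fun h => (h y).1 ⟨y, T.mem_openCellAt n y, rfl⟩, ?_⟩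
  rintro ⟨z, hz, rfl⟩ x
  constructor <;> intro h
  · rw [T.image_openCellAt_eq hnm h]
    exact ⟨z, hz, rfl⟩
  · rw [T.image_openCellAt_eq hnm h, T.openCellAt_eq hz]
    exact ⟨y, T.mem_openCellAt n y, rfl⟩

/-- `proj n` is injective on an open level-`n` cell of `ℝᵈ`, so `down` is injective on each copy of
it in a higher complex. With `Copy.exists_lift`, each copy is mapped bijectively to its cell. -/
theorem Copy.eq_of_down_eq {n m : ℕ} (hnm : n ≤ m) {a b : T.AP m}
    (h : T.Copy n m a b) (hab : T.down hnm a = T.down hnm b) : a = b := by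
  obtain ⟨y, rfl⟩ := T.proj_surjective m a
  obtain ⟨z, hz, rfl⟩ := (copy_iff hnm).1 h
  rw [T.proj_injOn_openCellAt le_rfl y (T.mem_openCellAt n y) hz hab]

theorem Copy.exists_lift {n m : ℕ} (hnm : n ≤ m) {a : T.AP m} {c : T.AP n}
    (h : T.Copy n n (T.down hnm a) c) : ∃ b, T.Copy n m a b ∧ T.down hnm b = c := by
  obtain ⟨y, rfl⟩ := T.proj_surjective m a
  obtain ⟨z, hz, rfl⟩ := (copy_iff le_rfl).1 h
  exact ⟨T.proj m z, (copy_iff hnm).2 ⟨z, hz, rfl⟩, rfl⟩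

theorem Copy.down {n m l : ℕ} (hnm : n ≤ m) (hml : m ≤ l) {a b : T.AP l} (h : T.Copy n l a b) :
    T.Copy n m (T.down hml a) (T.down hml b) := by
  obtain ⟨y, rfl⟩ := T.proj_surjective l a
  obtain ⟨z, hz, rfl⟩ := (copy_iff (hnm.trans hml)).1 h
  exact (copy_iff hnm).2 ⟨z, hz, rfl⟩

theorem Copy.mono {n n' m : ℕ} (hn : n ≤ n') (hm : n' ≤ m) {a b : T.AP m} (h : T.Copy n m a b) :
    T.Copy n' m a b := by
  obtain ⟨y, rfl⟩ := T.proj_surjective m a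
  obtain ⟨z, hz, rfl⟩ := (copy_iff (hn.trans hm)).1 h
  exact (copy_iff hm).2 ⟨z, T.openCellAt_subset_of_le hn y hz, rfl⟩

end Tiling

/-! ## Cells -/

namespace CellStructure

variable {d : ℕ} {S : Substitution d} {T : Tiling S} (X : CellStructure T)

theorem chart_source {n k : ℕ} (e : X.Cell n k) : (X.chart e).source = ball 0 1 :=
  (X.cw n).source_eq k e

theorem openCell_eq_target {n k : ℕ} (e : X.Cell n k) : X.openCell e = (X.chart e).target := by
  rw [← (X.chart e).image_source_eq_target, X.chart_source, openCell]

theorem continuousOn_chart {n k : ℕ} (e : X.Cell n k) :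
    ContinuousOn (X.chart e) (closedBall 0 1) := (X.cw n).continuousOn k e

theorem continuousOn_chart_symm {n k : ℕ} (e : X.Cell n k) :
    ContinuousOn (X.chart e).symm (X.openCell e) := by
  rw [openCell_eq_target]; exact (X.cw n).continuousOn_symm k e

theorem chart_injOn {n k : ℕ} (e : X.Cell n k) : InjOn (X.chart e) (ball 0 1) := by
  rw [← X.chart_source e]; exact (X.chart e).injOn

theorem chart_mem {n k : ℕ} (e : X.Cell n k) {x : Fin k → ℝ} (hx : x ∈ ball 0 1) :
    X.chart e x ∈ X.openCell e := ⟨x, hx, rfl⟩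

theorem sigma_cell_eq {n j k : ℕ} {e : X.Cell n j} {e' : X.Cell n k} {p : T.AP n}
    (h : p ∈ X.openCell e) (h' : p ∈ X.openCell e') :
    (⟨j, e⟩ : Σ i, X.Cell n i) = ⟨k, e'⟩ := by
  by_contra hne
  exact ((X.cw n).pairwiseDisjoint' (mem_univ _) (mem_univ _) hne).le_bot ⟨h, h'⟩

theorem dim_eq {n j k : ℕ} {e : X.Cell n j} {e' : X.Cell n k} {p : T.AP n}
    (h : p ∈ X.openCell e) (h' : p ∈ X.openCell e') : j = k :=
  congrArg Sigma.fst (X.sigma_cell_eq h h')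

theorem cell_eq {n k : ℕ} {e e' : X.Cell n k} {p : T.AP n}
    (h : p ∈ X.openCell e) (h' : p ∈ X.openCell e') : e = e' := by
  simpa using X.sigma_cell_eq h h'

/-- The union of the open cells of dimension less than `k`. -/
def lowerCells (n k : ℕ) : Set (T.AP n) := {p | ∃ j < k, ∃ e : X.Cell n j, p ∈ X.openCell e}

theorem lowerCells_mono (n : ℕ) {j k : ℕ} (h : j ≤ k) : X.lowerCells n j ⊆ X.lowerCells n k :=
  fun _ ⟨i, hi, e⟩ => ⟨i, hi.trans_le h, e⟩

/-- The boundary goes to closed cells of lower dimension. A point of such a closed cell lies in its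
open cell or comes from its boundary sphere, where induction on the dimension applies. -/
theorem chart_mem_lowerCells_of_mem_sphere {n k : ℕ} (e : X.Cell n k) {x : Fin k → ℝ}
    (hx : x ∈ sphere 0 1) : X.chart e x ∈ X.lowerCells n k := by
  induction k using Nat.strong_induction_on with | _ k ih => ?_
  obtain ⟨I, hI⟩ := (X.cw n).mapsTo' k e
  obtain ⟨j, hj, e', -, y, hy, hyx⟩ : ∃ j < k, ∃ e' : X.Cell n j, e' ∈ I j ∧
      ∃ y ∈ closedBall 0 1, X.chart e' y = X.chart e x := by
    obtain ⟨j, h⟩ := mem_iUnion.1 (hI hx)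
    simp only [mem_iUnion] at h
    obtain ⟨hj, e', he', y, hy, h⟩ := h
    exact ⟨j, hj, e', he', y, hy, h⟩
  rw [← hyx]
  rcases (mem_closedBall.1 hy).lt_or_eq with h | h
  · exact ⟨j, hj, e', X.chart_mem e' h⟩
  · exact X.lowerCells_mono n hj.le (ih j hj e' h)

theorem chart_mem_openCell_or {n k : ℕ} (e : X.Cell n k) {x : Fin k → ℝ}
    (hx : x ∈ closedBall 0 1) : X.chart e x ∈ X.openCell e ∨ X.chart e x ∈ X.lowerCells n k := by
  rcases (mem_closedBall.1 hx).lt_or_eq with h | h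
  · exact Or.inl (X.chart_mem e h)
  · exact Or.inr (X.chart_mem_lowerCells_of_mem_sphere e h)

theorem chart_mem_lowerCells {n k : ℕ} (e : X.Cell n k) {x : Fin k → ℝ}
    (hx : x ∈ closedBall 0 1) : X.chart e x ∈ X.lowerCells n (k + 1) := by
  rcases X.chart_mem_openCell_or e hx with h | h
  · exact ⟨k, k.lt_succ_self, e, h⟩
  · exact X.lowerCells_mono n k.le_succ h

theorem exists_chart_eq_sigma {n k : ℕ} (e : X.Cell (n + 1) k) {x : Fin k → ℝ}
    (hx : x ∈ closedBall 0 1) : ∃ (e' : X.Cell n k) (y : Fin k → ℝ), y ∈ closedBall 0 1 ∧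
      X.chart e' y = T.σ n (X.chart e x) := by
  obtain ⟨s, hs⟩ := X.subdivides n k e
  have h1 : T.σ n (X.chart e x) ∈ T.σ n '' ((X.cw (n + 1)).map k e '' closedBall 0 1) :=
    ⟨_, ⟨x, hx, rfl⟩, rfl⟩
  rw [hs] at h1
  simp only [mem_iUnion] at h1
  obtain ⟨e', -, y, hy, h⟩ := h1
  exact ⟨e', y, hy, h⟩

/-- `σ` maps a closed cell onto a union of closed cells of the same dimension, so it cannot raise
the dimension of the open cell around a point. -/
theorem sigma_mem_lowerCells {n k : ℕ} {p : T.AP (n + 1)} (hp : p ∈ X.lowerCells (n + 1) k) :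
    T.σ n p ∈ X.lowerCells n k := by
  obtain ⟨j, hj, e, x, hx, rfl⟩ := hp
  obtain ⟨e', y, hy, h⟩ := X.exists_chart_eq_sigma e (ball_subset_closedBall hx)
  rw [← h]
  exact X.lowerCells_mono n hj (X.chart_mem_lowerCells e' hy)

theorem notMem_lowerCells {n k : ℕ} {e : X.Cell n k} {p : T.AP n} (hp : p ∈ X.openCell e) :
    p ∉ X.lowerCells n k := fun ⟨_, hj, _, h⟩ => hj.ne (X.dim_eq h hp)

theorem openCell_eq_image {n k : ℕ} {e : X.Cell n k} {y : Euc d} (h : T.proj n y ∈ X.openCell e) :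
    X.openCell e = T.proj n '' T.openCellAt n y := by
  obtain ⟨x, hx⟩ := (X.openCell_iff n (X.openCell e)).1 ⟨k, e, rfl⟩
  rw [hx] at h ⊢
  exact T.image_openCellAt_eq le_rfl h

theorem copy_iff_mem_openCell {n k : ℕ} {e : X.Cell n k} {p q : T.AP n} (hp : p ∈ X.openCell e) :
    T.Copy n n p q ↔ q ∈ X.openCell e := by
  obtain ⟨y, rfl⟩ := T.proj_surjective n p
  rw [X.openCell_eq_image hp, Tiling.copy_iff le_rfl]

theorem mem_openCell_of_copy {n m k : ℕ} (hnm : n ≤ m) {e : X.Cell m k} {p q : T.AP m}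
    (hp : p ∈ X.openCell e) (h : T.Copy n m p q) : q ∈ X.openCell e :=
  (X.copy_iff_mem_openCell hp).1 (h.mono hnm le_rfl)

/-- Each open `k`-cell of `AP n` covers the open `k`-cells of `AP (n + 1)` that `σ` maps to it. -/
theorem exists_mem_openCell_sigma {n k : ℕ} (e : X.Cell (n + 1) k) :
    ∃ e' : X.Cell n k, ∀ p' ∈ X.openCell e', ∃ p ∈ X.openCell e, T.σ n p = p' := by
  obtain ⟨s, hs⟩ := X.subdivides n k e
  have h0 : ((T.σ n '' ((X.cw (n + 1)).map k e '' closedBall 0 1))).Nonempty :=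
    ((nonempty_closedBall.2 zero_le_one).image _).image _
  rw [hs] at h0
  obtain ⟨_, h0⟩ := h0
  simp only [mem_iUnion] at h0
  obtain ⟨e', he', -⟩ := h0
  refine ⟨e', fun p' hp' => ?_⟩
  have h1 : p' ∈ T.σ n '' ((X.cw (n + 1)).map k e '' closedBall 0 1) := by
    rw [hs]
    obtain ⟨x, hx, rfl⟩ := hp'
    exact mem_biUnion he' ⟨x, ball_subset_closedBall hx, rfl⟩
  obtain ⟨_, ⟨x, hx, rfl⟩, h2⟩ := h1
  -- The boundary of `e` goes to cells of dimension less than `k`, so a point of the open cell `e'`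
  -- can only come from the open cell `e`.
  rcases X.chart_mem_openCell_or e hx with h | h
  · exact ⟨_, h, h2⟩
  · exact absurd (h2 ▸ X.sigma_mem_lowerCells h) (X.notMem_lowerCells hp')

/-- A point of an open cell of `AP (n + 1)` has finitely many companions with the same image. -/
theorem finite_openCell_fiber {n k : ℕ} (e : X.Cell (n + 1) k) (c : T.AP n) :
    {p ∈ X.openCell e | T.σ n p = c}.Finite := by
  obtain ⟨x, hx⟩ := (X.openCell_iff (n + 1) (X.openCell e)).1 ⟨k, e, rfl⟩
  refine ((T.finite_proj_fiber n (T.isBounded_openCellAt (n + 1) x) c).image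
    (T.proj (n + 1))).subset ?_
  rintro p ⟨hp, hpc⟩
  rw [hx] at hp
  obtain ⟨y, hy, rfl⟩ := hp
  exact ⟨y, ⟨hy, hpc⟩, rfl⟩

/-- Each point of `e` over `c` lies in a copy of `e'` that is contained in `e` and has a point over
`c'`. Passing from one to the other is injective because a copy has only one point over `c`. -/
theorem ncard_fiber_le {n k : ℕ} (e : X.Cell (n + 1) k) {e' : X.Cell n k} {c c' : T.AP n}
    (hc : c ∈ X.openCell e') (hc' : c' ∈ X.openCell e') :
    {p ∈ X.openCell e | T.σ n p = c}.ncard ≤ {p ∈ X.openCell e | T.σ n p = c'}.ncard := by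
  have h1 : ∀ p ∈ {p ∈ X.openCell e | T.σ n p = c}, ∃ q, T.Copy n (n + 1) p q ∧
      T.down n.le_succ q = c' := by
    rintro p ⟨hp, hpc⟩
    refine Tiling.Copy.exists_lift _ ((X.copy_iff_mem_openCell (e := e') ?_).2 hc')
    rwa [← T.sigma_eq_down, hpc]
  have hne : Nonempty (T.AP (n + 1)) := ⟨T.proj _ 0⟩
  choose! f hf hf' using h1
  refine ncard_le_ncard_of_injOn f (fun p hp => ?_) (fun p hp q hq hpq => ?_)
    (X.finite_openCell_fiber e c')
  · exact ⟨X.mem_openCell_of_copy n.le_succ hp.1 (hf p hp), by rw [T.sigma_eq_down, hf' p hp]⟩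
  · have h2 := (hf p hp).trans (hpq ▸ (hf q hq).symm)
    exact h2.eq_of_down_eq n.le_succ (by rw [← T.sigma_eq_down, ← T.sigma_eq_down, hp.2, hq.2])

theorem ncard_fiber_eq {n k : ℕ} (e : X.Cell (n + 1) k) {e' : X.Cell n k} {c c' : T.AP n}
    (hc : c ∈ X.openCell e') (hc' : c' ∈ X.openCell e') :
    {p ∈ X.openCell e | T.σ n p = c}.ncard = {p ∈ X.openCell e | T.σ n p = c'}.ncard :=
  (X.ncard_fiber_le e hc hc').antisymm (X.ncard_fiber_le e hc' hc)

/-! ## Punctures -/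

section Punctures

variable {X} {pun : ℕ → Set (T.AP 0)} (hpun : X.IsPuncturing pun) {k : ℕ} (hk : k ≤ d)
include hpun hk

/-- Since `σ` does not raise dimensions, a point of a cell of dimension less than `k` descends to
such a cell, which contains no `k`-puncture. This keeps the images of `k`-punctures off the
boundaries of `k`-cells. -/
theorem notMem_lowerCells_of_descend {n : ℕ} {p : T.AP n} (hp : T.descend n p ∈ pun k) :
    p ∉ X.lowerCells n k := by
  have key : ∀ n (p : T.AP n), p ∈ X.lowerCells n k → T.descend n p ∈ X.lowerCells 0 k := by
    intro n
    induction n with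
    | zero => exact fun _ h => h
    | succ n ih => exact fun p h => ih _ (X.sigma_mem_lowerCells h)
  obtain ⟨e, he⟩ := (hpun k hk).1 _ hp
  exact fun h => X.notMem_lowerCells he (key n p h)

theorem sigma_mem_punctures {n : ℕ} {p : T.AP (n + 1)} (hp : p ∈ X.punctures pun (n + 1) k) :
    T.σ n p ∈ X.punctures pun n k := by
  obtain ⟨⟨e, he⟩, hd⟩ := hp
  refine ⟨?_, hd⟩
  obtain ⟨x, hx, rfl⟩ := he
  obtain ⟨e', y, hy, h⟩ := X.exists_chart_eq_sigma e (ball_subset_closedBall hx)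
  rcases X.chart_mem_openCell_or e' hy with h1 | h1
  · exact ⟨e', h ▸ h1⟩
  · rw [h] at h1
    exact absurd h1 (notMem_lowerCells_of_descend (n := n) hpun hk hd)

theorem down_mem_punctures {n m : ℕ} (h : n ≤ m) {p : T.AP m} (hp : p ∈ X.punctures pun m k) :
    T.down h p ∈ X.punctures pun n k := by
  induction h with
  | refl => rwa [T.down_self]
  | step h ih =>
    have := ih (sigma_mem_punctures hpun hk hp)
    rwa [T.sigma_eq_down, T.down_down] at this

theorem exists_puncture (n : ℕ) (e : X.Cell n k) : ∃ p ∈ X.punctures pun n k, p ∈ X.openCell e := by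
  induction n with
  | zero =>
    obtain ⟨p, ⟨h1, h2⟩, -⟩ := (hpun k hk).2 e
    exact ⟨p, ⟨⟨e, h1⟩, h2⟩, h1⟩
  | succ n ih =>
    obtain ⟨e', he'⟩ := X.exists_mem_openCell_sigma e
    obtain ⟨p', hp', hpe'⟩ := ih e'
    obtain ⟨p, hp, rfl⟩ := he' p' hpe'
    exact ⟨p, ⟨⟨e, hp⟩, hp'.2⟩, hp⟩

theorem finite_punctures (n : ℕ) : (X.punctures pun n k).Finite := by
  induction n with
  | zero =>
    choose f hf hf' using fun e : X.Cell 0 k => (hpun k hk).2 e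
    refine (finite_range f).subset ?_
    rintro p ⟨⟨e, he⟩, hp⟩
    exact ⟨e, (hf' e p ⟨he, hp⟩).symm⟩
  | succ n ih =>
    refine (ih.biUnion fun c _ => finite_iUnion fun e : X.Cell (n + 1) k =>
      X.finite_openCell_fiber e c).subset fun p hp => ?_
    obtain ⟨e, he⟩ := hp.1
    exact mem_biUnion (sigma_mem_punctures hpun hk hp) (mem_iUnion.2 ⟨e, he, rfl⟩)

end Punctures

/-! ## Sequences of punctures -/

section LimPuncture

variable {X} {pun : ℕ → Set (T.AP 0)} {k : ℕ}

theorem down_eq_of_sigma_eq {p : ∀ n, T.AP n} (hp : ∀ n, T.σ n (p (n + 1)) = p n) {n m : ℕ}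
    (h : n ≤ m) : T.down h (p m) = p n := by
  induction h with
  | refl => exact T.down_self _
  | @step m h ih => rw [← ih, ← hp m, T.sigma_eq_down, T.down_down]

theorem LimPuncture.down_eq (p : X.LimPuncture pun k) {n m : ℕ} (h : n ≤ m) :
    T.down h (p.1 m) = p.1 n := down_eq_of_sigma_eq p.2.1 h

theorem TailRel.copy {n m : ℕ} {p q : X.LimPuncture pun k} (h : TailRel n p q) (hm : n ≤ m) :
    T.Copy n m (p.1 m) (q.1 m) := h m hm

/-- The copy of a level-`n` cell that contains `p m` also contains `q m`, and it has only one point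
over `q n`. So an arrow of level `n` is determined by its range and the level-`n` term of its
source. -/
theorem TailRel.eq_of_eq {n m : ℕ} {p q p' q' : X.LimPuncture pun k} (h : TailRel n p q)
    (h' : TailRel n p' q') (hm : n ≤ m) (hp : p.1 m = p'.1 m) (hq : q.1 n = q'.1 n) :
    q.1 m = q'.1 m := by
  have h1 := (h.copy hm).symm.trans (hp ▸ h'.copy hm)
  exact h1.eq_of_down_eq hm (by rw [q.down_eq, q'.down_eq, hq])

variable (hpun : X.IsPuncturing pun) (hk : k ≤ d)
include hpun hk

/-- At each level above `n`, the copy of the level-`n` cell around the term of `p` has exactly one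
point over `c`; uniqueness makes these points compatible with `σ`. -/
theorem TailRel.exists_of_copy {n : ℕ} (p : X.LimPuncture pun k) {c : T.AP n}
    (hc : c ∈ X.punctures pun n k) (h : T.Copy n n (p.1 n) c) :
    ∃ q : X.LimPuncture pun k, TailRel n p q ∧ q.1 n = c := by
  obtain ⟨p, hp, hpp⟩ := p
  have hd : ∀ {n m : ℕ} (h : n ≤ m), T.down h (p m) = p n := fun h => down_eq_of_sigma_eq hp h
  have h1 : ∀ m, ∃ b, T.Copy n (n + m) (p (n + m)) b ∧ T.down (n.le_add_right m) b = c := by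
    intro m
    refine Tiling.Copy.exists_lift _ ?_
    rwa [hd]
  choose b hb hbc using h1
  have hcomp : ∀ m, T.down (Nat.le_succ _) (b (m + 1)) = b m := by
    intro m
    have h2 := Tiling.Copy.down (n.le_add_right m) (Nat.le_succ (n + m)) (hb (m + 1))
    refine ((h2.symm.trans ?_).eq_of_down_eq (n.le_add_right m) ?_)
    · have := hb m
      rwa [← hd (Nat.le_succ (n + m))] at this
    · rw [T.down_down]; exact (hbc (m + 1)).trans (hbc m).symm
  have hbp : ∀ m, b m ∈ X.punctures pun (n + m) k := by
    intro m
    obtain ⟨e, he⟩ := (hpp (n + m)).1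
    refine ⟨⟨e, X.mem_openCell_of_copy (n.le_add_right m) he (hb m)⟩, ?_⟩
    rw [T.descend_eq_down, ← T.down_down n.zero_le (n.le_add_right m), hbc, ← T.descend_eq_down]
    exact hc.2
  -- `b m` belongs to level `n + m`, so projecting it to level `m` defines the sequence at all
  -- levels at once, also below `n`.
  refine ⟨⟨fun m => T.down (m.le_add_left n) (b m), fun m => ?_, fun m =>
    down_mem_punctures hpun hk _ (hbp m)⟩, fun m hm => ?_, ?_⟩
  · change T.σ m (T.down _ (b (m + 1))) = T.down _ (b m)
    rw [T.sigma_eq_down, T.down_down, ← hcomp m, T.down_down]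
  · have h2 := Tiling.Copy.down hm (m.le_add_left n) (hb m)
    rw [hd] at h2
    exact h2
  · rw [← hbc n]

end LimPuncture

end CellStructure

/-! ## Orientation preserving maps -/

section Orientation

variable {k : ℕ}

/-- The maps `f₀` and `f₁` from the unit sphere to `ℝᵏ ∖ {0}` are homotopic. -/
def SphereHomotopic (f₀ f₁ : (Fin k → ℝ) → (Fin k → ℝ)) : Prop :=
  ∃ H : ℝ × (Fin k → ℝ) → (Fin k → ℝ), ContinuousOn H (Icc 0 1 ×ˢ sphere 0 1) ∧
    ∀ u ∈ sphere (0 : Fin k → ℝ) 1,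
      H (0, u) = f₀ u ∧ H (1, u) = f₁ u ∧ ∀ t ∈ Icc (0 : ℝ) 1, H (t, u) ≠ 0

theorem SphereHomotopic.symm {f₀ f₁ : (Fin k → ℝ) → (Fin k → ℝ)} (h : SphereHomotopic f₀ f₁) :
    SphereHomotopic f₁ f₀ := by
  obtain ⟨H, hH, h⟩ := h
  refine ⟨fun p => H (1 - p.1, p.2), hH.comp (by fun_prop) fun p hp => ⟨?_, hp.2⟩, fun u hu =>
    ⟨by simpa using (h u hu).2.1, by simpa using (h u hu).1, fun t ht => (h u hu).2.2 _ ?_⟩⟩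
  · obtain ⟨h1, h2⟩ := hp.1
    constructor <;> simp only <;> linarith
  · obtain ⟨h1, h2⟩ := ht
    constructor <;> linarith

theorem SphereHomotopic.trans {f₀ f₁ f₂ : (Fin k → ℝ) → (Fin k → ℝ)} (h : SphereHomotopic f₀ f₁)
    (h' : SphereHomotopic f₁ f₂) : SphereHomotopic f₀ f₂ := by
  obtain ⟨H, hH, h⟩ := h
  obtain ⟨H', hH', h'⟩ := h'
  let G : ℝ × (Fin k → ℝ) → (Fin k → ℝ) := fun p =>
    if p.1 ≤ 1 / 2 then H (2 * p.1, p.2) else H' (2 * p.1 - 1, p.2)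
  have hG1 : ∀ t u, t ≤ 1 / 2 → G (t, u) = H (2 * t, u) := fun t u ht => if_pos ht
  have hG2 : ∀ t, ∀ u ∈ sphere (0 : Fin k → ℝ) 1, 1 / 2 ≤ t → G (t, u) = H' (2 * t - 1, u) := by
    intro t u hu ht
    rcases ht.eq_or_lt with rfl | ht
    · rw [hG1 _ _ le_rfl]; norm_num; rw [(h u hu).2.1, (h' u hu).1]
    · exact if_neg (not_le.2 ht)
  refine ⟨G, ?_, fun u hu => ⟨?_, ?_, fun t ht => ?_⟩⟩
  · have e : Icc (0 : ℝ) 1 ×ˢ sphere (0 : Fin k → ℝ) 1 =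
        Icc (0 : ℝ) (1 / 2) ×ˢ sphere 0 1 ∪ Icc (1 / 2 : ℝ) 1 ×ˢ sphere 0 1 := by
      rw [← union_prod, Icc_union_Icc_eq_Icc (by norm_num) (by norm_num)]
    rw [e]
    refine ContinuousOn.union_of_isClosed ?_ ?_ (isClosed_Icc.prod isClosed_sphere)
      (isClosed_Icc.prod isClosed_sphere)
    · refine ContinuousOn.congr (hH.comp (f := fun p : ℝ × (Fin k → ℝ) => (2 * p.1, p.2))
        (by fun_prop) ?_) fun p hp => hG1 _ _ hp.1.2
      rintro p ⟨⟨h1, h2⟩, hp⟩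
      exact ⟨⟨by simp only; linarith, by simp only; linarith⟩, hp⟩
    · refine ContinuousOn.congr (hH'.comp (f := fun p : ℝ × (Fin k → ℝ) => (2 * p.1 - 1, p.2))
        (by fun_prop) ?_) fun p hp => hG2 _ _ hp.2 hp.1.1
      rintro p ⟨⟨h1, h2⟩, hp⟩
      exact ⟨⟨by simp only; linarith, by simp only; linarith⟩, hp⟩
  · rw [hG1 _ _ (by norm_num), mul_zero, (h u hu).1]
  · rw [hG2 _ _ hu (by norm_num)]; norm_num; exact (h' u hu).2.1
  · rcases le_total t (1 / 2) with h1 | h1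
    · rw [hG1 _ _ h1]; exact (h u hu).2.2 _ ⟨by linarith [ht.1], by linarith⟩
    · rw [hG2 _ _ hu h1]; exact (h' u hu).2.2 _ ⟨by linarith, by linarith [ht.2]⟩

theorem SphereHomotopic.congr_left {f₀ f₀' f₁ : (Fin k → ℝ) → (Fin k → ℝ)}
    (h : SphereHomotopic f₀ f₁) (he : ∀ u ∈ sphere (0 : Fin k → ℝ) 1, f₀ u = f₀' u) :
    SphereHomotopic f₀' f₁ := by
  obtain ⟨H, hH, h⟩ := h
  exact ⟨H, hH, fun u hu => ⟨(h u hu).1.trans (he u hu), (h u hu).2⟩⟩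

theorem preservesOrientationAt_iff {h : (Fin k → ℝ) → (Fin k → ℝ)} {x : Fin k → ℝ} :
    PreservesOrientationAt h x ↔ ∃ R > 0, ∀ r : ℝ, 0 < r → r < R →
      SphereHomotopic (fun u => h (x + r • u) - h x) id := Iff.rfl

/-- An embedding of a ball that preserves the orientation at the centre preserves it everywhere. -/
theorem PreservesOrientationAt.of_center {g : (Fin k → ℝ) → (Fin k → ℝ)}
    (hg : ContinuousOn g (ball 0 1)) (hinj : InjOn g (ball 0 1)) (h0 : PreservesOrientationAt g 0)
    {x : Fin k → ℝ} (hx : x ∈ ball 0 1) : PreservesOrientationAt g x := by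
  rw [preservesOrientationAt_iff] at h0 ⊢
  obtain ⟨R, hR, h0⟩ := h0
  rw [mem_ball_zero_iff] at hx
  refine ⟨min R (1 - ‖x‖), lt_min hR (by linarith), fun r hr hrR => ?_⟩
  refine SphereHomotopic.trans ?_ (h0 r hr (hrR.trans_le (min_le_left _ _)))
  have hr1 := hrR.trans_le (min_le_right _ _)
  have hb : ∀ t ∈ Icc (0 : ℝ) 1, ‖(1 - t) • x‖ ≤ ‖x‖ := by
    intro t ht
    rw [norm_smul, Real.norm_of_nonneg (by linarith [ht.2])]
    exact mul_le_of_le_one_left (norm_nonneg x) (by linarith [ht.1])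
  have hmem1 : ∀ t ∈ Icc (0 : ℝ) 1, (1 - t) • x ∈ ball (0 : Fin k → ℝ) 1 := fun t ht => by
    rw [mem_ball_zero_iff]; exact (hb t ht).trans_lt hx
  have hmem2 : ∀ t ∈ Icc (0 : ℝ) 1, ∀ u ∈ sphere (0 : Fin k → ℝ) 1,
      (1 - t) • x + r • u ∈ ball (0 : Fin k → ℝ) 1 := fun t ht u hu => by
    rw [mem_ball_zero_iff]
    calc ‖(1 - t) • x + r • u‖ ≤ ‖(1 - t) • x‖ + ‖r • u‖ := norm_add_le _ _
      _ ≤ ‖x‖ + r := by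
        refine add_le_add (hb t ht) ?_
        rw [norm_smul, mem_sphere_zero_iff_norm.1 hu, mul_one, Real.norm_of_nonneg hr.le]
      _ < 1 := by linarith
  -- The centre of the small sphere moves along the segment from `x` to `0`. A radius below `1 -
  -- ‖x‖` keeps the sphere in the ball, and injectivity of `g` keeps the difference nonzero.
  refine ⟨fun p => g ((1 - p.1) • x + r • p.2) - g ((1 - p.1) • x), ?_, fun u hu =>
    ⟨by simp, by simp, fun t ht h => ?_⟩⟩
  · exact (hg.comp (by fun_prop) fun p hp => hmem2 _ hp.1 _ hp.2).sub
      (hg.comp (by fun_prop) fun p hp => hmem1 _ hp.1)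
  · have h1 := hinj (hmem2 t ht u hu) (hmem1 t ht) (sub_eq_zero.1 h)
    rw [add_eq_left, smul_eq_zero] at h1
    rcases h1 with h1 | h1
    · exact hr.ne' h1
    · simp [h1] at hu

/-- If `φ` is an embedding of the ball that preserves the orientation at `0`, then `φ ∘ f - φ 0` is
homotopic to `f`. -/
theorem SphereHomotopic.of_embedding {φ : (Fin k → ℝ) → (Fin k → ℝ)}
    (hφ : ContinuousOn φ (ball 0 1)) (hinj : InjOn φ (ball 0 1)) (h0 : PreservesOrientationAt φ 0)
    {f : (Fin k → ℝ) → (Fin k → ℝ)} (hf : ContinuousOn f (sphere 0 1))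
    (hf1 : ∀ u ∈ sphere (0 : Fin k → ℝ) 1, f u ∈ ball (0 : Fin k → ℝ) 1 ∧ f u ≠ 0) :
    SphereHomotopic (fun u => φ (f u) - φ 0) f := by
  rw [preservesOrientationAt_iff] at h0
  obtain ⟨R, hR, h0⟩ := h0
  set ρ : ℝ := min R 1 / 2
  have hρ : 0 < ρ := by positivity
  have hρR : ρ < R := (half_lt_self (by positivity)).trans_le (min_le_left _ _)
  have hρ1 : ρ < 1 := (half_lt_self (by positivity)).trans_le (min_le_right _ _)
  obtain ⟨H, hH, hHu⟩ := h0 ρ hρ hρR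
  have hn : ∀ u ∈ sphere (0 : Fin k → ℝ) 1, 0 < ‖f u‖ ∧ ‖f u‖ < 1 := fun u hu =>
    ⟨norm_pos_iff.2 (hf1 u hu).2, mem_ball_zero_iff.1 (hf1 u hu).1⟩
  have hdir : ∀ u ∈ sphere (0 : Fin k → ℝ) 1, ‖f u‖⁻¹ • f u ∈ sphere (0 : Fin k → ℝ) 1 := by
    intro u hu
    rw [mem_sphere_zero_iff_norm, norm_smul, norm_inv, norm_norm, inv_mul_cancel₀ (hn u hu).1.ne']
  have hf2 : ContinuousOn (fun p : ℝ × (Fin k → ℝ) => f p.2) (Icc (0 : ℝ) 1 ×ˢ sphere 0 1) :=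
    hf.comp (by fun_prop) fun p hp => hp.2
  have hninv : ContinuousOn (fun p : ℝ × (Fin k → ℝ) => ‖f p.2‖⁻¹) (Icc (0 : ℝ) 1 ×ˢ sphere 0 1) :=
    hf2.norm.inv₀ fun p hp => (hn _ hp.2).1.ne'
  have hfst : ContinuousOn (fun p : ℝ × (Fin k → ℝ) => p.1) (Icc (0 : ℝ) 1 ×ˢ sphere 0 1) := by
    fun_prop
  -- Inside `φ`, the vector `f u` is moved radially to norm `ρ`; there the hypothesis on `φ` at `0`
  -- gives a homotopy to the direction of `f u` (`hB`), which is finally rescaled to `f u` (`hC`).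
  have hA : SphereHomotopic (fun u => φ (f u) - φ 0)
      (fun u => φ (0 + ρ • (‖f u‖⁻¹ • f u)) - φ 0) := by
    have hnorm : ∀ t ∈ Icc (0 : ℝ) 1, ∀ u ∈ sphere (0 : Fin k → ℝ) 1,
        ‖((1 - t) + t * ρ * ‖f u‖⁻¹) • f u‖ = (1 - t) * ‖f u‖ + t * ρ := by
      intro t ht u hu
      have h1 := (hn u hu).1
      have h2 : 0 ≤ 1 - t := by linarith [ht.2]
      have h3 := ht.1
      rw [norm_smul, Real.norm_of_nonneg (by positivity)]
      field_simp
    have hmem : ∀ t ∈ Icc (0 : ℝ) 1, ∀ u ∈ sphere (0 : Fin k → ℝ) 1,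
        ((1 - t) + t * ρ * ‖f u‖⁻¹) • f u ∈ ball (0 : Fin k → ℝ) 1 := by
      intro t ht u hu
      rw [mem_ball_zero_iff, hnorm t ht u hu]
      calc (1 - t) * ‖f u‖ + t * ρ ≤ (1 - t) * max ‖f u‖ ρ + t * max ‖f u‖ ρ :=
          add_le_add (mul_le_mul_of_nonneg_left (le_max_left _ _) (by linarith [ht.2]))
            (mul_le_mul_of_nonneg_left (le_max_right _ _) ht.1)
        _ = max ‖f u‖ ρ := by ring
        _ < 1 := max_lt (hn u hu).2 hρ1
    refine ⟨fun p => φ (((1 - p.1) + p.1 * ρ * ‖f p.2‖⁻¹) • f p.2) - φ 0, ?_, fun u hu =>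
      ⟨by simp, by simp [mul_smul], fun t ht h => ?_⟩⟩
    · refine (hφ.comp ?_ fun p hp => hmem _ hp.1 _ hp.2).sub continuousOn_const
      exact ((continuousOn_const.sub hfst).add ((hfst.mul continuousOn_const).mul hninv)).smul hf2
    · have h1 := hinj (hmem t ht u hu) (mem_ball_self one_pos) (sub_eq_zero.1 h)
      have h2 := hnorm t ht u hu
      rw [h1, norm_zero] at h2
      obtain ⟨h3, h4⟩ := hn u hu
      nlinarith [ht.1, ht.2, mul_nonneg ht.1 hρ.le, mul_nonneg (sub_nonneg.2 ht.2) h3.le]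
  have hB : SphereHomotopic (fun u => φ (0 + ρ • (‖f u‖⁻¹ • f u)) - φ 0)
      (fun u => ‖f u‖⁻¹ • f u) := by
    refine ⟨fun p => H (p.1, ‖f p.2‖⁻¹ • f p.2), hH.comp (hfst.prodMk (hninv.smul hf2))
      fun p hp => ⟨hp.1, hdir _ hp.2⟩, fun u hu => ?_⟩
    exact hHu _ (hdir u hu)
  have hC : SphereHomotopic (fun u => ‖f u‖⁻¹ • f u) f := by
    refine ⟨fun p => ((1 - p.1) * ‖f p.2‖⁻¹ + p.1) • f p.2,
      (((continuousOn_const.sub hfst).mul hninv).add hfst).smul hf2, fun u hu =>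
      ⟨by simp, by simp, fun t ht h => ?_⟩⟩
    rcases smul_eq_zero.1 h with h | h
    · have h1 := inv_pos.2 (hn u hu).1
      obtain ⟨h2, h3⟩ := ht
      rcases h2.eq_or_lt with rfl | h2
      · simp at h; exact (hf1 u hu).2 h
      · have : 0 ≤ (1 - t) * ‖f u‖⁻¹ := mul_nonneg (by linarith) h1.le
        linarith
    · exact (hf1 u hu).2 h
  exact (hA.trans hB).trans hC

/-- If `φ ∘ h - φ 0` and `g - g x` agree near `x`, for orientation preserving embeddings `φ` and `g`,
then `h` preserves the orientation at `x`. -/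
theorem PreservesOrientationAt.of_comp_eq {φ g h : (Fin k → ℝ) → (Fin k → ℝ)} {x : Fin k → ℝ} {δ : ℝ}
    (hφ : ContinuousOn φ (ball 0 1)) (hinj : InjOn φ (ball 0 1)) (h0 : PreservesOrientationAt φ 0)
    (hg : PreservesOrientationAt g x) (hδ : 0 < δ) (hh : ContinuousOn h (ball x δ)) (hx : h x = 0)
    (hmem : ∀ y ∈ ball x δ, h y ∈ ball (0 : Fin k → ℝ) 1)
    (he : ∀ y ∈ ball x δ, φ (h y) - φ 0 = g y - g x) : PreservesOrientationAt h x := by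
  rw [preservesOrientationAt_iff] at hg ⊢
  obtain ⟨R, hR, hg⟩ := hg
  refine ⟨min R δ, lt_min hR hδ, fun r hr hrR => ?_⟩
  have hgr := hg r hr (hrR.trans_le (min_le_left _ _))
  have hb : ∀ u ∈ sphere (0 : Fin k → ℝ) 1, x + r • u ∈ ball x δ := fun u hu => by
    rw [mem_ball, dist_eq_norm, add_sub_cancel_left, norm_smul, mem_sphere_zero_iff_norm.1 hu,
      mul_one, Real.norm_of_nonneg hr.le]
    exact hrR.trans_le (min_le_right _ _)
  have h1 : SphereHomotopic (fun u => φ (h (x + r • u)) - φ 0) (fun u => h (x + r • u)) := by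
    refine SphereHomotopic.of_embedding hφ hinj h0 (hh.comp (by fun_prop) fun u hu => hb u hu)
      fun u hu => ⟨hmem _ (hb u hu), fun h2 => ?_⟩
    -- A zero of `h` on the sphere would be a zero of `g (x + r • u) - g x`, which starts a homotopy
    -- without zeros.
    obtain ⟨H, -, hH⟩ := hgr
    obtain ⟨h3, -, h4⟩ := hH u hu
    refine h4 0 (by simp) (h3.trans ?_)
    simp only
    rw [← he _ (hb u hu), h2, sub_self]
  refine SphereHomotopic.congr_left (h1.symm.trans (hgr.congr_left fun u hu => ?_)) fun u _ => ?_
  · exact (he _ (hb u hu)).symm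
  · rw [hx, sub_zero]

end Orientation

/-! ## The cellular chain map of `σ` counts punctures -/

namespace CellStructure

variable {d : ℕ} {S : Substitution d} {T : Tiling S} (X : CellStructure T)

/-- `σ` maps a neighbourhood of a point over an open `k`-cell, in a `k`-cell, to the open cell. -/
theorem eventually_sigma_chart_mem {n k : ℕ} (e : X.Cell (n + 1) k) (e' : X.Cell n k)
    {x : Fin k → ℝ} (hx : x ∈ ball 0 1) (h : T.σ n (X.chart e x) ∈ X.openCell e') :
    ∃ δ > 0, ∀ y ∈ ball x δ, y ∈ ball 0 1 ∧ T.σ n (X.chart e y) ∈ X.openCell e' := by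
  -- The union of the closed cells of lower dimension and of the closed `k`-cells other than `e'`.
  -- It is closed, being a finite union of compact sets in a Hausdorff space, and it misses the
  -- given point.
  set C : Set (T.AP n) := (⋃ (j : Fin k) (e'' : X.Cell n j), X.chart e'' '' closedBall 0 1) ∪
    ⋃ e'' : {e'' : X.Cell n k // e'' ≠ e'}, X.chart e''.1 '' closedBall 0 1
  have hcl : ∀ {j} (e'' : X.Cell n j), IsClosed (X.chart e'' '' closedBall 0 1) := fun e'' =>
    ((isCompact_closedBall _ _).image_of_continuousOn (X.continuousOn_chart e'')).isClosed
  have hC : IsClosed C := (isClosed_iUnion_of_finite fun j => isClosed_iUnion_of_finite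
    fun e'' => hcl e'').union (isClosed_iUnion_of_finite fun e'' => hcl e''.1)
  have hxC : T.σ n (X.chart e x) ∉ C := by
    rintro (h1 | h1)
    · simp only [mem_iUnion] at h1
      obtain ⟨j, e'', y, hy, h1⟩ := h1
      refine X.notMem_lowerCells h (X.lowerCells_mono n (Nat.succ_le_of_lt j.2) ?_)
      rw [← h1]
      exact X.chart_mem_lowerCells e'' hy
    · simp only [mem_iUnion] at h1
      obtain ⟨e'', y, hy, h1⟩ := h1
      rw [← h1] at h
      rcases X.chart_mem_openCell_or e''.1 hy with h2 | h2
      · exact e''.2 (X.cell_eq h2 h)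
      · exact X.notMem_lowerCells h h2
  have hF : ContinuousOn (fun y => T.σ n (X.chart e y)) (ball 0 1) :=
    (T.continuous_sigma n).comp_continuousOn
      ((X.continuousOn_chart e).mono ball_subset_closedBall)
  have hnhds := hF.isOpen_inter_preimage isOpen_ball hC.isOpen_compl
  obtain ⟨δ, hδ, hsub⟩ := Metric.isOpen_iff.1 hnhds x ⟨hx, hxC⟩
  refine ⟨δ, hδ, fun y hy => ⟨(hsub hy).1, ?_⟩⟩
  have hyC : T.σ n (X.chart e y) ∉ C := (hsub hy).2
  obtain ⟨e'', z, hz, h1⟩ := X.exists_chart_eq_sigma e (ball_subset_closedBall (hsub hy).1)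
  have h2 : e'' = e' := by
    by_contra hne
    exact hyC (Or.inr (mem_iUnion.2 ⟨⟨e'', hne⟩, z, hz, h1⟩))
  subst h2
  rw [← h1] at hyC ⊢
  rcases X.chart_mem_openCell_or e'' hz with h2 | ⟨j, hj, e₁, w, hw, h2⟩
  · exact h2
  · refine absurd (Or.inl ?_) hyC
    exact mem_iUnion.2 ⟨⟨j, hj⟩, mem_iUnion.2 ⟨e₁, w, ball_subset_closedBall hw, h2⟩⟩

/-- If the cells `e` and `e'` are oriented by the same linear map then `σ` preserves the orientation
where it maps `e` to `e'`. -/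
theorem preservesOrientationAt_sigma {n k : ℕ} {e : X.Cell (n + 1) k} {e' : X.Cell n k}
    {L : (Fin k → ℝ) →ₗ[ℝ] Euc d} (hL : X.OrientedBy e L) (hL' : X.OrientedBy e' L)
    {x : Fin k → ℝ} (hx : x ∈ ball 0 1) (h : T.σ n (X.chart e x) = X.chart e' 0) :
    PreservesOrientationAt (fun y => (X.chart e').symm (T.σ n (X.chart e y))) x := by
  obtain ⟨hLinj, a, x₀, g, hg, hg0, hgc⟩ := hL
  obtain ⟨-, a', x₀', g', hg', hg0', hgc'⟩ := hL'
  have h0 : (0 : Fin k → ℝ) ∈ ball 0 1 := mem_ball_self one_pos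
  have hginj : InjOn g (ball 0 1) := fun y hy z hz hyz =>
    X.chart_injOn e hy hz (by rw [← (hgc y hy).2, ← (hgc z hz).2, hyz])
  have hginj' : InjOn g' (ball 0 1) := fun y hy z hz hyz =>
    X.chart_injOn e' hy hz (by rw [← (hgc' y hy).2, ← (hgc' z hz).2, hyz])
  obtain ⟨δ, hδ, hδe⟩ := X.eventually_sigma_chart_mem e e' hx (h ▸ X.chart_mem e' h0)
  set F : (Fin k → ℝ) → (Fin k → ℝ) := fun y => (X.chart e').symm (T.σ n (X.chart e y))
  have hFmem : ∀ y ∈ ball x δ, F y ∈ ball (0 : Fin k → ℝ) 1 := fun y hy => by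
    rw [← X.chart_source e']
    exact (X.chart e').map_target (X.openCell_eq_target e' ▸ (hδe y hy).2)
  have hFe : ∀ y ∈ ball x δ, X.chart e' (F y) = T.σ n (X.chart e y) := fun y hy =>
    (X.chart e').right_inv (X.openCell_eq_target e' ▸ (hδe y hy).2)
  have hFx : F x = 0 := by
    simp only [F, h]
    exact (X.chart e').left_inv (by rw [X.chart_source]; exact h0)
  have hF : ContinuousOn F (ball x δ) :=
    (X.continuousOn_chart_symm e').comp ((T.continuous_sigma n).comp_continuousOn
      ((X.continuousOn_chart e).mono fun y hy => ball_subset_closedBall (hδe y hy).1))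
      fun y hy => (hδe y hy).2
  -- `w y` is the difference of two points of `ℝᵈ` with the same image in `AP n`. Translation by it
  -- takes a fixed supertile to one that meets a bounded set, so `w` has finitely many values; being
  -- continuous on a ball it is constant. Up to a translation, `L ∘ g` and `L ∘ g' ∘ F` thus agree.
  set w : (Fin k → ℝ) → Euc d := fun y => (a + L (g y)) - (a' + L (g' (F y)))
  have hLc : Continuous L := L.continuous_of_finiteDimensional
  have hw : ContinuousOn w (ball x δ) :=
    (continuousOn_const.add (hLc.comp_continuousOn (hg.mono fun y hy => (hδe y hy).1))).sub
      (continuousOn_const.add (hLc.comp_continuousOn (hg'.comp hF hFmem)))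
  have hproj : ∀ y ∈ ball x δ, T.proj n (a' + L (g' (F y))) = T.proj n (a + L (g y)) := by
    intro y hy
    rw [(hgc' _ (hFmem y hy)).2, hFe y hy, ← (hgc y (hδe y hy).1).2, T.sigma_proj]
  obtain ⟨t, ht, htx⟩ := T.exists_tile_mem n x₀'
  have hfin : (w '' ball x δ).Finite := by
    refine Finite.of_injOn (f := fun v => S.shift v t) (t := {t ∈ T.tiles n |
      (S.tileSupp n t ∩ T.openCellAt (n + 1) x₀).Nonempty}) ?_ ?_
      (T.finite_tiles_meeting n (T.isBounded_openCellAt _ _))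
    · rintro _ ⟨y, hy, rfl⟩
      have h1 : S.shift (w y) t ∈ T.tilesAt n (a + L (g y)) := by
        rw [T.tilesAt_eq_of_proj_eq le_rfl (hproj y hy)]
        refine ⟨t, ?_, rfl⟩
        rw [T.mem_stratum.1 (connectedComponentIn_subset _ _ (hgc' _ (hFmem y hy)).1)]
        exact ⟨ht, htx⟩
      exact ⟨h1.1, _, h1.2, (hgc y (hδe y hy).1).1⟩
    · intro v _ v' _ hvv
      simpa [Substitution.shift] using hvv
  have hconst : ∀ y ∈ ball x δ, w y = w x := by
    have hpre := (convex_ball x δ).isPreconnected.image w hw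
    have hdisc : IsDiscrete (w '' ball x δ) := hfin.isDiscrete
    intro y hy
    exact (hpre.isDiscrete_iff_subsingleton.1 hdisc) ⟨y, hy, rfl⟩ ⟨x, mem_ball_self hδ, rfl⟩
  refine PreservesOrientationAt.of_comp_eq hg' hginj' hg0'
    (PreservesOrientationAt.of_center hg hginj hg0 hx) hδ hF hFx hFmem fun y hy => ?_
  have h1 := hconst y hy
  simp only [w, hFx] at h1
  apply hLinj
  rw [map_sub, map_sub]
  rw [sub_eq_sub_iff_add_eq_add] at h1 ⊢
  have h2 := congrArg (fun v => v - a - a') h1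
  rw [show a + L (g y) + (a' + L (g' 0)) - a - a' = L (g y) + L (g' 0) by abel,
    show a + L (g x) + (a' + L (g' (F y))) - a - a' = L (g' (F y)) + L (g x) by abel] at h2
  exact h2.symm

/-- Whenever `σ` maps a point of an open `k`-cell to an open `k`-cell, both cells are oriented by the
same linear map. -/
def IsCoherent (k : ℕ) : Prop :=
  ∀ n (e : X.Cell (n + 1) k) (e' : X.Cell n k), (∃ p ∈ X.openCell e, T.σ n p ∈ X.openCell e') →
    ∃ L, X.OrientedBy e L ∧ X.OrientedBy e' L

variable {X}

theorem IsOriented.isCoherent_top (h : X.IsOriented) : X.IsCoherent d :=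
  fun n e e' _ => ⟨_, h.top (n + 1) e, h.top n e'⟩

theorem IsOriented.isCoherent_of_boundaryHyperplane (h : X.IsOriented) (hb : X.BoundaryHyperplane)
    {k : ℕ} (hk : k < d) : X.IsCoherent k :=
  fun n e e' hp => h.flat n k hk e e' (hb (n + 1) k hk e) hp

/-- Coherence makes every local degree equal to `1`, so the incidence number counts the points over
the centre of `e'`; `ncard_fiber_eq` replaces the centre by `c`. -/
theorem IsCoherent.incidence_eq {k : ℕ} (h : X.IsCoherent k) {n : ℕ} (e : X.Cell (n + 1) k)
    {e' : X.Cell n k} {c : T.AP n} (hc : c ∈ X.openCell e') :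
    X.incidence e e' = {p ∈ X.openCell e | T.σ n p = c}.ncard := by
  have h0 : (0 : Fin k → ℝ) ∈ ball 0 1 := mem_ball_self one_pos
  rw [X.ncard_fiber_eq e hc (X.chart_mem e' h0)]
  set A := {x | x ∈ ball (0 : Fin k → ℝ) 1 ∧ T.σ n (X.chart e x) = X.chart e' 0}
  have h1 : X.incidence e e' = ∑ᶠ x ∈ A, (1 : ℤ) := by
    refine finsum_mem_congr rfl fun x hx => if_pos ?_
    obtain ⟨L, hL, hL'⟩ := h n e e' ⟨_, X.chart_mem e hx.1, hx.2 ▸ X.chart_mem e' h0⟩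
    exact X.preservesOrientationAt_sigma hL hL' hx.1 hx.2
  have h2 : {p ∈ X.openCell e | T.σ n p = X.chart e' 0} = X.chart e '' A := by
    ext p
    constructor
    · rintro ⟨⟨x, hx, rfl⟩, hp⟩
      exact ⟨x, ⟨hx, hp⟩, rfl⟩
    · rintro ⟨x, ⟨hx, hp⟩, rfl⟩
      exact ⟨⟨x, hx, rfl⟩, hp⟩
  have hinj : InjOn (X.chart e) A := (X.chart_injOn e).mono fun x hx => hx.1
  -- Finiteness matters here: on an infinite set the `finsum` of ones would be `0`.
  have hfin : A.Finite := by
    refine Finite.of_finite_image ?_ hinj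
    rw [← h2]
    exact X.finite_openCell_fiber e _
  rw [h1, h2, hinj.ncard_image, finsum_mem_eq_finite_toFinset_sum _ hfin,
    ncard_eq_toFinset_card A hfin]
  simp

open Classical in
/-- The map `σᵀ` sends the dual of a cell to the sum of the duals of the cells of the
punctures over a given puncture of the cell. -/
theorem IsCoherent.sigmaT_single {k : ℕ} (h : X.IsCoherent k) {pun : ℕ → Set (T.AP 0)} {n : ℕ}
    [Fintype (X.punctures pun (n + 1) k)]
    (cell : X.punctures pun (n + 1) k → X.Cell (n + 1) k) (hcell : ∀ p, p.1 ∈ X.openCell (cell p))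
    {e' : X.Cell n k} {c : T.AP n} (hc : c ∈ X.punctures pun n k) (hce : c ∈ X.openCell e') :
    X.sigmaT n k (Pi.single e' 1) =
      ∑ p : X.punctures pun (n + 1) k, if T.σ n p.1 = c then Pi.single (cell p) 1 else 0 := by
  ext e
  have h1 : X.sigmaT n k (Pi.single e' 1) e = X.incidence e e' := by
    change (Matrix.mulVec _ _) e = _
    rw [Matrix.mulVec_single_one]
    rfl
  rw [h1, h.incidence_eq e hce, Finset.sum_apply]
  have h2 : ∀ p : X.punctures pun (n + 1) k,
      (if T.σ n p.1 = c then Pi.single (cell p) (1 : ℤ) else 0 : X.Cochain (n + 1) k) e =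
        if T.σ n p.1 = c ∧ e = cell p then 1 else 0 := by
    intro p
    by_cases h4 : T.σ n p.1 = c <;> simp [h4, Pi.single_apply]
  have h3 : ∀ p : X.punctures pun (n + 1) k, e = cell p ↔ p.1 ∈ X.openCell e := fun p =>
    ⟨fun he => he ▸ hcell p, fun he => X.cell_eq he (hcell p)⟩
  rw [Finset.sum_congr rfl fun p _ => h2 p, Finset.sum_boole, ← Set.ncard_coe_finset,
    ← ncard_image_of_injective _ Subtype.val_injective]
  congr 2
  ext p
  simp only [Finset.coe_filter, Finset.mem_univ, true_and, mem_image, mem_ofPred_eq, h3]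
  constructor
  · rintro ⟨hp, hpc⟩
    exact ⟨⟨p, ⟨e, hp⟩, by rw [Tiling.descend, hpc]; exact hc.2⟩, ⟨hpc, hp⟩, rfl⟩
  · rintro ⟨q, ⟨h4, h5⟩, rfl⟩
    exact ⟨h5, h4⟩

end CellStructure

/-! ## Perturbation of projections in C*-algebras -/

section Perturbation

/-- In a unital C*-algebra, an element close to `1` has an inverse square root. -/
theorem exists_inv_sqrt {U : Type*} [CStarAlgebra U] {a : U} (ha : IsSelfAdjoint a)
    (h : ‖a - 1‖ < 1) : ∃ s : U, IsSelfAdjoint s ∧ s * a * s = 1 ∧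
      ∀ b, Commute a b → Commute s b := by
  rcases subsingleton_or_nontrivial U with h' | h'
  · exact ⟨1, IsSelfAdjoint.one _, Subsingleton.elim _ _, fun b _ => Commute.one_left b⟩
  have hpos : ∀ x ∈ spectrum ℝ a, 0 < x := by
    intro x hx
    have h1 : x - 1 ∈ spectrum ℝ (a - 1) := by
      have := spectrum.sub_singleton_eq (R := ℝ) a 1
      rw [map_one] at this
      rw [← this]
      exact Set.sub_mem_sub hx rfl
    have h2 := spectrum.norm_le_norm_of_mem h1
    rw [Real.norm_eq_abs] at h2
    linarith [(abs_le.1 h2).1]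
  have hcont : ContinuousOn (fun x : ℝ => (√x)⁻¹) (spectrum ℝ a) :=
    (Real.continuous_sqrt.continuousOn).inv₀ fun x hx => (Real.sqrt_pos.2 (hpos x hx)).ne'
  refine ⟨cfc (fun x : ℝ => (√x)⁻¹) a, cfc_predicate _ a, ?_, fun b hb =>
    hb.cfc_real _⟩
  calc cfc (fun x : ℝ => (√x)⁻¹) a * a * cfc (fun x : ℝ => (√x)⁻¹) a
      = cfc (fun x : ℝ => (√x)⁻¹) a * cfc (fun x : ℝ => x) a * cfc (fun x : ℝ => (√x)⁻¹) a := by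
        rw [cfc_id' ℝ a]
    _ = cfc (fun x : ℝ => (√x)⁻¹ * x * (√x)⁻¹) a := by
        rw [← cfc_mul _ _ a hcont (continuousOn_id' _),
          ← cfc_mul (fun x : ℝ => (√x)⁻¹ * x) _ a (hcont.mul (continuousOn_id' _)) hcont]
    _ = cfc (fun _ : ℝ => (1 : ℝ)) a := by
        refine cfc_congr fun x hx => ?_
        have h1 := hpos x hx
        have h2 := Real.sqrt_pos.2 h1
        have h3 := Real.mul_self_sqrt h1.le
        field_simp
        nlinarith
    _ = 1 := cfc_const_one ℝ a

variable {M : Type*} [NonUnitalCStarAlgebra M]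

/-- If `z ∈ qMp` is almost a partial isometry from `p` to `q` then `p` and `q` are equivalent. -/
theorem exists_partialIsometry {p q z : M} (hp : IsStarProjection p) (hq : IsStarProjection q)
    (hzp : z * p = z) (hqz : q * z = z) (h1 : ‖star z * z - p‖ < 1) (h2 : ‖z * star z - q‖ < 1) :
    ∃ v : M, star v * v = p ∧ v * star v = q ∧ v * p = v ∧ q * v = v := by
  have hpp := hp.isIdempotentElem.eq
  have hps := hp.isSelfAdjoint.star_eq
  have hqq := hq.isIdempotentElem.eq
  have hqs := hq.isSelfAdjoint.star_eq
  set P : Unitization ℂ M := (p : Unitization ℂ M) with hP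
  set Z : Unitization ℂ M := (z : Unitization ℂ M) with hZ
  have hPP : P * P = P := by rw [hP, ← Unitization.inr_mul, hpp]
  have hPs : star P = P := by rw [hP, ← Unitization.inr_star, hps]
  have hZP : Z * P = Z := by rw [hP, hZ, ← Unitization.inr_mul, hzp]
  have hPZ : P * star Z = star Z := by
    have := congrArg star hZP
    rwa [star_mul, hPs] at this
  -- In the unitization `K - 1` is `star z * z - p`, so `K` has an inverse square root `s`, which
  -- commutes with `p`. Then `z s` is the partial isometry in the polar decomposition of `z`.
  set K : Unitization ℂ M := star Z * Z + (1 - P) with hK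
  have hKs : IsSelfAdjoint K := by
    simp [IsSelfAdjoint, hK, star_add, star_mul, star_sub, hPs]
  have hK1 : ‖K - 1‖ < 1 := by
    have : K - 1 = ((star z * z - p : M) : Unitization ℂ M) := by
      rw [hK, hZ, hP, ← Unitization.inr_star, ← Unitization.inr_mul, Unitization.inr_sub]
      abel
    rwa [this, Unitization.norm_inr]
  obtain ⟨s, hss, hsK, hcomm⟩ := exists_inv_sqrt hKs hK1
  have hPK : P * K = star Z * Z := by
    rw [hK, mul_add, ← mul_assoc, hPZ, mul_sub, mul_one, hPP, sub_self, add_zero]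
  have hKP : K * P = star Z * Z := by
    rw [hK, add_mul, mul_assoc, hZP, sub_mul, one_mul, hPP, sub_self, add_zero]
  have hsP : Commute s P := hcomm P (by rw [Commute, SemiconjBy, hKP, hPK])
  have hsK' : Commute s K := hcomm K (Commute.refl K)
  set v : M := (Z * s).snd with hv
  have hZs : (v : Unitization ℂ M) = Z * s := by
    have : (Z * s).fst = 0 := by simp [hZ]
    rw [hv]
    conv_rhs => rw [← Unitization.inl_fst_add_inr_snd_eq (Z * s), this]
    simp
  have inj : Function.Injective ((↑) : M → Unitization ℂ M) := Unitization.inr_injective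
  have hvv : star v * v = p := by
    apply inj
    rw [Unitization.inr_mul, Unitization.inr_star, hZs, star_mul, hss.star_eq]
    calc s * star Z * (Z * s) = s * (star Z * Z) * s := by simp only [mul_assoc]
      _ = s * (P * K) * s := by rw [hPK]
      _ = P * (s * K * s) := by rw [← mul_assoc, hsP.eq]; simp only [mul_assoc]
      _ = P := by rw [hsK, mul_one]
  have hvp : v * p = v := by
    apply inj
    rw [Unitization.inr_mul, hZs, mul_assoc, hsP.eq, ← mul_assoc, hZP]
  have hqv : q * v = v := by
    apply inj
    rw [Unitization.inr_mul, hZs, ← mul_assoc, hZ, ← Unitization.inr_mul, hqz]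
  refine ⟨v, hvv, ?_, hvp, hqv⟩
  have hvq : star v * q = star v := by
    have := congrArg star hqv
    rwa [star_mul, hqs] at this
  -- The defect `e` is a projection with `e * z = 0`. Hence `e = -e * (z * star z - q)` has norm
  -- less than `1` and must vanish.
  set e := q - v * star v with he
  have hee : e * e = e := by
    have h3 : v * star v * (v * star v) = v * star v := by
      rw [mul_assoc, ← mul_assoc (star v), hvv, ← mul_assoc, hvp]
    rw [he, sub_mul, mul_sub, mul_sub, hqq, ← mul_assoc q, hqv, mul_assoc v _ q, hvq, h3]
    abel
  have hes : star e = e := by rw [he, star_sub, star_mul, star_star, hqs]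
  have heq : e * q = e := by rw [he, sub_mul, hqq, mul_assoc, hvq]
  have hez : e * z = 0 := by
    have h3 : Z = (v : Unitization ℂ M) * (K * s) := by
      rw [hZs, mul_assoc, ← mul_assoc s, hsK, mul_one]
    have h4 : e * v = 0 := by
      rw [he, sub_mul, hqv, mul_assoc, hvv, hvp, sub_self]
    apply inj
    rw [Unitization.inr_mul, ← hZ, h3, ← mul_assoc, ← Unitization.inr_mul, h4]
    simp
  have heproj : IsStarProjection e := ⟨hee, hes⟩
  have hne : ‖e‖ < 1 := by
    have h3 : e = -(e * (z * star z - q)) := by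
      rw [mul_sub, ← mul_assoc, hez, zero_mul, heq]; abel
    calc ‖e‖ = ‖e * (z * star z - q)‖ := by conv_lhs => rw [h3, norm_neg]
      _ ≤ ‖e‖ * ‖z * star z - q‖ := norm_mul_le _ _
      _ ≤ 1 * ‖z * star z - q‖ := by gcongr; exact heproj.norm_le
      _ < 1 := by rwa [one_mul]
  have he0 : e = 0 := by
    have h3 : ‖e‖ = ‖e‖ * ‖e‖ := by
      rw [← CStarRing.norm_star_mul_self, hes, hee]
    have : ‖e‖ = 0 := by nlinarith [norm_nonneg e]
    exact norm_eq_zero.1 this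
  exact (sub_eq_zero.1 he0).symm

/-- Close projections are equivalent. -/
theorem exists_partialIsometry_of_norm_sub_lt {p q : M} (hp : IsStarProjection p)
    (hq : IsStarProjection q) (h : ‖p - q‖ < 1) :
    ∃ v : M, star v * v = p ∧ v * star v = q := by
  have hpp := hp.isIdempotentElem.eq
  have hps := hp.isSelfAdjoint.star_eq
  have hqq := hq.isIdempotentElem.eq
  have hqs := hq.isSelfAdjoint.star_eq
  have key : ∀ {p q : M}, IsStarProjection p → p * p = p → ‖q - p‖ < 1 → ‖p * q * p - p‖ < 1 := by
    intro p q hp hpp h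
    have h1 : p * q * p - p = p * (q - p) * p := by
      rw [mul_sub, sub_mul, hpp, hpp]
    rw [h1]
    calc ‖p * (q - p) * p‖ ≤ ‖p‖ * ‖q - p‖ * ‖p‖ :=
          (norm_mul_le _ _).trans (by gcongr; exact norm_mul_le _ _)
      _ ≤ 1 * ‖q - p‖ * 1 := by gcongr <;> exact hp.norm_le
      _ < 1 := by simpa
  -- The element `q * p` is almost a partial isometry: `star (q * p) * (q * p)` is `p * q * p`,
  -- which is within `‖p - q‖` of `p`.
  obtain ⟨v, h1, h2, -, -⟩ := exists_partialIsometry (z := q * p) hp hq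
    (by rw [mul_assoc, hpp]) (by rw [← mul_assoc, hqq])
    (by rw [star_mul, hps, hqs, mul_assoc, ← mul_assoc q, hqq, ← mul_assoc]
        exact key hp hpp (by rwa [norm_sub_rev]))
    (by rw [star_mul, hps, hqs, mul_assoc, ← mul_assoc p, hpp, ← mul_assoc]
        exact key hq hqq h)
  exact ⟨v, h1, h2⟩

/-- Close to a self-adjoint element that is almost idempotent there is a projection. -/
theorem exists_isStarProjection_norm_sub_lt {x : M} (hx : IsSelfAdjoint x)
    (h : ‖x * x - x‖ < 1 / 4) : ∃ p : M, IsStarProjection p ∧ ‖p - x‖ < 1 / 2 := by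
  -- The spectrum avoids `1 / 2`, where `|t * t - t|` equals `1 / 4`, so this step function is
  -- continuous on it.
  set f : ℝ → ℝ := fun t => if t < 1 / 2 then 0 else 1 with hf
  have hsq : ∀ t ∈ quasispectrum ℝ x, |t * t - t| < 1 / 4 := by
    intro t ht
    have h1 : cfcₙ (fun t : ℝ => t * t - t) x = x * x - x := by
      rw [cfcₙ_sub (fun t : ℝ => t * t) (fun t => t) x, cfcₙ_mul (fun t : ℝ => t) (fun t => t) x,
        cfcₙ_id' ℝ x]
    have h2 := norm_apply_le_norm_cfcₙ (fun t : ℝ => t * t - t) x ht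
    rw [h1] at h2
    exact h2.trans_lt h
  have hne : ∀ t ∈ quasispectrum ℝ x, t ≠ 1 / 2 := by
    rintro t ht rfl
    have := hsq _ ht
    norm_num [abs_of_pos, abs_of_neg] at this
  have hcont : ContinuousOn f (quasispectrum ℝ x) := by
    intro t ht
    refine ContinuousAt.continuousWithinAt ?_
    rcases lt_or_gt_of_ne (hne t ht) with h1 | h1
    · refine (continuousAt_const (y := (0 : ℝ))).congr ?_
      filter_upwards [Iio_mem_nhds h1] with s hs
      exact (if_pos hs).symm
    · refine (continuousAt_const (y := (1 : ℝ))).congr ?_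
      filter_upwards [Ioi_mem_nhds h1] with s hs
      exact (if_neg (not_lt.2 (le_of_lt hs))).symm
  have hf0 : f 0 = 0 := by simp [hf]
  refine ⟨cfcₙ f x, ⟨?_, cfcₙ_predicate f x⟩, ?_⟩
  · rw [IsIdempotentElem, ← cfcₙ_mul f f x hcont hf0 hcont hf0]
    refine cfcₙ_congr fun t _ => ?_
    simp only [hf]
    split_ifs <;> simp
  · conv_lhs => rw [← cfcₙ_id' ℝ x]
    rw [cfcₙ_id' ℝ x, show cfcₙ f x - x = cfcₙ f x - cfcₙ (fun t : ℝ => t) x by rw [cfcₙ_id' ℝ x],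
      ← cfcₙ_sub f (fun t => t) x hcont hf0]
    refine norm_cfcₙ_lt fun t ht => ?_
    have h1 := hsq t ht
    rw [abs_lt] at h1
    simp only [hf, Real.norm_eq_abs]
    split_ifs with h2
    · rw [abs_lt]; constructor <;> nlinarith
    · rw [not_lt] at h2
      have := lt_of_le_of_ne h2 (hne t ht).symm
      rw [abs_lt]; constructor <;> nlinarith

end Perturbation

/-! ## Approximation of projections by subalgebras -/

section Approximation

variable {M : Type*} [NonUnitalCStarAlgebra M] (D : NonUnitalStarSubalgebra ℂ M)

/-- The closed subalgebra `D` is itself a C*-algebra, so the functional calculus of the symmetrised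
`x` gives a projection of `D`. Its distance from `p` is less than `1 / 2 + 1 / 20 < 1`, and close
projections are equivalent. -/
theorem exists_isStarProjection_mem (hD : IsClosed (D : Set M)) {p x : M}
    (hp : IsStarProjection p) (hx : x ∈ D) (h : ‖x - p‖ < 1 / 20) :
    ∃ q ∈ D, IsStarProjection q ∧ ∃ v : M, star v * v = p ∧ v * star v = q := by
  have := hD
  have hps := hp.isSelfAdjoint.star_eq
  have hpp := hp.isIdempotentElem.eq
  set y : M := (1 / 2 : ℂ) • (x + star x) with hy
  have hyD : y ∈ D := SMulMemClass.smul_mem _ (add_mem hx (star_mem hx))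
  have hys : star y = y := by
    rw [hy, star_smul, star_add, star_star, add_comm]
    simp
  have hyp : ‖y - p‖ < 1 / 20 := by
    have h1 : y - p = (1 / 2 : ℂ) • ((x - p) + star (x - p)) := by
      rw [hy, star_sub, hps]
      have : p = (1 / 2 : ℂ) • (p + p) := by rw [← two_smul ℂ p, smul_smul]; norm_num
      conv_lhs => rw [this]
      rw [← smul_sub]
      congr 1
      abel
    rw [h1, norm_smul]
    have h2 := norm_add_le (x - p) (star (x - p))
    rw [norm_star] at h2
    have h3 : ‖(1 / 2 : ℂ)‖ = 1 / 2 := by norm_num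
    rw [h3]
    linarith
  have hpn : ‖p‖ ≤ 1 := hp.norm_le
  have hyy : ‖y * y - y‖ < 1 / 4 := by
    have h1 : y * y - y = (y - p) * (y - p) + ((y - p) * p + p * (y - p)) - (y - p) := by
      simp only [mul_sub, sub_mul, hpp]
      abel
    rw [h1]
    have h2 : ‖(y - p) * (y - p)‖ ≤ 1 / 20 * (1 / 20) :=
      (norm_mul_le _ _).trans (by gcongr)
    have h3 : ‖(y - p) * p‖ ≤ 1 / 20 * 1 := (norm_mul_le _ _).trans (by gcongr)
    have h4 : ‖p * (y - p)‖ ≤ 1 * (1 / 20) := (norm_mul_le _ _).trans (by gcongr)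
    have h5 := norm_sub_le ((y - p) * (y - p) + ((y - p) * p + p * (y - p))) (y - p)
    have h6 := norm_add_le ((y - p) * (y - p)) ((y - p) * p + p * (y - p))
    have h7 := norm_add_le ((y - p) * p) (p * (y - p))
    linarith
  obtain ⟨q, hq, hqy⟩ := exists_isStarProjection_norm_sub_lt (x := (⟨y, hyD⟩ : D))
    (Subtype.ext hys) hyy
  have hq' : IsStarProjection (q : M) :=
    ⟨congrArg Subtype.val hq.isIdempotentElem.eq, congrArg Subtype.val hq.isSelfAdjoint.star_eq⟩
  have hqy' : ‖(q : M) - y‖ < 1 / 2 := hqy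
  refine ⟨q, q.2, hq', exists_partialIsometry_of_norm_sub_lt hp hq' ?_⟩
  have h1 := norm_sub_le_norm_sub_add_norm_sub p y (q : M)
  rw [norm_sub_rev p y, norm_sub_rev y (q : M)] at h1
  linarith

/-- Compression replaces `w` by `q * w * p`, still within `1 / 4` of `v`. The errors in both
products are then at most `1 / 16 + 1 / 4 + 1 / 4 < 1`, so the polar decomposition can be carried
out inside `D`. -/
theorem exists_partialIsometry_mem (hD : IsClosed (D : Set M)) {p q v w : M} (hp : p ∈ D)
    (hq : q ∈ D) (hpp : IsStarProjection p) (hqp : IsStarProjection q) (hv : star v * v = p)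
    (hv' : v * star v = q) (hw : w ∈ D) (h : ‖w - v‖ < 1 / 4) :
    ∃ u ∈ D, star u * u = p ∧ u * star u = q := by
  have := hD
  have hps := hpp.isSelfAdjoint.star_eq
  have hp2 := hpp.isIdempotentElem.eq
  have hqs := hqp.isSelfAdjoint.star_eq
  have hq2 := hqp.isIdempotentElem.eq
  have hvp : v * p = v := by
    have h1 : star (v * p - v) * (v * p - v) = 0 := by
      have h2 : p * star v * (v * p) = p := by rw [mul_assoc, ← mul_assoc _ v, hv, hp2, hp2]
      have h3 : p * star v * v = p := by rw [mul_assoc, hv, hp2]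
      have h4 : star v * (v * p) = p := by rw [← mul_assoc, hv, hp2]
      rw [star_sub, star_mul, hps, sub_mul, mul_sub, mul_sub, h2, h3, h4, hv]
      abel
    exact sub_eq_zero.1 ((CStarRing.star_mul_self_eq_zero_iff _).1 h1)
  have hqv : q * v = v := by rw [← hv', mul_assoc, hv, hvp]
  have hpn : ‖p‖ ≤ 1 := hpp.norm_le
  have hqn : ‖q‖ ≤ 1 := hqp.norm_le
  have hvn : ‖v‖ ≤ 1 := by
    have := CStarRing.norm_star_mul_self (x := v)
    rw [hv] at this
    nlinarith [norm_nonneg v]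
  set z := q * w * p with hz
  have hzD : z ∈ D := mul_mem (mul_mem hq hw) hp
  have hzv : ‖z - v‖ ≤ 1 / 4 := by
    have h1 : z - v = q * (w - v) * p := by
      rw [mul_sub, sub_mul, hqv, hvp]
    rw [h1]
    calc ‖q * (w - v) * p‖ ≤ ‖q‖ * ‖w - v‖ * ‖p‖ :=
          (norm_mul_le _ _).trans (by gcongr; exact norm_mul_le _ _)
      _ ≤ 1 * (1 / 4) * 1 := by gcongr
      _ = 1 / 4 := by norm_num
  have hzs : ‖star (z - v)‖ ≤ 1 / 4 := by rwa [norm_star]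
  have hvs : ‖star v‖ ≤ 1 := by rwa [norm_star]
  have key1 : ‖star z * z - p‖ < 1 := by
    have h1 : star z * z - p = star (z - v) * (z - v) + (star (z - v) * v + star v * (z - v)) := by
      rw [← hv]
      simp only [star_sub, mul_sub, sub_mul]
      abel
    rw [h1]
    have h2 : ‖star (z - v) * (z - v)‖ ≤ 1 / 4 * (1 / 4) := (norm_mul_le _ _).trans (by gcongr)
    have h3 : ‖star (z - v) * v‖ ≤ 1 / 4 * 1 := (norm_mul_le _ _).trans (by gcongr)
    have h4 : ‖star v * (z - v)‖ ≤ 1 * (1 / 4) := (norm_mul_le _ _).trans (by gcongr)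
    have h6 := norm_add_le (star (z - v) * (z - v)) (star (z - v) * v + star v * (z - v))
    have h7 := norm_add_le (star (z - v) * v) (star v * (z - v))
    linarith
  have key2 : ‖z * star z - q‖ < 1 := by
    have h1 : z * star z - q = (z - v) * star (z - v) + ((z - v) * star v + v * star (z - v)) := by
      rw [← hv']
      simp only [star_sub, mul_sub, sub_mul]
      abel
    rw [h1]
    have h2 : ‖(z - v) * star (z - v)‖ ≤ 1 / 4 * (1 / 4) := (norm_mul_le _ _).trans (by gcongr)
    have h3 : ‖(z - v) * star v‖ ≤ 1 / 4 * 1 := (norm_mul_le _ _).trans (by gcongr)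
    have h4 : ‖v * star (z - v)‖ ≤ 1 * (1 / 4) := (norm_mul_le _ _).trans (by gcongr)
    have h6 := norm_add_le ((z - v) * star (z - v)) ((z - v) * star v + v * star (z - v))
    have h7 := norm_add_le ((z - v) * star v) (v * star (z - v))
    linarith
  obtain ⟨u, h1, h2, -, -⟩ := exists_partialIsometry (M := D) (p := ⟨p, hp⟩) (q := ⟨q, hq⟩)
    (z := ⟨z, hzD⟩) ⟨Subtype.ext hp2, Subtype.ext hps⟩ ⟨Subtype.ext hq2, Subtype.ext hqs⟩
    (Subtype.ext (by change q * w * p * p = q * w * p; rw [mul_assoc, hp2]))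
    (Subtype.ext (by change q * (q * w * p) = q * w * p; simp only [← mul_assoc, hq2]))
    key1 key2
  exact ⟨u, u.2, congrArg Subtype.val h1, congrArg Subtype.val h2⟩

end Approximation

/-! ## Matrices over an increasing union of subalgebras -/

section MatrixApproximation

open scoped Matrix

variable {A : Type*} [NonUnitalCStarAlgebra A]

/-- The matrices with entries in a given subalgebra. -/
def matrixSubalgebra (ι : Type*) [Fintype ι] (B : NonUnitalStarSubalgebra ℂ A) :
    NonUnitalStarSubalgebra ℂ (CStarMatrix ι ι A) where
  carrier := {W | ∀ i j, W i j ∈ B}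
  add_mem' h h' i j := add_mem (h i j) (h' i j)
  zero_mem' _ _ := zero_mem B
  mul_mem' {a b} h h' i j := by
    rw [CStarMatrix.mul_apply]
    exact sum_mem fun k _ => mul_mem (h i k) (h' k j)
  smul_mem' c W h i j := SMulMemClass.smul_mem c (h i j)
  star_mem' {a} h i j := by
    rw [CStarMatrix.star_apply]
    exact star_mem (h j i)

theorem isClosed_matrixSubalgebra {ι : Type*} [Fintype ι] {B : NonUnitalStarSubalgebra ℂ A}
    (hB : IsClosed (B : Set A)) : IsClosed (matrixSubalgebra ι B : Set (CStarMatrix ι ι A)) := by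
  have : (matrixSubalgebra ι B : Set (CStarMatrix ι ι A)) =
      ⋂ i, ⋂ j, (fun W : CStarMatrix ι ι A => W i j) ⁻¹' (B : Set A) := by
    ext W
    simp only [mem_iInter, mem_preimage, SetLike.mem_coe]
    rfl
  rw [this]
  refine isClosed_iInter fun i => isClosed_iInter fun j => hB.preimage ?_
  exact (continuous_apply j).comp (continuous_apply (A := fun _ => ι → A) i)

section Order

variable [PartialOrder A] [StarOrderedRing A]

/-- The norm of `CStarMatrix` induces entrywise convergence, so it suffices to approximate the
finitely many entries. The sum of their levels bounds them all. -/
theorem exists_matrix_near {ι : Type*} [Fintype ι] {B : ℕ → NonUnitalStarSubalgebra ℂ A}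
    (hmono : Monotone B) (hdense : ∀ a : A, ∀ ε > 0, ∃ n, ∃ b ∈ B n, ‖b - a‖ < ε)
    (W : CStarMatrix ι ι A) {ε : ℝ} (hε : 0 < ε) (n₀ : ℕ) :
    ∃ n ≥ n₀, ∃ W' ∈ matrixSubalgebra ι (B n), ‖W' - W‖ < ε := by
  have hcont : Continuous (fun x : ι → ι → A => (CStarMatrix.ofMatrix x : CStarMatrix ι ι A)) :=
    (CStarMatrix.ofMatrixL (A := A) (m := ι) (n := ι)).continuous
  obtain ⟨δ, hδ, h⟩ := Metric.continuous_iff.1 hcont W ε hε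
  choose n b hb hbW using fun i j => hdense (W i j) (δ / 2) (by linarith)
  set m := n₀ + ∑ i, ∑ j, n i j with hm
  have hle : ∀ i j, n i j ≤ m := by
    intro i j
    have h1 : n i j ≤ ∑ j, n i j := Finset.single_le_sum (f := fun j => n i j)
      (fun _ _ => Nat.zero_le _) (Finset.mem_univ j)
    have h2 : ∑ j, n i j ≤ ∑ i, ∑ j, n i j := Finset.single_le_sum (f := fun i => ∑ j, n i j)
      (fun _ _ => Nat.zero_le _) (Finset.mem_univ i)
    omega
  refine ⟨m, by omega, CStarMatrix.ofMatrix b, fun i j => hmono (hle i j) (hb i j), ?_⟩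
  have := h b (by
    refine (dist_pi_le_iff (by linarith)).2 (fun i => (dist_pi_le_iff (by linarith)).2 fun j => ?_)
      |>.trans_lt (half_lt_self hδ)
    rw [dist_eq_norm]
    exact (hbW i j).le)
  rwa [dist_eq_norm] at this

end Order

variable {B : ℕ → NonUnitalStarSubalgebra ℂ A}

/-- Every projection over `A` is equivalent to a projection over some `B n`. -/
theorem exists_equiv_matrix_mem
    (hclosed : ∀ n, IsClosed (B n : Set A)) (hmono : Monotone B)
    (hdense : ∀ a : A, ∀ ε > 0, ∃ n, ∃ b ∈ B n, ‖b - a‖ < ε)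
    {ι : Type*} [Fintype ι] {P : Matrix ι ι A}
    (hP : IsStarProjection P) : ∃ n, ∃ Q : Matrix ι ι A, (∀ i j, Q i j ∈ B n) ∧
      IsStarProjection Q ∧ ∃ v : Matrix ι ι A, vᴴ * v = P ∧ v * vᴴ = Q := by
  let _ := CStarAlgebra.spectralOrder A
  let _ := CStarAlgebra.spectralOrderedRing A
  have hP' : IsStarProjection (CStarMatrix.ofMatrix P) := ⟨hP.1, hP.2⟩
  obtain ⟨n, -, W, hW, hWP⟩ := exists_matrix_near hmono hdense (CStarMatrix.ofMatrix P)
    (ε := 1 / 20) (by norm_num) 0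
  obtain ⟨Q, hQ, hQp, v, h1, h2⟩ := exists_isStarProjection_mem _
    (isClosed_matrixSubalgebra (hclosed n)) hP' hW hWP
  exact ⟨n, Q, hQ, ⟨hQp.1, hQp.2⟩, v, h1, h2⟩

/-- Projections over `B n` that are equivalent over `A` are equivalent over some `B m`. -/
theorem exists_matrix_mem_of_equiv
    (hclosed : ∀ n, IsClosed (B n : Set A)) (hmono : Monotone B)
    (hdense : ∀ a : A, ∀ ε > 0, ∃ n, ∃ b ∈ B n, ‖b - a‖ < ε)
    {ι : Type*} [Fintype ι] {P Q v : Matrix ι ι A} {n : ℕ}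
    (hP : IsStarProjection P) (hQ : IsStarProjection Q) (hPn : ∀ i j, P i j ∈ B n)
    (hQn : ∀ i j, Q i j ∈ B n) (h1 : vᴴ * v = P) (h2 : v * vᴴ = Q) :
    ∃ m ≥ n, ∃ u : Matrix ι ι A, (∀ i j, u i j ∈ B m) ∧ uᴴ * u = P ∧ u * uᴴ = Q := by
  let _ := CStarAlgebra.spectralOrder A
  let _ := CStarAlgebra.spectralOrderedRing A
  have hP' : IsStarProjection (CStarMatrix.ofMatrix P) := ⟨hP.1, hP.2⟩
  have hQ' : IsStarProjection (CStarMatrix.ofMatrix Q) := ⟨hQ.1, hQ.2⟩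
  obtain ⟨m, hm, W, hW, hWv⟩ := exists_matrix_near hmono hdense (CStarMatrix.ofMatrix v)
    (ε := 1 / 4) (by norm_num) n
  obtain ⟨u, hu, h3, h4⟩ := exists_partialIsometry_mem (matrixSubalgebra ι (B m))
    (isClosed_matrixSubalgebra (hclosed m)) (fun i j => hmono hm (hPn i j))
    (fun i j => hmono hm (hQn i j)) hP' hQ' h1 h2 hW hWv
  exact ⟨m, hm, u, hu, h3, h4⟩

end MatrixApproximation

/-! ## Classes of projections with arbitrary index sets -/

section Classes

open scoped Matrix

variable {A : Type*} [NonUnitalRing A] [StarRing A]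

theorem isStarProjection_submatrix {ι κ : Type*} [Fintype ι] [Fintype κ] {P : Matrix ι ι A}
    (hP : IsStarProjection P) (e : κ ≃ ι) : IsStarProjection (P.submatrix e e) := by
  refine ⟨?_, ?_⟩
  · change _ * _ = _
    rw [Matrix.submatrix_mul_equiv, hP.isIdempotentElem.eq]
  · change Matrix.conjTranspose _ = _
    rw [Matrix.conjTranspose_submatrix]
    exact congrArg (fun M => M.submatrix e e) hP.isSelfAdjoint.star_eq

/-- The class of a projection in the matrices over `A` with an arbitrary finite index set. -/
def ProjClass.ofMatrix {ι : Type*} [Fintype ι] (P : Matrix ι ι A) (hP : IsStarProjection P) :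
    ProjClass A :=
  Quotient.mk (MatProj.setoid A) ⟨Fintype.card ι,
    P.submatrix (Fintype.equivFin ι).symm (Fintype.equivFin ι).symm,
    isStarProjection_submatrix hP _⟩

theorem ProjClass.ofMatrix_eq_iff {ι κ : Type*} [Fintype ι] [Fintype κ] {P : Matrix ι ι A}
    {Q : Matrix κ κ A} (hP : IsStarProjection P) (hQ : IsStarProjection Q) :
    ProjClass.ofMatrix P hP = ProjClass.ofMatrix Q hQ ↔
      ∃ v : Matrix κ ι A, vᴴ * v = P ∧ v * vᴴ = Q := by
  set e := Fintype.equivFin ι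
  set f := Fintype.equivFin κ
  refine ⟨fun h => ?_, fun ⟨v, h1, h2⟩ => Quotient.sound ?_⟩
  · obtain ⟨v, h1, h2⟩ := Quotient.exact h
    change vᴴ * v = P.submatrix e.symm e.symm at h1
    change v * vᴴ = Q.submatrix f.symm f.symm at h2
    refine ⟨v.submatrix f e, ?_, ?_⟩
    · rw [Matrix.conjTranspose_submatrix, Matrix.submatrix_mul_equiv, h1]
      ext i j; simp
    · rw [Matrix.conjTranspose_submatrix, Matrix.submatrix_mul_equiv, h2]
      ext i j; simp
  · refine ⟨v.submatrix f.symm e.symm, ?_, ?_⟩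
    · rw [Matrix.conjTranspose_submatrix, Matrix.submatrix_mul_equiv, h1]
    · rw [Matrix.conjTranspose_submatrix, Matrix.submatrix_mul_equiv, h2]

theorem ProjClass.ofMatrix_reindex {ι κ : Type*} [Fintype ι] [Fintype κ] {P : Matrix ι ι A}
    (hP : IsStarProjection P) (e : κ ≃ ι) :
    ProjClass.ofMatrix (P.submatrix e e) (isStarProjection_submatrix hP e) =
      ProjClass.ofMatrix P hP := by
  have h1 : Pᴴ = P := hP.isSelfAdjoint.star_eq
  rw [ProjClass.ofMatrix_eq_iff]
  refine ⟨P.submatrix id e, ?_, ?_⟩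
  · rw [Matrix.conjTranspose_submatrix, ← Matrix.submatrix_mul _ _ _ id _ Function.bijective_id,
      h1, hP.isIdempotentElem.eq]
  · rw [Matrix.conjTranspose_submatrix, Matrix.submatrix_mul_equiv, h1, hP.isIdempotentElem.eq,
      Matrix.submatrix_id_id]

theorem ProjClass.mk_eq_ofMatrix (p : MatProj A) :
    Quotient.mk (MatProj.setoid A) p = ProjClass.ofMatrix p.mat p.isProj :=
  Quotient.sound (MatProj.equiv_of_reindex _ _ p.mat (Equiv.refl _)
    (Fintype.equivFin (Fin p.size)).symm rfl rfl)

theorem isStarProjection_fromBlocks {ι κ : Type*} [Fintype ι] [Fintype κ] {P : Matrix ι ι A}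
    {Q : Matrix κ κ A} (hP : IsStarProjection P) (hQ : IsStarProjection Q) :
    IsStarProjection (Matrix.fromBlocks P 0 0 Q) := by
  refine ⟨?_, ?_⟩
  · change _ * _ = _
    rw [Matrix.fromBlocks_multiply]
    simp [hP.isIdempotentElem.eq, hQ.isIdempotentElem.eq]
  · change Matrix.conjTranspose _ = _
    rw [Matrix.fromBlocks_conjTranspose]
    have h1 : Pᴴ = P := hP.isSelfAdjoint.star_eq
    have h2 : Qᴴ = Q := hQ.isSelfAdjoint.star_eq
    simp [h1, h2]

theorem ProjClass.ofMatrix_fromBlocks {ι κ : Type} [Fintype ι] [Fintype κ] {P : Matrix ι ι A}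
    {Q : Matrix κ κ A} (hP : IsStarProjection P) (hQ : IsStarProjection Q) :
    ProjClass.ofMatrix (Matrix.fromBlocks P 0 0 Q) (isStarProjection_fromBlocks hP hQ) =
      ProjClass.ofMatrix P hP + ProjClass.ofMatrix Q hQ := by
  have key : ∀ x y, Matrix.fromBlocks (P.submatrix (Fintype.equivFin ι).symm
      (Fintype.equivFin ι).symm) 0 0 (Q.submatrix (Fintype.equivFin κ).symm
      (Fintype.equivFin κ).symm) x y = Matrix.fromBlocks P 0 0 Q
        (Sum.map (Fintype.equivFin ι).symm (Fintype.equivFin κ).symm x)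
        (Sum.map (Fintype.equivFin ι).symm (Fintype.equivFin κ).symm y) := by
    rintro (i | i) (j | j) <;> rfl
  refine Quotient.sound (MatProj.equiv_of_reindex _ _ (Matrix.fromBlocks P 0 0 Q)
    (Fintype.equivFin (ι ⊕ κ)).symm (finSumFinEquiv.symm.trans
      (Equiv.sumCongr (Fintype.equivFin ι).symm (Fintype.equivFin κ).symm)) rfl ?_)
  ext i j
  exact key _ _

theorem isStarProjection_of_const {ι : Type*} [Unique ι] {p : A} (hp : IsStarProjection p) :
    IsStarProjection (Matrix.of fun _ _ : ι => p) := by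
  refine ⟨?_, ?_⟩
  · change _ * _ = _
    ext i j
    simpa [Matrix.mul_apply] using hp.isIdempotentElem.eq
  · change Matrix.conjTranspose _ = _
    ext i j
    simpa [Matrix.conjTranspose_apply] using hp.isSelfAdjoint.star_eq

/-- The class of a projection in `A`. -/
def ProjClass.ofElem (p : A) (hp : IsStarProjection p) : ProjClass A :=
  ProjClass.ofMatrix (Matrix.of fun _ _ : Unit => p) (isStarProjection_of_const hp)

/-- The class in `K₀(A)` of a class of projections. -/
def K0.of : ProjClass A →+ K0 A := Algebra.GrothendieckAddGroup.of

theorem K0.ofProj_eq (p : A) (hp : IsStarProjection p) :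
    K0.ofProj p hp = K0.of (ProjClass.ofElem p hp) := by
  exact congrArg Algebra.GrothendieckAddGroup.of (Quotient.sound (MatProj.equiv_of_reindex _ _ (Matrix.of fun _ _ : Unit => p)
    (Equiv.ofUnique (Fin 1) Unit) (Fintype.equivFin Unit).symm rfl rfl))

theorem isStarProjection_diag {ι : Type*} [Fintype ι] {P : Matrix ι ι A}
    (hP : IsStarProjection P) (h : ∀ i j, i ≠ j → P i j = 0) (i : ι) :
    IsStarProjection (P i i) := by
  refine ⟨?_, ?_⟩
  · change _ * _ = _
    have h1 := congrFun (congrFun hP.isIdempotentElem.eq i) i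
    rw [Matrix.mul_apply, Finset.sum_eq_single i] at h1
    · exact h1
    · intro j _ hj
      rw [h i j hj.symm, zero_mul]
    · simp
  · exact congrFun (congrFun hP.isSelfAdjoint.star_eq i) i

/-- The class of a diagonal projection is the sum of the classes of its entries. -/
theorem ProjClass.ofMatrix_diagonal {ι : Type} [Fintype ι] {P : Matrix ι ι A}
    (hP : IsStarProjection P) (h : ∀ i j, i ≠ j → P i j = 0) :
    ProjClass.ofMatrix P hP = ∑ i, ProjClass.ofElem (P i i) (isStarProjection_diag hP h i) := by
  suffices H : ∀ (ι : Type) [Fintype ι], ∀ (P : Matrix ι ι A) (hP : IsStarProjection P)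
      (h : ∀ i j, i ≠ j → P i j = 0), ProjClass.ofMatrix P hP =
        ∑ i, ProjClass.ofElem (P i i) (isStarProjection_diag hP h i) from H ι P hP h
  intro ι _
  refine Fintype.induction_empty_option (P := fun ι _ => ∀ (P : Matrix ι ι A)
      (hP : IsStarProjection P) (h : ∀ i j, i ≠ j → P i j = 0), ProjClass.ofMatrix P hP =
        ∑ i, ProjClass.ofElem (P i i) (isStarProjection_diag hP h i)) ?_ ?_ ?_ ι
  · intro α β _ e ih P hP h
    let _ := Fintype.ofEquiv β e.symm
    rw [← ProjClass.ofMatrix_reindex hP e,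
      ih _ (isStarProjection_submatrix hP e) (fun i j hij => h _ _ (e.injective.ne hij))]
    exact Fintype.sum_equiv e _ _ fun _ => rfl
  · intro P hP h
    rw [Finset.univ_eq_empty, Finset.sum_empty]
    exact Quotient.sound (MatProj.equiv_of_reindex _ _ P (Fintype.equivFin PEmpty).symm
      (Equiv.equivOfIsEmpty (Fin 0) PEmpty) rfl (by ext i; exact i.elim0))
  · intro α _ ih P hP h
    have hQ : IsStarProjection (P.submatrix some some) := by
      refine ⟨?_, ?_⟩
      · change _ * _ = _
        ext i j
        have h1 := congrFun (congrFun hP.isIdempotentElem.eq (some i)) (some j)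
        rw [Matrix.mul_apply, Fintype.sum_option, h _ _ (by simp), zero_mul, zero_add] at h1
        exact h1
      · ext i j
        exact congrFun (congrFun hP.isSelfAdjoint.star_eq (some i)) (some j)
    have h0 := isStarProjection_of_const (ι := Unit) (isStarProjection_diag hP h none)
    let e : α ⊕ Unit ≃ Option α := (Equiv.optionEquivSumPUnit α).symm
    have he : P.submatrix e e =
        Matrix.fromBlocks (P.submatrix some some) 0 0 (Matrix.of fun _ _ : Unit => P none none) := by
      ext i j
      rcases i with i | i <;> rcases j with j | j
      · rfl
      · exact h _ _ (by simp)
      · exact h _ _ (by simp)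
      · rfl
    rw [← ProjClass.ofMatrix_reindex hP e, Fintype.sum_option, add_comm]
    have := ProjClass.ofMatrix_fromBlocks hQ h0
    simp only [he]
    rw [this, ih _ hQ fun i j hij => h _ _ (by simpa using hij)]
    rfl

theorem K0.of_eq_of_iff {x y : ProjClass A} : K0.of x = K0.of y ↔ ∃ c, c + x = c + y := by
  refine ((AddLocalization.addMonoidOf (⊤ : AddSubmonoid (ProjClass A))).eq_iff_exists).trans ?_
  exact ⟨fun ⟨c, hc⟩ => ⟨c, hc⟩, fun ⟨c, hc⟩ => ⟨⟨c, trivial⟩, hc⟩⟩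

theorem grothendieck_eq_top_of_forall_of_mem {M : Type*} [AddCommMonoid M]
    {H : AddSubgroup (Algebra.GrothendieckAddGroup M)}
    (h : ∀ x, Algebra.GrothendieckAddGroup.of x ∈ H) : H = ⊤ := by
  rw [eq_top_iff]
  rintro z -
  induction z using AddLocalization.ind with
  | _ y =>
    have h1 : AddLocalization.mk y.1 y.2 =
        Algebra.GrothendieckAddGroup.of y.1 - Algebra.GrothendieckAddGroup.of (y.2 : M) := by
      rw [eq_sub_iff_add_eq]
      change AddLocalization.mk y.1 y.2 + AddLocalization.mk (y.2 : M) 0 = AddLocalization.mk y.1 0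
      rw [AddLocalization.mk_add, AddLocalization.mk_eq_mk_iff, AddLocalization.r_iff_exists]
      exact ⟨0, by simp [_root_.add_comm]⟩
    rw [h1]
    exact sub_mem (h _) (h _)

theorem K0.eq_top_of_forall_of_mem {H : AddSubgroup (K0 A)} (h : ∀ x, K0.of x ∈ H) : H = ⊤ :=
  grothendieck_eq_top_of_forall_of_mem (M := ProjClass A) h

end Classes

/-! ## Systems of matrix units -/

section MatrixUnits

open scoped Matrix
open Classical

/-- A complex projection matrix is of the form `u uᴴ` with `uᴴ u = 1`. -/
theorem exists_isometry_of_isStarProjection {κ : Type*} [Fintype κ]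
    {ρ : Matrix κ κ ℂ} (hρ : IsStarProjection ρ) :
    ∃ (r : ℕ) (u : Matrix κ (Fin r) ℂ), uᴴ * u = 1 ∧ u * uᴴ = ρ := by
  have hH : ρ.IsHermitian := hρ.isSelfAdjoint.star_eq
  set U : Matrix κ κ ℂ := (hH.eigenvectorUnitary : Matrix κ κ ℂ) with hU
  have hUU : Uᴴ * U = 1 := Unitary.coe_star_mul_self hH.eigenvectorUnitary
  have hUU' : U * Uᴴ = 1 := Unitary.coe_mul_star_self hH.eigenvectorUnitary
  set D : κ → ℂ := fun k => (hH.eigenvalues k : ℂ) with hD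
  have hspec : ρ = U * Matrix.diagonal D * Uᴴ := by
    have := hH.spectral_theorem
    rw [Unitary.conjStarAlgAut_apply] at this
    exact this
  have hDD : ∀ k, D k * D k = D k := by
    have h1 : Matrix.diagonal D = Uᴴ * ρ * U := by
      rw [hspec]
      simp only [Matrix.mul_assoc, hUU, Matrix.mul_one]
      rw [← Matrix.mul_assoc, hUU, Matrix.one_mul]
    have h2 : Matrix.diagonal D * Matrix.diagonal D = Matrix.diagonal D := by
      rw [h1]
      calc Uᴴ * ρ * U * (Uᴴ * ρ * U) = Uᴴ * ρ * (U * Uᴴ) * ρ * U := by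
            simp only [Matrix.mul_assoc]
        _ = Uᴴ * (ρ * ρ) * U := by rw [hUU', Matrix.mul_one]; simp only [Matrix.mul_assoc]
        _ = Uᴴ * ρ * U := by rw [hρ.isIdempotentElem.eq]
    rw [Matrix.diagonal_mul_diagonal] at h2
    exact fun k => congrFun (Matrix.diagonal_injective h2) k
  have hD01 : ∀ k, D k = 0 ∨ D k = 1 := by
    intro k
    have : D k * (D k - 1) = 0 := by rw [mul_sub, hDD, mul_one, sub_self]
    rcases mul_eq_zero.1 this with h | h
    · exact Or.inl h
    · exact Or.inr (sub_eq_zero.1 h)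
  -- All eigenvalues are `0` or `1`; the eigenvectors of eigenvalue `1` are the columns of the
  -- isometry.
  let e := Fintype.equivFin {k // D k ≠ 0}
  refine ⟨Fintype.card {k // D k ≠ 0}, U.submatrix id fun x => (e.symm x).1, ?_, ?_⟩
  · rw [Matrix.conjTranspose_submatrix, ← Matrix.submatrix_mul _ _ _ id _ Function.bijective_id, hUU]
    ext i j
    rw [Matrix.submatrix_apply, Matrix.one_apply, Matrix.one_apply]
    have : (e.symm i).1 = (e.symm j).1 ↔ i = j := by rw [Subtype.coe_inj, e.symm.apply_eq_iff_eq]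
    simp only [this]
  · ext i j
    rw [hspec, Matrix.mul_apply, Matrix.mul_apply]
    simp only [Matrix.submatrix_apply, id, Matrix.conjTranspose_apply, Matrix.mul_diagonal]
    rw [Equiv.sum_comp e.symm (fun k : {k // D k ≠ 0} => U i k.1 * star (U j k.1))]
    rw [← Finset.sum_subtype (s := Finset.univ.filter fun k => D k ≠ 0) (p := fun k => D k ≠ 0)
      (by simp) (fun k => U i k * star (U j k)), Finset.sum_filter]
    refine Finset.sum_congr rfl fun k _ => ?_
    rcases hD01 k with h | h <;> simp [h]

variable {A : Type*} [NonUnitalCStarAlgebra A]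

variable (A) in
/-- An increasing sequence of systems of matrix units `E n s t` (for `s`, `t` in a finite set `P n`
that is partitioned into cells), together with the maps `β` that describe the
embeddings of the cells of consecutive levels. -/
structure UnitSystem where
  V : ℕ → Type
  P : ℕ → Type
  fintypeV : ∀ n, Fintype (V n)
  fintypeP : ∀ n, Fintype (P n)
  cell : ∀ n, P n → V n
  cell_surjective : ∀ n, Function.Surjective (cell n)
  σ : ∀ n, P (n + 1) → P n
  E : ∀ n, P n → P n → A
  E_eq_zero : ∀ n s t, cell n s ≠ cell n t → E n s t = 0
  mul_same : ∀ n r s t, cell n r = cell n s → E n r s * E n s t = E n r t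
  mul_ne : ∀ n r s t u, s ≠ t → E n r s * E n t u = 0
  star_E : ∀ n s t, star (E n s t) = E n t s
  E_mem : ∀ n s t, E n s t ∈
    Submodule.span ℂ (range fun x : P (n + 1) × P (n + 1) => E (n + 1) x.1 x.2)
  E_diag : ∀ n t, E n t t = ∑ s, if σ n s = t then E (n + 1) s s else 0
  β : ∀ n, (V n → ℤ) →+ (V (n + 1) → ℤ)
  β_single : ∀ n t, β n (Pi.single (cell n t) 1) =
    ∑ s, if σ n s = t then Pi.single (cell (n + 1) s) 1 else 0
  -- A matrix unit may vanish in `A`. Its class in `K₀` is then `0`, so the generator of its cell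
  -- has to die in the limit of the maps `β`.
  dead : ∀ n t, E n t t = 0 → ∃ (m : ℕ) (h : n ≤ m), seqMap β n m h (Pi.single (cell n t) 1) = 0

namespace UnitSystem

variable (𝒰 : UnitSystem A)

instance (n : ℕ) : Fintype (𝒰.V n) := 𝒰.fintypeV n
instance (n : ℕ) : Fintype (𝒰.P n) := 𝒰.fintypeP n

theorem mul_E (n : ℕ) (r s t u : 𝒰.P n) : 𝒰.E n r s * 𝒰.E n t u =
    if s = t ∧ 𝒰.cell n r = 𝒰.cell n s then 𝒰.E n r u else 0 := by
  split_ifs with h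
  · obtain ⟨rfl, h⟩ := h
    exact 𝒰.mul_same n r s u h
  · by_cases hst : s = t
    · rw [𝒰.E_eq_zero n r s fun h' => h ⟨hst, h'⟩, zero_mul]
    · exact 𝒰.mul_ne n r s t u hst

theorem isStarProjection_E (n : ℕ) (t : 𝒰.P n) : IsStarProjection (𝒰.E n t t) :=
  ⟨𝒰.mul_same n t t t rfl, 𝒰.star_E n t t⟩

/-- The span of the matrix units of level `n`. -/
def span (n : ℕ) : Submodule ℂ A :=
  Submodule.span ℂ (range fun x : 𝒰.P n × 𝒰.P n => 𝒰.E n x.1 x.2)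

theorem E_mem_span (n : ℕ) (s t : 𝒰.P n) : 𝒰.E n s t ∈ 𝒰.span n :=
  Submodule.subset_span ⟨(s, t), rfl⟩

theorem mem_span_iff (n : ℕ) (x : A) : x ∈ 𝒰.span n ↔
    ∃ c : 𝒰.P n → 𝒰.P n → ℂ, x = ∑ s, ∑ t, c s t • 𝒰.E n s t := by
  rw [span, Submodule.mem_span_range_iff_exists_fun]
  constructor
  · rintro ⟨c, hc⟩
    exact ⟨fun s t => c (s, t), by rw [← hc, Fintype.sum_prod_type]⟩
  · rintro ⟨c, hc⟩
    exact ⟨fun x => c x.1 x.2, by rw [hc, Fintype.sum_prod_type]⟩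

/-- The algebra of level `n`. -/
def level (n : ℕ) : NonUnitalStarSubalgebra ℂ A where
  toSubmodule := 𝒰.span n
  mul_mem' {a b} ha hb := by
    refine Submodule.span_induction₂ (p := fun a b _ _ => a * b ∈ 𝒰.span n) ?_ ?_ ?_ ?_ ?_ ?_ ?_
      ha hb
    · rintro _ _ ⟨x, rfl⟩ ⟨y, rfl⟩
      simp only [mul_E]
      split_ifs
      · exact 𝒰.E_mem_span n _ _
      · exact zero_mem _
    · intro y _; rw [zero_mul]; exact zero_mem _
    · intro y _; rw [mul_zero]; exact zero_mem _
    · intro x y z _ _ _ h h'; rw [add_mul]; exact add_mem h h'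
    · intro x y z _ _ _ h h'; rw [mul_add]; exact add_mem h h'
    · intro c x y _ _ h; rw [smul_mul_assoc]; exact Submodule.smul_mem _ _ h
    · intro c x y _ _ h; rw [mul_smul_comm]; exact Submodule.smul_mem _ _ h
  star_mem' {a} ha := by
    obtain ⟨c, rfl⟩ := (𝒰.mem_span_iff n a).1 ha
    refine (𝒰.mem_span_iff n _).2 ⟨fun s t => star (c t s), ?_⟩
    simp only [star_sum, star_smul, star_E]
    exact Finset.sum_comm

theorem mem_level {n : ℕ} {x : A} : x ∈ 𝒰.level n ↔ x ∈ 𝒰.span n := Iff.rfl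

theorem level_mono : Monotone 𝒰.level := by
  refine monotone_nat_of_le_succ fun n => ?_
  intro x hx
  exact Submodule.span_le.2 (by rintro _ ⟨y, rfl⟩; exact 𝒰.E_mem n y.1 y.2) hx

theorem isClosed_level (n : ℕ) : IsClosed (𝒰.level n : Set A) := by
  have : FiniteDimensional ℂ (𝒰.span n) :=
    FiniteDimensional.span_of_finite ℂ (finite_range _)
  exact Submodule.closed_of_finiteDimensional (𝒰.span n)

/-- The algebras of all levels have dense union. -/
def IsDense : Prop := ∀ a : A, ∀ ε > 0, ∃ n, ∃ b ∈ 𝒰.level n, ‖b - a‖ < ε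

/-! ### Traces -/

/-- The trace on the cell of `t`, multiplied with the projection `E t t`. -/
def trace (n : ℕ) (t : 𝒰.P n) : A →ₗ[ℂ] A where
  toFun x := ∑ s, 𝒰.E n t s * x * 𝒰.E n s t
  map_add' x y := by simp only [mul_add, add_mul, Finset.sum_add_distrib]
  map_smul' c x := by
    simp only [mul_smul_comm, smul_mul_assoc, RingHom.id_apply, Finset.smul_sum]

theorem trace_E (n : ℕ) (t r u : 𝒰.P n) : 𝒰.trace n t (𝒰.E n r u) =
    if r = u ∧ 𝒰.cell n t = 𝒰.cell n r then 𝒰.E n t t else 0 := by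
  change ∑ s, 𝒰.E n t s * 𝒰.E n r u * 𝒰.E n s t = _
  rw [Finset.sum_eq_single r]
  · rw [mul_E]
    split_ifs with h1 h2 h2
    · rw [← h2.1]; exact 𝒰.mul_same n t r t h2.2
    · rw [mul_E, if_neg]
      rintro ⟨h3, -⟩
      exact h2 ⟨h3.symm, h1.2⟩
    · exact absurd ⟨rfl, h2.2⟩ h1
    · rw [zero_mul]
  · intro s _ hs
    rw [𝒰.mul_ne n t s r u hs, zero_mul]
  · simp

theorem trace_mul_comm (n : ℕ) (t : 𝒰.P n) {x y : A} (hx : x ∈ 𝒰.level n) (hy : y ∈ 𝒰.level n) :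
    𝒰.trace n t (x * y) = 𝒰.trace n t (y * x) := by
  refine Submodule.span_induction₂ (p := fun x y _ _ => 𝒰.trace n t (x * y) = 𝒰.trace n t (y * x))
    ?_ ?_ ?_ ?_ ?_ ?_ ?_ hx hy
  · rintro _ _ ⟨⟨r, s⟩, rfl⟩ ⟨⟨r', s'⟩, rfl⟩
    simp only [mul_E]
    by_cases h : s = r' ∧ s' = r
    · obtain ⟨rfl, rfl⟩ := h
      by_cases h' : 𝒰.cell n s = 𝒰.cell n s'
      · simp [h', trace_E]
      · simp [h', Ne.symm h']
    · have h1 : 𝒰.trace n t (if s = r' ∧ 𝒰.cell n r = 𝒰.cell n s then 𝒰.E n r s' else 0) = 0 := by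
        split_ifs with h2
        · rw [trace_E, if_neg]
          rintro ⟨h3, -⟩
          exact h ⟨h2.1, h3.symm⟩
        · exact map_zero _
      have h1' : 𝒰.trace n t (if s' = r ∧ 𝒰.cell n r' = 𝒰.cell n s' then 𝒰.E n r' s else 0) = 0 := by
        split_ifs with h2
        · rw [trace_E, if_neg]
          rintro ⟨h3, -⟩
          exact h ⟨h3.symm, h2.1⟩
        · exact map_zero _
      rw [h1, h1']
  · intro y _; simp
  · intro y _; simp
  · intro x y z _ _ _ h h'; rw [add_mul, mul_add, map_add, map_add, h, h']
  · intro x y z _ _ _ h h'; rw [add_mul, mul_add, map_add, map_add, h, h']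
  · intro c x y _ _ h; rw [smul_mul_assoc, mul_smul_comm, map_smul, map_smul, h]
  · intro c x y _ _ h; rw [smul_mul_assoc, mul_smul_comm, map_smul, map_smul, h]

theorem trace_eq_of_equiv {ι : Type*} [Fintype ι] (n : ℕ) (t : 𝒰.P n) {u : Matrix ι ι A}
    (hu : ∀ i j, u i j ∈ 𝒰.level n) :
    ∑ i, 𝒰.trace n t ((uᴴ * u) i i) = ∑ i, 𝒰.trace n t ((u * uᴴ) i i) := by
  simp only [Matrix.mul_apply, Matrix.conjTranspose_apply, map_sum]
  rw [Finset.sum_comm]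
  exact Finset.sum_congr rfl fun i _ => Finset.sum_congr rfl fun j _ =>
    𝒰.trace_mul_comm n t (star_mem (hu i j)) (hu i j)

end UnitSystem

end MatrixUnits

/-! ## Sequences of abelian groups -/

section Sequences

universe u
variable {A : ℕ → Type u} [∀ n, AddCommGroup (A n)] (f : ∀ n, A n →+ A (n + 1))

theorem seqMap_self (n : ℕ) (h : n ≤ n) (x : A n) : seqMap f n n h x = x := by
  rw [seqMap, Nat.leRecOn_self]
  rfl

theorem seqMap_succ {n m : ℕ} (h : n ≤ m) (h' : n ≤ m + 1) (x : A n) :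
    seqMap f n (m + 1) h' x = f m (seqMap f n m h x) := by
  rw [seqMap, Nat.leRecOn_succ h]
  rfl

theorem seqMap_seqMap {n m l : ℕ} (h : n ≤ m) (h' : m ≤ l) (x : A n) :
    seqMap f m l h' (seqMap f n m h x) = seqMap f n l (h.trans h') x := by
  induction l, h' using Nat.le_induction with
  | base => rw [seqMap_self]
  | succ l hl ih => rw [seqMap_succ f hl, ih, seqMap_succ f (h.trans hl)]

/-- Compatible homomorphisms from the groups of a sequence that are jointly surjective, and whose
kernels consist of elements that vanish in the limit, give an isomorphism. -/
theorem nonempty_seqLim_equiv {G : Type*} [AddCommGroup G] (Φ : ∀ n, A n →+ G)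
    (hf : ∀ n x, Φ (n + 1) (f n x) = Φ n x)
    (hker : ∀ n x, Φ n x = 0 → ∃ (m : ℕ) (h : n ≤ m), seqMap f n m h x = 0)
    (hgen : ∀ H : AddSubgroup G, (∀ n x, Φ n x ∈ H) → H = ⊤) :
    Nonempty (G ≃+ SeqLim f) := by
  have hcomp : ∀ n m (h : n ≤ m) x, Φ m (seqMap f n m h x) = Φ n x := by
    intro n m h x
    induction m, h using Nat.le_induction with
    | base => rw [seqMap_self]
    | succ m hm ih => rw [seqMap_succ f hm, hf, ih]
  let F : SeqLim f →+ G := AddCommGroup.DirectLimit.lift A (seqMap f) G Φ hcomp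
  have hF : ∀ n x, F (AddCommGroup.DirectLimit.of A (seqMap f) n x) = Φ n x := fun n x =>
    AddCommGroup.DirectLimit.lift_of G Φ hcomp n x
  have hinj : Function.Injective F := by
    rw [injective_iff_map_eq_zero]
    intro z
    refine AddCommGroup.DirectLimit.induction_on z fun n x hx => ?_
    rw [hF] at hx
    obtain ⟨m, h, hm⟩ := hker n x hx
    rw [← AddCommGroup.DirectLimit.of_f h x, hm, map_zero]
  have hsurj : Function.Surjective F := by
    rw [← AddMonoidHom.range_eq_top]
    exact hgen _ fun n x => ⟨_, hF n x⟩
  exact ⟨(AddEquiv.ofBijective F ⟨hinj, hsurj⟩).symm⟩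

end Sequences

section Functions

theorem eq_sum_zsmul_single {V : Type*} [Fintype V] [DecidableEq V] (x : V → ℤ) :
    x = ∑ v, x v • Pi.single v (1 : ℤ) := by
  ext w
  simp [Finset.sum_apply, Pi.single_apply]

theorem addHom_ext_single {V G : Type*} [Fintype V] [DecidableEq V] [AddCommGroup G]
    {f g : (V → ℤ) →+ G} (h : ∀ v, f (Pi.single v 1) = g (Pi.single v 1)) : f = g := by
  refine DFunLike.ext _ _ fun x => ?_
  have hx := eq_sum_zsmul_single x
  rw [hx, map_sum, map_sum]
  exact Finset.sum_congr rfl fun v _ => by rw [map_zsmul, map_zsmul, h]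

end Functions

/-! ## The group `K₀` of the limit of a sequence of finite-dimensional algebras -/

namespace UnitSystem

open scoped Matrix
open Classical

variable {A : Type*} [NonUnitalCStarAlgebra A] (𝒰 : UnitSystem A)

/-- The class of the projection `E t t`. -/
def cls (n : ℕ) (t : 𝒰.P n) : ProjClass A := ProjClass.ofElem _ (𝒰.isStarProjection_E n t)

theorem cls_eq {n : ℕ} {s t : 𝒰.P n} (h : 𝒰.cell n s = 𝒰.cell n t) : 𝒰.cls n s = 𝒰.cls n t := by
  refine (ProjClass.ofMatrix_eq_iff (isStarProjection_of_const (𝒰.isStarProjection_E n s))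
    (isStarProjection_of_const (𝒰.isStarProjection_E n t))).2 ⟨Matrix.of fun _ _ => 𝒰.E n t s, ?_, ?_⟩
  · ext
    simpa [Matrix.mul_apply, star_E] using 𝒰.mul_same n s t s h
  · ext
    simpa [Matrix.mul_apply, star_E] using 𝒰.mul_same n t s t h.symm

/-- `E t t` is the sum of the mutually orthogonal projections `E s s` for `s` over `t`. The column
of these projections is a partial isometry from `E t t` to the diagonal matrix with these entries.
-/
theorem cls_split (n : ℕ) (t : 𝒰.P n) :
    𝒰.cls n t = ∑ s, if 𝒰.σ n s = t then 𝒰.cls (n + 1) s else 0 := by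
  let I := {s : 𝒰.P (n + 1) // 𝒰.σ n s = t}
  let D : Matrix I I A := Matrix.of fun i j => if i = j then 𝒰.E (n + 1) i.1 i.1 else 0
  have hDij : ∀ i j, i ≠ j → D i j = 0 := fun i j h => if_neg h
  have hDii : ∀ i, D i i = 𝒰.E (n + 1) i.1 i.1 := fun i => if_pos rfl
  let v : Matrix I Unit A := Matrix.of fun i _ => 𝒰.E (n + 1) i.1 i.1
  have h1 : vᴴ * v = Matrix.of fun _ _ : Unit => 𝒰.E n t t := by
    ext
    simp only [Matrix.mul_apply, Matrix.conjTranspose_apply, v, Matrix.of_apply, star_E,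
      𝒰.mul_same _ _ _ _ rfl]
    rw [𝒰.E_diag n t, ← Finset.sum_filter,
      Finset.sum_subtype (p := fun s => 𝒰.σ n s = t) _ (by simp)]
  have h2 : v * vᴴ = D := by
    ext i j
    simp only [Matrix.mul_apply, Matrix.conjTranspose_apply, v, Matrix.of_apply, star_E, D,
      Finset.univ_unique, Finset.sum_singleton]
    split_ifs with h
    · rw [h, 𝒰.mul_same _ _ _ _ rfl]
    · exact 𝒰.mul_ne _ _ _ _ _ fun h' => h (Subtype.ext h')
  have hD : IsStarProjection D := by
    have h3 : Dᴴ = D := by rw [← h2, Matrix.conjTranspose_mul, Matrix.conjTranspose_conjTranspose]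
    have h4 : (Matrix.of fun _ _ : Unit => 𝒰.E n t t) * vᴴ = vᴴ := by
      ext i j
      simp only [Matrix.mul_apply, Matrix.conjTranspose_apply, v, Matrix.of_apply, star_E,
        Finset.univ_unique, Finset.sum_singleton]
      rw [𝒰.E_diag n t, Finset.sum_mul, Finset.sum_eq_single j.1]
      · rw [if_pos j.2, 𝒰.mul_same _ _ _ _ rfl]
      · intro s _ hs
        split_ifs
        · exact 𝒰.mul_ne _ _ _ _ _ hs
        · exact zero_mul _
      · simp
    refine ⟨?_, h3⟩
    change D * D = D
    conv_lhs => rw [← h2]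
    rw [Matrix.mul_assoc, ← Matrix.mul_assoc vᴴ, h1, h4, h2]
  have h5 : 𝒰.cls n t = ProjClass.ofMatrix D hD :=
    (ProjClass.ofMatrix_eq_iff (isStarProjection_of_const (𝒰.isStarProjection_E n t)) hD).2
      ⟨v, h1, h2⟩
  rw [h5, ProjClass.ofMatrix_diagonal hD hDij, ← Finset.sum_filter,
    Finset.sum_subtype (p := fun s => 𝒰.σ n s = t) _ (by simp)]
  refine Finset.sum_congr rfl fun i _ => ?_
  simp only [hDii]
  rfl

/-- A point of the cell `v`. -/
def base (n : ℕ) (v : 𝒰.V n) : 𝒰.P n := Function.surjInv (𝒰.cell_surjective n) v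

theorem cell_base (n : ℕ) (v : 𝒰.V n) : 𝒰.cell n (𝒰.base n v) = v := Function.surjInv_eq _ v

/-- The homomorphism that sends the generator of the cell `v` to the class of the projections
`E t t`, with `t` in `v`. -/
def toK0 (n : ℕ) : (𝒰.V n → ℤ) →+ K0 A where
  toFun x := ∑ v, x v • K0.of (𝒰.cls n (𝒰.base n v))
  map_zero' := by simp
  map_add' x y := by simp only [Pi.add_apply, add_smul, Finset.sum_add_distrib]

theorem toK0_single (n : ℕ) (t : 𝒰.P n) :
    𝒰.toK0 n (Pi.single (𝒰.cell n t) 1) = K0.of (𝒰.cls n t) := by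
  change ∑ v, _ = _
  rw [Finset.sum_eq_single (𝒰.cell n t)]
  · rw [Pi.single_eq_same, one_smul, 𝒰.cls_eq (𝒰.cell_base n _)]
  · intro v _ hv
    rw [Pi.single_eq_of_ne hv, zero_smul]
  · simp

theorem toK0_β (n : ℕ) (x : 𝒰.V n → ℤ) : 𝒰.toK0 (n + 1) (𝒰.β n x) = 𝒰.toK0 n x := by
  suffices h : (𝒰.toK0 (n + 1)).comp (𝒰.β n) = 𝒰.toK0 n from DFunLike.congr_fun h x
  refine addHom_ext_single fun v => ?_
  rw [← 𝒰.cell_base n v, AddMonoidHom.comp_apply, 𝒰.β_single, toK0_single, cls_split, map_sum,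
    map_sum]
  refine Finset.sum_congr rfl fun s _ => ?_
  split_ifs
  · exact 𝒰.toK0_single _ _
  · simp

/-- Passing to the next level splits a diagonal unit and the generator of its cell by the same rule,
so the same coefficients occur in both expansions. -/
theorem exists_count (n m : ℕ) (h : n ≤ m) (t : 𝒰.P n) : ∃ F : 𝒰.P m → ℤ,
    𝒰.E n t t = ∑ s, F s • 𝒰.E m s s ∧
    seqMap 𝒰.β n m h (Pi.single (𝒰.cell n t) 1) = ∑ s, F s • Pi.single (𝒰.cell m s) 1 := by
  induction m, h using Nat.le_induction with
  | base =>
    refine ⟨fun s => if s = t then 1 else 0, by simp, ?_⟩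
    rw [seqMap_self]
    simp
  | succ m hm ih =>
    obtain ⟨F, h1, h2⟩ := ih
    refine ⟨fun s => F (𝒰.σ m s), ?_, ?_⟩
    · rw [h1]
      simp only [𝒰.E_diag m, Finset.smul_sum, smul_ite, smul_zero]
      rw [Finset.sum_comm]
      simp
    · rw [seqMap_succ _ hm, h2, map_sum]
      simp only [map_zsmul, 𝒰.β_single, Finset.smul_sum, smul_ite, smul_zero]
      rw [Finset.sum_comm]
      simp

/-- This is how traces detect the maps `β`: the trace at `t` counts the diagonal units in the cell
of `t` into which `E n s s` splits. -/
theorem trace_E_of_le {n m : ℕ} (h : n ≤ m) (s : 𝒰.P n) (t : 𝒰.P m) :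
    𝒰.trace m t (𝒰.E n s s) =
      seqMap 𝒰.β n m h (Pi.single (𝒰.cell n s) 1) (𝒰.cell m t) • 𝒰.E m t t := by
  obtain ⟨F, h1, h2⟩ := 𝒰.exists_count n m h s
  rw [h1, h2, map_sum, Finset.sum_apply, Finset.sum_smul]
  refine Finset.sum_congr rfl fun r _ => ?_
  rw [map_zsmul, trace_E, Pi.smul_apply, Pi.single_apply]
  by_cases hr : 𝒰.cell m t = 𝒰.cell m r <;> simp [hr]

theorem isStarProjection_diagonal {ι : Type*} [Fintype ι] [DecidableEq ι] (n : ℕ) (g : ι → 𝒰.P n) :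
    IsStarProjection (Matrix.diagonal fun i => 𝒰.E n (g i) (g i)) := by
  refine ⟨?_, ?_⟩
  · change _ * _ = _
    rw [Matrix.diagonal_mul_diagonal]
    simp only [𝒰.mul_same _ _ _ _ rfl]
  · change Matrix.conjTranspose _ = _
    rw [Matrix.diagonal_conjTranspose]
    congr 1
    ext i
    exact 𝒰.star_E _ _ _

theorem sum_cls (n : ℕ) (a : 𝒰.V n → ℕ) : ∑ v, a v • 𝒰.cls n (𝒰.base n v) =
    ProjClass.ofMatrix _ (𝒰.isStarProjection_diagonal n
      fun i : Σ v, Fin (a v) => 𝒰.base n i.1) := by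
  rw [ProjClass.ofMatrix_diagonal (𝒰.isStarProjection_diagonal n
    fun i : Σ v, Fin (a v) => 𝒰.base n i.1) fun i j h => Matrix.diagonal_apply_ne _ h,
    Fintype.sum_sigma]
  refine Finset.sum_congr rfl fun v _ => ?_
  have h : ∀ (x : A) (hx : IsStarProjection x), x = 𝒰.E n (𝒰.base n v) (𝒰.base n v) →
      ProjClass.ofElem x hx = 𝒰.cls n (𝒰.base n v) := by
    rintro x hx rfl
    rfl
  refine Eq.trans ?_ (Finset.sum_congr rfl fun x _ => h _ _ (Matrix.diagonal_apply_eq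
    (fun i : Σ v, Fin (a v) => 𝒰.E n (𝒰.base n i.1) (𝒰.base n i.1)) ⟨v, x⟩)).symm
  rw [Finset.sum_const, Finset.card_univ, Fintype.card_fin]

/-- Every projection over the algebra of level `n` is equivalent to a sum of projections
`E t t`. -/
theorem exists_eq_sum_cls {ι : Type} [Fintype ι] {n : ℕ} {p : Matrix ι ι A}
    (hp : IsStarProjection p) (hpn : ∀ i j, p i j ∈ 𝒰.level n) :
    ∃ a : 𝒰.V n → ℕ, ProjClass.ofMatrix p hp = ∑ v, a v • 𝒰.cls n (𝒰.base n v) := by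
  -- The coefficients of vanishing units are set to `0`, so that the others can be recovered by
  -- compression (`hext`) and all are determined by `p`.
  have hcoef : ∀ i j, ∃ c : 𝒰.P n → 𝒰.P n → ℂ, p i j = ∑ s, ∑ t, c s t • 𝒰.E n s t ∧
      ∀ s t, 𝒰.E n s t = 0 → c s t = 0 := by
    intro i j
    obtain ⟨c, hc⟩ := (𝒰.mem_span_iff n _).1 (hpn i j)
    refine ⟨fun s t => if 𝒰.E n s t = 0 then 0 else c s t, ?_, fun s t h => if_pos h⟩
    rw [hc]
    refine Finset.sum_congr rfl fun s _ => Finset.sum_congr rfl fun t _ => ?_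
    by_cases h : 𝒰.E n s t = 0
    · rw [h, smul_zero, smul_zero]
    · simp only [if_neg h]
  choose c hc hc0 using hcoef
  have hext : ∀ (c : 𝒰.P n → 𝒰.P n → ℂ) (r u : 𝒰.P n),
      𝒰.E n r r * (∑ s, ∑ t, c s t • 𝒰.E n s t) * 𝒰.E n u u = c r u • 𝒰.E n r u := by
    intro c r u
    have h1 : 𝒰.E n r r * (∑ s, ∑ t, c s t • 𝒰.E n s t) = ∑ t, c r t • 𝒰.E n r t := by
      rw [Finset.mul_sum, Finset.sum_eq_single r]
      · rw [Finset.mul_sum]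
        refine Finset.sum_congr rfl fun t _ => ?_
        rw [mul_smul_comm, 𝒰.mul_same n r r t rfl]
      · intro s _ hs
        rw [Finset.mul_sum]
        refine Finset.sum_eq_zero fun t _ => ?_
        rw [mul_smul_comm, 𝒰.mul_ne n r r s t hs.symm, smul_zero]
      · simp
    rw [h1, Finset.sum_mul, Finset.sum_eq_single u]
    · rw [smul_mul_assoc]
      by_cases h : 𝒰.cell n r = 𝒰.cell n u
      · rw [𝒰.mul_same n r u u h]
      · rw [𝒰.E_eq_zero n r u h, zero_mul]
    · intro t _ ht
      rw [smul_mul_assoc, 𝒰.mul_ne n r t u u ht, smul_zero]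
    · simp
  have hne : ∀ i j s t, c i j s t ≠ 0 → 𝒰.E n s t ≠ 0 := fun i j s t h h' => h (hc0 i j s t h')
  have hcell : ∀ i j s t, c i j s t ≠ 0 → 𝒰.cell n s = 𝒰.cell n t := fun i j s t h =>
    by_contra fun h' => hne i j s t h (𝒰.E_eq_zero n s t h')
  have hpos : ∀ s t, 𝒰.E n s t = 0 → 𝒰.E n t s = 0 := fun s t h => by
    rw [← 𝒰.star_E n s t, h, star_zero]
  -- The coefficients form a complex matrix, which is a projection because they are unique. It is
  -- block diagonal with respect to the cells.
  let ρ : Matrix (ι × 𝒰.P n) (ι × 𝒰.P n) ℂ := Matrix.of fun x y => c x.1 y.1 x.2 y.2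
  have hρstar : ρᴴ = ρ := by
    ext ⟨i, s⟩ ⟨j, t⟩
    change star (c j i t s) = c i j s t
    have h1 : star (p j i) = p i j := congrFun (congrFun hp.isSelfAdjoint.star_eq i) j
    have h2 : star (p j i) = ∑ s, ∑ t, star (c j i t s) • 𝒰.E n s t := by
      rw [hc j i]
      simp only [star_sum, star_smul, star_E]
      exact Finset.sum_comm
    have h3 := hext (fun s t => star (c j i t s)) s t
    rw [← h2, h1, hc i j, hext] at h3
    by_cases h4 : 𝒰.E n s t = 0
    · rw [hc0 i j s t h4, hc0 j i t s (hpos s t h4), star_zero]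
    · exact (smul_left_injective ℂ h4 h3).symm
  have hρmul : ρ * ρ = ρ := by
    ext ⟨i, s⟩ ⟨j, t⟩
    rw [Matrix.mul_apply, Fintype.sum_prod_type]
    change ∑ k, ∑ r, c i k s r * c k j r t = c i j s t
    have h1 : ∑ k, p i k * p k j = p i j := congrFun (congrFun hp.isIdempotentElem.eq i) j
    have h2 : ∀ k, p i k * p k j = ∑ s, ∑ t, (∑ r, c i k s r * c k j r t) • 𝒰.E n s t := by
      intro k
      rw [hc i k, hc k j, Finset.sum_mul]
      refine Finset.sum_congr rfl fun s _ => ?_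
      rw [Finset.sum_mul]
      simp only [Finset.mul_sum, Finset.sum_smul]
      rw [Finset.sum_comm, Finset.sum_comm (s := Finset.univ) (t := Finset.univ)
        (f := fun t r => (c i k s r * c k j r t) • 𝒰.E n s t), Finset.sum_comm]
      refine Finset.sum_congr rfl fun r _ => ?_
      rw [Finset.sum_eq_single r]
      · refine Finset.sum_congr rfl fun t _ => ?_
        rw [smul_mul_smul_comm]
        by_cases h : c i k s r = 0
        · rw [h, zero_mul, zero_smul, zero_smul]
        · rw [𝒰.mul_same n s r t (hcell _ _ _ _ h)]
      · intro r' _ hr'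
        refine Finset.sum_eq_zero fun t _ => ?_
        rw [smul_mul_smul_comm, 𝒰.mul_ne n s r r' t hr'.symm, smul_zero]
      · simp
    have h3 : p i j = ∑ s, ∑ t, (∑ k, ∑ r, c i k s r * c k j r t) • 𝒰.E n s t := by
      rw [← h1]
      simp only [h2]
      rw [Finset.sum_comm]
      refine Finset.sum_congr rfl fun s _ => ?_
      rw [Finset.sum_comm]
      exact Finset.sum_congr rfl fun t _ => by rw [← Finset.sum_smul]
    have h4 := hext (fun s t => ∑ k, ∑ r, c i k s r * c k j r t) s t
    rw [← h3, hc i j, hext] at h4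
    by_cases h5 : 𝒰.E n s t = 0
    · rw [hc0 i j s t h5]
      refine Finset.sum_eq_zero fun k _ => Finset.sum_eq_zero fun r _ => ?_
      by_contra h6
      obtain ⟨h7, h8⟩ := mul_ne_zero_iff.1 h6
      refine hne _ _ _ _ h7 ?_
      have h9 := 𝒰.mul_same n s t r ((hcell _ _ _ _ h7).trans (hcell _ _ _ _ h8))
      rw [← h9, h5, zero_mul]
    · exact (smul_left_injective ℂ h5 h4).symm
  let ρv : 𝒰.V n → Matrix (ι × 𝒰.P n) (ι × 𝒰.P n) ℂ := fun v =>
    Matrix.of fun x y => if 𝒰.cell n x.2 = v then ρ x y else 0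
  have hρcell : ∀ x y, 𝒰.cell n x.2 ≠ 𝒰.cell n y.2 → ρ x y = 0 := fun x y h =>
    by_contra fun h' => h (hcell _ _ _ _ h')
  have hρv : ∀ v, IsStarProjection (ρv v) := by
    intro v
    refine ⟨?_, ?_⟩
    · change _ * _ = _
      ext x z
      rw [Matrix.mul_apply]
      change ∑ y, (if 𝒰.cell n x.2 = v then ρ x y else 0) *
        (if 𝒰.cell n y.2 = v then ρ y z else 0) = if 𝒰.cell n x.2 = v then ρ x z else 0
      split_ifs with h
      · rw [← congrFun (congrFun hρmul x) z, Matrix.mul_apply]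
        refine Finset.sum_congr rfl fun y _ => ?_
        split_ifs with h'
        · rfl
        · rw [hρcell x y fun h'' => h' (h''.symm.trans h), zero_mul, zero_mul]
      · simp
    · change Matrix.conjTranspose _ = _
      ext x y
      change star (if 𝒰.cell n y.2 = v then ρ y x else 0) = if 𝒰.cell n x.2 = v then ρ x y else 0
      have h1 : star (ρ y x) = ρ x y := congrFun (congrFun hρstar x) y
      by_cases h : 𝒰.cell n x.2 = 𝒰.cell n y.2
      · rw [h]
        split_ifs
        · exact h1
        · exact star_zero _
      · rw [hρcell x y h, hρcell y x (Ne.symm h)]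
        simp
  choose a u hu hu' using fun v => exists_isometry_of_isStarProjection (hρv v)
  have husupp : ∀ v x k, 𝒰.cell n x.2 ≠ v → u v x k = 0 := by
    intro v x k h
    have h1 : ρv v * u v = u v := by rw [← hu' v, Matrix.mul_assoc, hu, Matrix.mul_one]
    rw [← h1, Matrix.mul_apply]
    refine Finset.sum_eq_zero fun y _ => ?_
    change (if 𝒰.cell n x.2 = v then ρ x y else 0) * _ = 0
    rw [if_neg h, zero_mul]
  refine ⟨a, ?_⟩
  rw [sum_cls]
  -- `u v` factors the block of `ρ` over the cell `v`, of rank `a v`. Its columns, as coefficients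
  -- of the units from the base point of `v`, give a partial isometry between `p` and the diagonal
  -- matrix with `a v` units at that point for each `v`.
  let w : Matrix ι (Σ v, Fin (a v)) A := Matrix.of fun i x =>
    ∑ s, u x.1 (i, s) x.2 • 𝒰.E n s (𝒰.base n x.1)
  refine (ProjClass.ofMatrix_eq_iff _ _).2 ⟨wᴴ, ?_, ?_⟩
  · rw [Matrix.conjTranspose_conjTranspose]
    ext i j
    rw [Matrix.mul_apply, Fintype.sum_sigma, hc i j]
    have h1 : ∀ (v : 𝒰.V n) (k : Fin (a v)), w i ⟨v, k⟩ * wᴴ ⟨v, k⟩ j =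
        ∑ s, ∑ t, (u v (i, s) k * star (u v (j, t) k)) • 𝒰.E n s t := by
      intro v k
      change (∑ s, u v (i, s) k • 𝒰.E n s (𝒰.base n v)) *
        star (∑ t, u v (j, t) k • 𝒰.E n t (𝒰.base n v)) = _
      rw [star_sum, Finset.sum_mul]
      refine Finset.sum_congr rfl fun s _ => ?_
      rw [Finset.mul_sum]
      refine Finset.sum_congr rfl fun t _ => ?_
      rw [star_smul, star_E, smul_mul_smul_comm]
      by_cases h : 𝒰.cell n s = v
      · rw [𝒰.mul_same n s _ t (by rw [cell_base, h])]
      · rw [husupp v (i, s) k h, zero_mul, zero_smul, zero_smul]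
    simp only [h1]
    have h2 : ∀ v, ∑ k, ∑ s, ∑ t, (u v (i, s) k * star (u v (j, t) k)) • 𝒰.E n s t =
        ∑ s, ∑ t, ρv v (i, s) (j, t) • 𝒰.E n s t := by
      intro v
      rw [Finset.sum_comm]
      refine Finset.sum_congr rfl fun s _ => ?_
      rw [Finset.sum_comm]
      refine Finset.sum_congr rfl fun t _ => ?_
      rw [← Finset.sum_smul, ← hu' v, Matrix.mul_apply]
      rfl
    simp only [h2]
    rw [Finset.sum_comm]
    refine Finset.sum_congr rfl fun s _ => ?_
    rw [Finset.sum_comm]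
    refine Finset.sum_congr rfl fun t _ => ?_
    rw [← Finset.sum_smul]
    congr 1
    change ∑ v, (if 𝒰.cell n s = v then c i j s t else 0) = _
    simp
  · rw [Matrix.conjTranspose_conjTranspose]
    ext ⟨v, k⟩ ⟨v', k'⟩
    rw [Matrix.mul_apply]
    have h1 : ∀ i, wᴴ ⟨v, k⟩ i * w i ⟨v', k'⟩ =
        ∑ s, (star (u v (i, s) k) * u v' (i, s) k') •
          (𝒰.E n (𝒰.base n v) s * 𝒰.E n s (𝒰.base n v')) := by
      intro i
      change star (∑ t, u v (i, t) k • 𝒰.E n t (𝒰.base n v)) *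
        (∑ s, u v' (i, s) k' • 𝒰.E n s (𝒰.base n v')) = _
      rw [star_sum, Finset.sum_mul]
      refine Finset.sum_congr rfl fun s _ => ?_
      rw [Finset.mul_sum, Finset.sum_eq_single s]
      · rw [star_smul, star_E, smul_mul_smul_comm]
      · intro t _ ht
        rw [star_smul, star_E, smul_mul_smul_comm, 𝒰.mul_ne _ _ _ _ _ ht.symm, smul_zero]
      · simp
    simp only [h1]
    by_cases hv : v = v'
    · subst hv
      have h2 : ∀ i s, (star (u v (i, s) k) * u v (i, s) k') •
          (𝒰.E n (𝒰.base n v) s * 𝒰.E n s (𝒰.base n v)) =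
          (star (u v (i, s) k) * u v (i, s) k') • 𝒰.E n (𝒰.base n v) (𝒰.base n v) := by
        intro i s
        by_cases h : 𝒰.cell n s = v
        · rw [𝒰.mul_same n _ s _ (by rw [cell_base, h])]
        · rw [husupp v (i, s) k h, star_zero, zero_mul, zero_smul, zero_smul]
      simp only [h2, ← Finset.sum_smul]
      have h3 := congrFun (congrFun (hu v) k) k'
      rw [Matrix.mul_apply, Fintype.sum_prod_type] at h3
      simp only [Matrix.conjTranspose_apply] at h3
      rw [h3, Matrix.one_apply, Matrix.diagonal_apply]
      by_cases hk : k = k'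
      · subst hk; simp
      · rw [if_neg hk, if_neg (by simpa using hk), zero_smul]
    · rw [Matrix.diagonal_apply_ne _ (by simp [hv])]
      refine Finset.sum_eq_zero fun i _ => Finset.sum_eq_zero fun s _ => ?_
      by_cases h : 𝒰.cell n s = v
      · rw [husupp v' (i, s) k' (h ▸ hv), mul_zero, zero_smul]
      · rw [husupp v (i, s) k h, star_zero, zero_mul, zero_smul]

/-! ### Kernels and images of the maps to `K₀` -/

theorem sum_trace_fromBlocks {ι κ : Type*} [Fintype ι] [Fintype κ] (n : ℕ) (t : 𝒰.P n)
    (M : Matrix ι ι A) (N : Matrix κ κ A) : ∑ i, 𝒰.trace n t (Matrix.fromBlocks M 0 0 N i i) =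
      ∑ i, 𝒰.trace n t (M i i) + ∑ i, 𝒰.trace n t (N i i) := by
  rw [Fintype.sum_sum_type]
  rfl

/-- The equivalence `v` is rectangular. Placed in a corner of a square block matrix it can be
perturbed into a finite level, where traces are invariant. -/
theorem trace_eq_of_ofMatrix_eq (hd : 𝒰.IsDense) {ι κ : Type*} [Fintype ι] [Fintype κ] {n : ℕ} {P : Matrix ι ι A}
    {Q : Matrix κ κ A} (hP : IsStarProjection P) (hQ : IsStarProjection Q)
    (hPn : ∀ i j, P i j ∈ 𝒰.level n) (hQn : ∀ i j, Q i j ∈ 𝒰.level n)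
    (h : ProjClass.ofMatrix P hP = ProjClass.ofMatrix Q hQ) :
    ∃ m ≥ n, ∀ t, ∑ i, 𝒰.trace m t (P i i) = ∑ i, 𝒰.trace m t (Q i i) := by
  obtain ⟨v, h1, h2⟩ := (ProjClass.ofMatrix_eq_iff hP hQ).1 h
  have h0 : IsStarProjection (0 : Matrix ι ι A) := ⟨zero_mul _, star_zero _⟩
  have h0' : IsStarProjection (0 : Matrix κ κ A) := ⟨zero_mul _, star_zero _⟩
  obtain ⟨m, hm, u, hu, h3, h4⟩ := exists_matrix_mem_of_equiv 𝒰.isClosed_level 𝒰.level_mono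
    hd (P := Matrix.fromBlocks P 0 0 (0 : Matrix κ κ A))
    (Q := Matrix.fromBlocks (0 : Matrix ι ι A) 0 0 Q) (v := Matrix.fromBlocks 0 0 v 0) (n := n)
    (isStarProjection_fromBlocks hP h0') (isStarProjection_fromBlocks h0 hQ)
    (by
      rintro (i | i) (j | j)
      · exact hPn i j
      all_goals exact zero_mem (𝒰.level n))
    (by
      rintro (i | i) (j | j)
      · exact zero_mem (𝒰.level n)
      · exact zero_mem (𝒰.level n)
      · exact zero_mem (𝒰.level n)
      · exact hQn i j)
    (by rw [Matrix.fromBlocks_conjTranspose, Matrix.fromBlocks_multiply]; simp [h1])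
    (by rw [Matrix.fromBlocks_conjTranspose, Matrix.fromBlocks_multiply]; simp [h2])
  refine ⟨m, hm, fun t => ?_⟩
  have h5 := 𝒰.trace_eq_of_equiv m t hu
  rw [h3, h4, sum_trace_fromBlocks, sum_trace_fromBlocks] at h5
  simpa using h5

theorem sum_trace_diagonal {n m : ℕ} (h : n ≤ m) (t : 𝒰.P m) (a : 𝒰.V n → ℕ) :
    ∑ i : Σ v, Fin (a v), 𝒰.trace m t (Matrix.diagonal (fun i : Σ v, Fin (a v) =>
      𝒰.E n (𝒰.base n i.1) (𝒰.base n i.1)) i i) =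
    seqMap 𝒰.β n m h (fun v => (a v : ℤ)) (𝒰.cell m t) • 𝒰.E m t t := by
  rw [eq_sum_zsmul_single (fun v => (a v : ℤ)), map_sum, Finset.sum_apply, Finset.sum_smul,
    Fintype.sum_sigma]
  refine Finset.sum_congr rfl fun v _ => ?_
  simp only [Matrix.diagonal_apply_eq]
  rw [Finset.sum_const, Finset.card_univ, Fintype.card_fin, 𝒰.trace_E_of_le h, cell_base,
    map_zsmul, Pi.smul_apply, smul_assoc, natCast_zsmul]

/-- A cell either has coefficient `0` or has a vanishing unit and dies by `dead`. As there are
finitely many cells, one level serves for all. -/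
theorem exists_seqMap_eq_zero {n : ℕ} (x : 𝒰.V n → ℤ)
    (hx : ∀ t, 𝒰.E n t t ≠ 0 → x (𝒰.cell n t) = 0) :
    ∃ (m : ℕ) (h : n ≤ m), seqMap 𝒰.β n m h x = 0 := by
  have h1 : ∀ v, ∃ (m : ℕ) (h : n ≤ m), seqMap 𝒰.β n m h (x v • Pi.single v 1) = 0 := by
    intro v
    by_cases hv : 𝒰.E n (𝒰.base n v) (𝒰.base n v) = 0
    · obtain ⟨m, h, hm⟩ := 𝒰.dead n _ hv
      rw [cell_base] at hm
      exact ⟨m, h, by rw [map_zsmul, hm, smul_zero]⟩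
    · have := hx _ hv
      rw [cell_base] at this
      exact ⟨n, le_rfl, by rw [this, zero_smul, map_zero]⟩
  choose m hm h2 using h1
  have h3 : ∀ v, m v ≤ n + ∑ v, m v := fun v =>
    (Finset.single_le_sum (f := m) (fun _ _ => Nat.zero_le _) (Finset.mem_univ v)).trans
      (Nat.le_add_left _ _)
  refine ⟨n + ∑ v, m v, Nat.le_add_right _ _, ?_⟩
  rw [eq_sum_zsmul_single x, map_sum]
  refine Finset.sum_eq_zero fun v _ => ?_
  rw [← seqMap_seqMap 𝒰.β (hm v) (h3 v), h2, map_zero]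

/-- Let `x` be the difference of its positive and negative parts. Their classes agree after addition
of a projection, which may be taken over a finite level. Traces cancel this projection and show that
the image of `x` vanishes on every cell whose unit is nonzero; the remaining cells die later. -/
theorem exists_seqMap_eq_zero_of_toK0 (hd : 𝒰.IsDense) {n : ℕ} (x : 𝒰.V n → ℤ) (hx : 𝒰.toK0 n x = 0) :
    ∃ (m : ℕ) (h : n ≤ m), seqMap 𝒰.β n m h x = 0 := by
  set a : 𝒰.V n → ℕ := fun v => (x v).toNat with ha
  set b : 𝒰.V n → ℕ := fun v => (-x v).toNat with hb
  have hxab : x = (fun v => (a v : ℤ)) - fun v => (b v : ℤ) := by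
    ext v
    simp only [ha, hb, Pi.sub_apply]
    omega
  have hof : ∀ a : 𝒰.V n → ℕ, 𝒰.toK0 n (fun v => (a v : ℤ)) =
      K0.of (∑ v, a v • 𝒰.cls n (𝒰.base n v)) := by
    intro a
    rw [map_sum]
    refine Finset.sum_congr rfl fun v _ => ?_
    rw [natCast_zsmul, map_nsmul]
  rw [hxab, map_sub, sub_eq_zero, hof, hof, K0.of_eq_of_iff] at hx
  obtain ⟨⟨p⟩, hc⟩ := hx
  obtain ⟨l, Q, hQl, hQ, v, h1, h2⟩ := exists_equiv_matrix_mem 𝒰.isClosed_level 𝒰.level_mono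
    hd p.isProj
  have hpQ : (Quot.mk _ p : ProjClass A) = ProjClass.ofMatrix Q hQ :=
    (ProjClass.mk_eq_ofMatrix p).trans ((ProjClass.ofMatrix_eq_iff _ _).2 ⟨v, h1, h2⟩)
  rw [hpQ, sum_cls, sum_cls, ← ProjClass.ofMatrix_fromBlocks, ← ProjClass.ofMatrix_fromBlocks] at hc
  have hmem : ∀ a : 𝒰.V n → ℕ, ∀ i j, Matrix.fromBlocks Q 0 0 (Matrix.diagonal
      fun i : Σ v, Fin (a v) => 𝒰.E n (𝒰.base n i.1) (𝒰.base n i.1)) i j ∈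
        𝒰.level (max n l) := by
    rintro a (i | i) (j | j)
    · exact 𝒰.level_mono (le_max_right n l) (hQl i j)
    · exact zero_mem (𝒰.level _)
    · exact zero_mem (𝒰.level _)
    · rw [Matrix.fromBlocks_apply₂₂, Matrix.diagonal_apply]
      split_ifs
      · exact 𝒰.level_mono (le_max_left n l) (𝒰.E_mem_span n _ _)
      · exact zero_mem (𝒰.level _)
  obtain ⟨m, hm, h3⟩ := 𝒰.trace_eq_of_ofMatrix_eq hd _ _ (hmem a) (hmem b) hc
  have hnm : n ≤ m := (le_max_left n l).trans hm
  obtain ⟨m', hm', h4⟩ := 𝒰.exists_seqMap_eq_zero (seqMap 𝒰.β n m hnm x) (by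
    intro t ht
    have h5 := h3 t
    rw [sum_trace_fromBlocks, sum_trace_fromBlocks, add_right_inj, 𝒰.sum_trace_diagonal hnm,
      𝒰.sum_trace_diagonal hnm, ← sub_eq_zero, ← sub_smul, ← Pi.sub_apply, ← map_sub, ← hxab,
      ← Int.cast_smul_eq_zsmul ℂ, smul_eq_zero] at h5
    exact_mod_cast h5.resolve_right ht)
  exact ⟨m', hnm.trans hm', by rw [← h4, seqMap_seqMap]⟩

theorem exists_toK0_eq (hd : 𝒰.IsDense) (x : ProjClass A) : ∃ n y, 𝒰.toK0 n y = K0.of x := by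
  obtain ⟨p⟩ := x
  obtain ⟨n, Q, hQn, hQ, v, h1, h2⟩ := exists_equiv_matrix_mem 𝒰.isClosed_level 𝒰.level_mono
    hd p.isProj
  have hpQ : (Quot.mk _ p : ProjClass A) = ProjClass.ofMatrix Q hQ :=
    (ProjClass.mk_eq_ofMatrix p).trans ((ProjClass.ofMatrix_eq_iff _ _).2 ⟨v, h1, h2⟩)
  obtain ⟨a, ha⟩ := 𝒰.exists_eq_sum_cls hQ hQn
  refine ⟨n, fun v => (a v : ℤ), ?_⟩
  rw [hpQ, ha, map_sum]
  refine Finset.sum_congr rfl fun v _ => ?_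
  rw [natCast_zsmul, map_nsmul]

/-- `K₀` of the limit of a sequence of finite-dimensional algebras. -/
theorem nonempty_K0_equiv (hd : 𝒰.IsDense) : Nonempty (K0 A ≃+ SeqLim 𝒰.β) := by
  refine nonempty_seqLim_equiv 𝒰.β 𝒰.toK0 𝒰.toK0_β (fun n => 𝒰.exists_seqMap_eq_zero_of_toK0 hd) ?_
  intro H hH
  refine K0.eq_top_of_forall_of_mem fun x => ?_
  obtain ⟨n, y, hy⟩ := 𝒰.exists_toK0_eq hd x
  rw [← hy]
  exact hH n y

/-- If the embeddings of consecutive levels are isomorphisms, so is the map from any level to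
`K₀`. -/
theorem bijective_toK0 (hd : 𝒰.IsDense) (hβ : ∀ n, Function.Bijective (𝒰.β n)) :
    Function.Bijective (𝒰.toK0 0) := by
  have hseq : ∀ m (h : 0 ≤ m), Function.Bijective (seqMap 𝒰.β 0 m h) := by
    intro m h
    induction m with
    | zero => convert Function.bijective_id using 1; ext1 x; exact seqMap_self 𝒰.β _ _ x
    | succ m ih =>
      convert (hβ m).comp (ih (Nat.zero_le m)) using 1
      ext1 x
      exact seqMap_succ 𝒰.β (Nat.zero_le m) h x
  have hcomp : ∀ m (h : 0 ≤ m) x, 𝒰.toK0 m (seqMap 𝒰.β 0 m h x) = 𝒰.toK0 0 x := by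
    intro m h x
    induction m with
    | zero => rw [seqMap_self]
    | succ m ih => rw [seqMap_succ _ (Nat.zero_le m), toK0_β, ih (Nat.zero_le m)]
  refine ⟨(injective_iff_map_eq_zero _).2 fun x hx => ?_, ?_⟩
  · obtain ⟨m, h, hm⟩ := 𝒰.exists_seqMap_eq_zero_of_toK0 hd x hx
    exact (injective_iff_map_eq_zero _).1 (hseq m h).1 x hm
  · rw [← AddMonoidHom.range_eq_top]
    refine K0.eq_top_of_forall_of_mem fun x => ?_
    obtain ⟨n, y, hy⟩ := 𝒰.exists_toK0_eq hd x
    obtain ⟨z, rfl⟩ := (hseq n (Nat.zero_le n)).2 y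
    exact ⟨z, by rw [← hy, hcomp]⟩

end UnitSystem

/-! ## Operators in the regular representation -/

/-- Weighted shift operators on `ℓ²`. -/
theorem exists_weightedShift {I : Type*} (τ : I → I) (u : I → ℂ) {C : ℝ} (hC : 0 ≤ C)
    (hu : ∀ i, ‖u i‖ ≤ C) (hτ : ∀ i j, u i ≠ 0 → u j ≠ 0 → τ i = τ j → i = j) :
    ∃ W : lp (fun _ : I => ℂ) 2 →L[ℂ] lp (fun _ : I => ℂ) 2,
      (∀ ξ i, (W ξ : I → ℂ) i = u i * (ξ : I → ℂ) (τ i)) ∧ ‖W‖ ≤ C := by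
  classical
  have key : ∀ (ξ : lp (fun _ : I => ℂ) 2) (s : Finset I),
      ∑ i ∈ s, ‖u i * (ξ : I → ℂ) (τ i)‖ ^ (2 : ENNReal).toReal ≤
        (C * ‖ξ‖) ^ (2 : ENNReal).toReal := by
    intro ξ s
    have h0 : ∀ i, ‖u i * (ξ : I → ℂ) (τ i)‖ ^ (2 : ENNReal).toReal ≤ C ^ (2 : ENNReal).toReal *
        if u i ≠ 0 then ‖(ξ : I → ℂ) (τ i)‖ ^ (2 : ENNReal).toReal else 0 := by
      intro i
      split_ifs with h
      · rw [norm_mul, Real.mul_rpow (norm_nonneg _) (norm_nonneg _)]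
        have := hu i
        gcongr
      · rw [not_not] at h
        simp [h]
    calc ∑ i ∈ s, ‖u i * (ξ : I → ℂ) (τ i)‖ ^ (2 : ENNReal).toReal
        ≤ ∑ i ∈ s, C ^ (2 : ENNReal).toReal *
          (if u i ≠ 0 then ‖(ξ : I → ℂ) (τ i)‖ ^ (2 : ENNReal).toReal else 0) :=
          Finset.sum_le_sum fun i _ => h0 i
      _ = C ^ (2 : ENNReal).toReal * ∑ i ∈ s.filter fun i => u i ≠ 0,
          ‖(ξ : I → ℂ) (τ i)‖ ^ (2 : ENNReal).toReal := by rw [← Finset.mul_sum, Finset.sum_filter]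
      _ = C ^ (2 : ENNReal).toReal * ∑ j ∈ (s.filter fun i => u i ≠ 0).image τ,
          ‖(ξ : I → ℂ) j‖ ^ (2 : ENNReal).toReal := by
          -- `τ` is injective where `u` does not vanish, so no coordinate of `ξ` is counted twice.
          rw [Finset.sum_image]
          intro i hi j hj hij
          exact hτ i j (Finset.mem_filter.1 hi).2 (Finset.mem_filter.1 hj).2 hij
      _ ≤ C ^ (2 : ENNReal).toReal * ‖ξ‖ ^ (2 : ENNReal).toReal := by
          gcongr
          exact lp.sum_rpow_le_norm_rpow (by norm_num) ξ _
      _ = (C * ‖ξ‖) ^ (2 : ENNReal).toReal := (Real.mul_rpow hC (norm_nonneg _)).symm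
  let L : lp (fun _ : I => ℂ) 2 →ₗ[ℂ] lp (fun _ : I => ℂ) 2 :=
    { toFun := fun ξ => ⟨fun i => u i * (ξ : I → ℂ) (τ i), memℓp_gen' (key ξ)⟩
      map_add' := fun ξ η => by
        ext i
        exact mul_add _ _ _
      map_smul' := fun c ξ => by
        ext i
        exact mul_left_comm _ _ _ }
  refine ⟨L.mkContinuous C fun ξ => lp.norm_le_of_forall_sum_le (by norm_num) (by positivity)
    (key ξ), fun ξ i => rfl, LinearMap.mkContinuous_norm_le _ hC _⟩

namespace EqGroupoid

variable {G : EqGroupoid}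

open Classical in
theorem ext_single {S S' : G.L2 →L[ℂ] G.L2}
    (h : ∀ a : G.Arrow, S (lp.single 2 a (1 : ℂ) : G.L2) = S' (lp.single 2 a (1 : ℂ) : G.L2)) :
    S = S' := by
  ext1 ξ
  have h1 := lp.hasSum_single (p := 2) (by norm_num) ξ
  have h2 := h1.mapL S
  have h3 := h1.mapL S'
  have h4 : ∀ a, S (lp.single 2 a ((ξ : G.Arrow → ℂ) a) : G.L2) =
      S' (lp.single 2 a ((ξ : G.Arrow → ℂ) a) : G.L2) := by
    intro a
    have h5 : (lp.single 2 a ((ξ : G.Arrow → ℂ) a) : G.L2) =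
        (ξ : G.Arrow → ℂ) a • lp.single 2 a (1 : ℂ) := by
      rw [← lp.single_smul, smul_eq_mul, mul_one]
    rw [h5, map_smul, map_smul, h]
  simp only [h4] at h2
  exact h2.unique h3

theorem IsRegularRep.unique {f : G.Arrow → ℂ} {S S' : G.L2 →L[ℂ] G.L2} (h : IsRegularRep f S)
    (h' : IsRegularRep f S') : S = S' := by
  classical
  refine ext_single fun a => ?_
  ext c
  rw [h a c, h' a c]

theorem IsRegularRep.add {f g : G.Arrow → ℂ} {S S' : G.L2 →L[ℂ] G.L2} (h : IsRegularRep f S)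
    (h' : IsRegularRep g S') : IsRegularRep (f + g) (S + S') := by
  classical
  intro a c
  have h1 := h a c
  have h2 := h' a c
  change (S (lp.single 2 a (1 : ℂ)) : G.Arrow → ℂ) c +
    (S' (lp.single 2 a (1 : ℂ)) : G.Arrow → ℂ) c = _
  rw [h1, h2]
  split_ifs
  · rfl
  · exact add_zero _

theorem IsRegularRep.smul {f : G.Arrow → ℂ} {S : G.L2 →L[ℂ] G.L2} (h : IsRegularRep f S)
    (r : ℂ) : IsRegularRep (r • f) (r • S) := by
  classical
  intro a c
  have h1 := h a c
  change r * (S (lp.single 2 a (1 : ℂ)) : G.Arrow → ℂ) c = _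
  rw [h1]
  split_ifs
  · rfl
  · exact mul_zero _

theorem IsRegularRep.zero : IsRegularRep (0 : G.Arrow → ℂ) 0 := by
  intro a c
  change (0 : ℂ) = _
  split_ifs <;> rfl

theorem IsRegularRep.sum {ι : Type*} {s : Finset ι} {f : ι → G.Arrow → ℂ}
    {S : ι → G.L2 →L[ℂ] G.L2} (h : ∀ i ∈ s, IsRegularRep (f i) (S i)) :
    IsRegularRep (∑ i ∈ s, f i) (∑ i ∈ s, S i) := by
  classical
  induction s using Finset.induction_on with
  | empty => simpa using IsRegularRep.zero
  | insert i s hi ih =>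
    rw [Finset.sum_insert hi, Finset.sum_insert hi]
    exact (h i (Finset.mem_insert_self _ _)).add
      (ih fun j hj => h j (Finset.mem_insert_of_mem hj))

theorem IsRegularRep.sub {f g : G.Arrow → ℂ} {S S' : G.L2 →L[ℂ] G.L2} (h : IsRegularRep f S)
    (h' : IsRegularRep g S') : IsRegularRep (f - g) (S - S') := by
  have := h.add (h'.smul (-1))
  simpa [sub_eq_add_neg] using this

/-- The inverse of an arrow. -/
def Arrow.inv (a : G.Arrow) : G.Arrow := ⟨(a.1.2, a.1.1), G.rel.symm a.2⟩

theorem IsRegularRep.star {f : G.Arrow → ℂ} {S : G.L2 →L[ℂ] G.L2} (h : IsRegularRep f S) :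
    IsRegularRep (fun a => Star.star (f a.inv)) (Star.star S) := by
  classical
  intro a c
  have h1 : (Star.star S (lp.single 2 a (1 : ℂ)) : G.Arrow → ℂ) c =
      inner ℂ (lp.single 2 c (1 : ℂ) : G.L2) (Star.star S (lp.single 2 a (1 : ℂ))) := by
    rw [lp.inner_single_left]
    simp
  have h2 : inner ℂ (S (lp.single 2 c (1 : ℂ))) (lp.single 2 a (1 : ℂ) : G.L2) =
      Star.star ((S (lp.single 2 c (1 : ℂ)) : G.Arrow → ℂ) a) := by
    rw [lp.inner_single_right]
    simp
  have h3 := h c a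
  have h4 := h1.trans ((ContinuousLinearMap.adjoint_inner_right S _ _).trans h2)
  refine Eq.trans (by convert h4) ?_
  refine Eq.trans (congrArg Star.star (by convert h3)) ?_
  by_cases hs : c.source = a.source
  · rw [dif_pos hs, dif_pos hs.symm]
    rfl
  · rw [dif_neg hs, dif_neg (Ne.symm hs), star_zero]

/-- A function that is supported on a bisection acts by a bounded operator. -/
theorem exists_isRegularRep (f : G.Arrow → ℂ) {C : ℝ} (hC : 0 ≤ C) (hf : ∀ a, ‖f a‖ ≤ C)
    (hrange : ∀ a b, f a ≠ 0 → f b ≠ 0 → a.range = b.range → a = b)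
    (hsource : ∀ a b, f a ≠ 0 → f b ≠ 0 → a.source = b.source → a = b) :
    ∃ W, IsRegularRep f W ∧ ‖W‖ ≤ C := by
  classical
  -- At an arrow `c` the operator reads the coordinate at `b⁻¹ c`, where `b` is the only arrow in
  -- the support of `f` with the range of `c`; this is `τ c`. Where no such `b` exists, the weight
  -- `u c` is `0` and `τ c` is irrelevant.
  let D : G.Arrow → Prop := fun c => ∃ b : G.Arrow, f b ≠ 0 ∧ b.range = c.range
  let β : ∀ c, D c → G.Arrow := fun c h => h.choose
  have hβ : ∀ c (h : D c), f (β c h) ≠ 0 := fun c h => h.choose_spec.1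
  have hβr : ∀ c (h : D c), (β c h).range = c.range := fun c h => h.choose_spec.2
  let τ : G.Arrow → G.Arrow := fun c => if h : D c then
    ⟨((β c h).source, c.source), G.rel.trans (G.rel.symm (β c h).2)
      (by have h1 := c.2; rw [← show (β c h).1.1 = c.1.1 from hβr c h] at h1; exact h1)⟩ else c
  let u : G.Arrow → ℂ := fun c => if h : D c then f (β c h) else 0
  have hτ1 : ∀ c (h : D c), (τ c).range = (β c h).source := by
    exact fun c h => congrArg Arrow.range (dif_pos h)
  have hτ2 : ∀ c, (τ c).source = c.source := by
    intro c
    by_cases h : D c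
    · exact (congrArg Arrow.source (dif_pos h : τ c = _)).trans rfl
    · exact congrArg Arrow.source (dif_neg h)
  have hu0 : ∀ c, u c ≠ 0 → D c := fun c h => by_contra fun h' => h (dif_neg h')
  have ext_arrow : ∀ {a b : G.Arrow}, a.range = b.range → a.source = b.source → a = b :=
    fun h1 h2 => Subtype.ext (Prod.ext h1 h2)
  obtain ⟨W, hW, hWC⟩ := exists_weightedShift τ u hC
    (fun c => by
      by_cases h : D c
      · simp only [u, dif_pos h]; exact hf _
      · simp only [u, dif_neg h, norm_zero]; exact hC)
    (fun c c' hc hc' h => by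
      have h1 := hu0 c hc
      have h2 := hu0 c' hc'
      have h3 : (β c h1).source = (β c' h2).source := by rw [← hτ1, ← hτ1, h]
      have h4 := hsource _ _ (hβ c h1) (hβ c' h2) h3
      refine ext_arrow ?_ ?_
      · rw [← hβr c h1, ← hβr c' h2, h4]
      · rw [← hτ2 c, ← hτ2 c', h])
  refine ⟨W, fun a c => ?_, hWC⟩
  rw [hW]
  rw [lp.single_apply]
  by_cases h : c.source = a.source
  · rw [dif_pos h]
    by_cases h1 : f (c.mulInv a h) = 0
    · rw [h1]
      by_cases hD : D c
      · rw [Pi.single_eq_of_ne, mul_zero]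
        intro h2
        refine hβ c hD ?_
        rw [← h1]
        congr 1
        refine ext_arrow (hβr c hD) ?_
        rw [← hτ1 c hD, h2]
        rfl
      · rw [show u c = 0 from dif_neg hD, zero_mul]
    · have hD : D c := ⟨_, h1, rfl⟩
      have h2 : β c hD = c.mulInv a h := hrange _ _ (hβ c hD) h1 (hβr c hD)
      have h3 : τ c = a := by
        refine ext_arrow ?_ ?_
        · rw [hτ1 c hD, h2]
          rfl
        · rw [hτ2, h]
      rw [h3, Pi.single_eq_same, mul_one, show u c = f (β c hD) from dif_pos hD, h2]
  · rw [dif_neg h, Pi.single_eq_of_ne, mul_zero]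
    intro h1
    rw [← hτ2 c, h1] at h
    exact h rfl

instance isClosed_reducedCStar : IsClosed (G.reducedCStar : Set (G.L2 →L[ℂ] G.L2)) :=
  NonUnitalStarSubalgebra.isClosed_topologicalClosure _

theorem mem_reducedCStar {f : G.Arrow → ℂ} {S : G.L2 →L[ℂ] G.L2} (hf : Continuous f)
    (hc : HasCompactSupport f) (hS : IsRegularRep f S) : S ∈ G.reducedCStar :=
  NonUnitalStarSubalgebra.le_topologicalClosure _
    (NonUnitalStarAlgebra.subset_adjoin ℂ _ ⟨f, hf, hc, hS⟩)

/-- A closed `*`-algebra that contains the operators of the continuous compactly supported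
functions contains the reduced C*-algebra. -/
theorem reducedCStar_le {D : NonUnitalStarSubalgebra ℂ (G.L2 →L[ℂ] G.L2)}
    (hD : IsClosed (D : Set (G.L2 →L[ℂ] G.L2)))
    (h : ∀ f S, Continuous f → HasCompactSupport f → IsRegularRep f S → S ∈ D) :
    G.reducedCStar ≤ D := by
  refine NonUnitalStarSubalgebra.topologicalClosure_minimal _ (NonUnitalStarAlgebra.adjoin_le ?_) hD
  rintro S ⟨f, h1, h2, h3⟩
  exact h f S h1 h2 h3

end EqGroupoid

/-! ## Tail equivalence relations -/

namespace EqGroupoid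

/-- An arrow in the support of `g` is determined by its source, so the convolution of `f` and `g`
has at most one nonzero term at each arrow; `hk` and `hk0` say that `k` is this convolution. -/
theorem IsRegularRep.mul {G : EqGroupoid} {f g k : G.Arrow → ℂ} {S S' : G.L2 →L[ℂ] G.L2}
    (hS : IsRegularRep f S) (hS' : IsRegularRep g S')
    (hg : ∀ a b, g a ≠ 0 → g b ≠ 0 → a.source = b.source → a = b)
    (hk : ∀ (b c : G.Arrow) (h : c.source = b.source), g b ≠ 0 → k c = f (c.mulInv b h) * g b)
    (hk0 : ∀ c : G.Arrow, (∀ b : G.Arrow, b.source = c.source → g b = 0) → k c = 0) :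
    IsRegularRep k (S * S') := by
  classical
  intro a c
  change (S (S' (lp.single 2 a (1 : ℂ))) : G.Arrow → ℂ) c = _
  by_cases h : ∃ b : G.Arrow, b.source = a.range ∧ g b ≠ 0
  · obtain ⟨b, hb, hgb⟩ := h
    let a' : G.Arrow := ⟨(b.range, a.source), G.rel.trans b.2
      (by have h1 := a.2; rw [← show b.1.2 = a.1.1 from hb] at h1; exact h1)⟩
    have h1 : S' (lp.single 2 a (1 : ℂ)) = g b • (lp.single 2 a' (1 : ℂ) : G.L2) := by
      ext e
      rw [show (S' (lp.single 2 a (1 : ℂ)) : G.Arrow → ℂ) e = _ by convert hS' a e]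
      change _ = g b * (lp.single 2 a' (1 : ℂ) : G.L2) e
      rw [lp.single_apply]
      by_cases he : e = a'
      · subst he
        rw [dif_pos (show a'.source = a.source from rfl), Pi.single_eq_same, mul_one]
        congr 1
        exact Subtype.ext (Prod.ext rfl hb.symm)
      · rw [Pi.single_eq_of_ne he, mul_zero]
        split_ifs with h2
        · by_contra h3
          have h4 := hg _ _ h3 hgb hb.symm
          exact he (Subtype.ext (Prod.ext (show (e.mulInv a h2).range = b.range from congrArg Arrow.range h4) h2))
        · rfl
    rw [h1, map_smul]
    change g b * (S (lp.single 2 a' (1 : ℂ)) : G.Arrow → ℂ) c = _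
    rw [show (S (lp.single 2 a' (1 : ℂ)) : G.Arrow → ℂ) c = _ by convert hS a' c]
    by_cases h2 : c.source = a.source
    · rw [dif_pos h2, dif_pos (show c.source = a'.source from h2),
        hk b (c.mulInv a h2) hb.symm hgb, mul_comm]
      rfl
    · rw [dif_neg h2, dif_neg (show ¬ c.source = a'.source from h2), mul_zero]
  · push Not at h
    have h1 : S' (lp.single 2 a (1 : ℂ)) = 0 := by
      ext e
      rw [show (S' (lp.single 2 a (1 : ℂ)) : G.Arrow → ℂ) e = _ by convert hS' a e]
      split_ifs with h2
      · exact h _ rfl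
      · rfl
    rw [h1, map_zero]
    split_ifs with h2
    · exact (hk0 (c.mulInv a h2) fun b hb => h b (show b.source = a.range from hb)).symm
    · rfl

instance instSMulCStar {G : EqGroupoid} : SMul ℂ G.reducedCStar := Module.toDistribMulAction.toSMul

instance instHSMulCStar {G : EqGroupoid} : HSMul ℂ G.reducedCStar G.reducedCStar := instHSMul

end EqGroupoid

/-- A groupoid that is the union of an increasing sequence of equivalence relations `R n`, where
the space of units is the limit of finite sets `Q n`, and `R n` identifies, in each cell of `Q n`,
the sequences that start with the points of this cell; together with the maps `β` that describe the
embeddings of the cells of consecutive levels. -/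
structure TailSystem (G : EqGroupoid) where
  V : ℕ → Type
  Q : ℕ → Type
  fintypeV : ∀ n, Fintype (V n)
  fintypeQ : ∀ n, Fintype (Q n)
  cell : ∀ n, Q n → V n
  cell_surjective : ∀ n, Function.Surjective (cell n)
  σ : ∀ n, Q (n + 1) → Q n
  π : ∀ n, G.Unit → Q n
  σ_π : ∀ n x, σ n (π (n + 1) x) = π n x
  R : ℕ → G.Unit → G.Unit → Prop
  R_equiv : ∀ n, Equivalence (R n)
  R_succ : ∀ n x y, R n x y → R (n + 1) x y
  rel_iff : ∀ x y, G.rel x y ↔ ∃ n, R n x y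
  top_eq : G.top = TopologicalSpace.generateFrom {B | ∃ (n : ℕ) (s t : Q n),
    B = {a | R n a.1.1 a.1.2 ∧ π n a.1.1 = s ∧ π n a.1.2 = t}}
  cell_eq : ∀ n x y, R n x y → cell n (π n x) = cell n (π n y)
  coherent : ∀ n m, n ≤ m → ∀ x y x' y', R n x y → R n x' y' → π m x = π m x' → π n y = π n y' →
    π m y = π m y'
  exists_rel : ∀ n x c, cell n (π n x) = cell n c → ∃ y, R n x y ∧ π n y = c
  separated : ∀ n x y, (∀ m ≥ n, π m x = π m y) → x = y
  refine : ∀ n x y x' y', R n x y → R (n + 1) x' y' → π (n + 1) x = π (n + 1) x' →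
    π (n + 1) y = π (n + 1) y' → R n x' y'
  complete : ∀ n (q : ∀ j, Q (n + j)), (∀ j, σ (n + j) (q (j + 1)) = q j) →
    ∃ x, ∀ j, π (n + j) x = q j
  β : ∀ n, (V n → ℤ) →+ (V (n + 1) → ℤ)
  β_single : ∀ n t [Fintype (Q (n + 1))] [DecidableEq (Q n)] [DecidableEq (V n)]
    [DecidableEq (V (n + 1))], β n (Pi.single (cell n t) 1) =
      ∑ s, if σ n s = t then Pi.single (cell (n + 1) s) 1 else 0

namespace TailSystem

open EqGroupoid Filter Topology
open Classical

variable {G : EqGroupoid} (𝒯 : TailSystem G)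

instance (n : ℕ) : Fintype (𝒯.Q n) := 𝒯.fintypeQ n

theorem R_mono {n m : ℕ} (h : n ≤ m) {x y : G.Unit} (hxy : 𝒯.R n x y) : 𝒯.R m x y := by
  induction m, h using Nat.le_induction with
  | base => exact hxy
  | succ m _ ih => exact 𝒯.R_succ m x y ih

/-- The set of arrows `[P, s, t]`. -/
def box (n : ℕ) (s t : 𝒯.Q n) : Set G.Arrow :=
  {a | 𝒯.R n a.range a.source ∧ 𝒯.π n a.range = s ∧ 𝒯.π n a.source = t}

/-- By the field `refine`, a pair of `R (m + 1)` that agrees at level `m + 1` with a pair of `R m`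
is itself in `R m`; this is iterated downwards to level `n`. -/
theorem box_subset {n m : ℕ} (h : n ≤ m) {s t : 𝒯.Q n} {a : G.Arrow} (ha : a ∈ 𝒯.box n s t) :
    𝒯.box m (𝒯.π m a.range) (𝒯.π m a.source) ⊆ 𝒯.box n s t := by
  induction m, h using Nat.le_induction with
  | base =>
    obtain ⟨-, rfl, rfl⟩ := ha
    exact subset_rfl
  | succ m hm ih =>
    rintro b ⟨h1, h2, h3⟩
    refine ih ⟨𝒯.refine m _ _ _ _ (𝒯.R_mono hm ha.1) h1 h2.symm h3.symm, ?_, ?_⟩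
    · rw [← 𝒯.σ_π, h2, 𝒯.σ_π]
    · rw [← 𝒯.σ_π, h3, 𝒯.σ_π]

theorem isOpen_box (n : ℕ) (s t : 𝒯.Q n) : IsOpen (𝒯.box n s t) := by
  change @IsOpen _ G.top _
  rw [𝒯.top_eq]
  exact TopologicalSpace.isOpen_generateFrom_of_mem ⟨n, s, t, rfl⟩

theorem exists_R (a : G.Arrow) : ∃ n, 𝒯.R n a.range a.source := (𝒯.rel_iff _ _).1 a.2

/-- The boxes around an arrow shrink as the level grows. Asking for all high levels, and not just
for one, makes the claim pass to finite intersections of generators. -/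
theorem exists_box_subset {O : Set G.Arrow} (hO : IsOpen O) {a : G.Arrow} (ha : a ∈ O) :
    ∃ n, ∀ m ≥ n, 𝒯.R m a.range a.source ∧
      𝒯.box m (𝒯.π m a.range) (𝒯.π m a.source) ⊆ O := by
  change @IsOpen _ G.top _ at hO
  rw [𝒯.top_eq] at hO
  induction hO with
  | basic B hB =>
    obtain ⟨n, s, t, rfl⟩ := hB
    exact ⟨n, fun m hm => ⟨𝒯.R_mono hm ha.1, 𝒯.box_subset hm ha⟩⟩
  | univ =>
    obtain ⟨n, hn⟩ := 𝒯.exists_R a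
    exact ⟨n, fun m hm => ⟨𝒯.R_mono hm hn, subset_univ _⟩⟩
  | inter B B' _ _ ih ih' =>
    obtain ⟨n, hn⟩ := ih ha.1
    obtain ⟨n', hn'⟩ := ih' ha.2
    exact ⟨max n n', fun m hm => ⟨(hn m (le_of_max_le_left hm)).1,
      subset_inter (hn m (le_of_max_le_left hm)).2 (hn' m (le_of_max_le_right hm)).2⟩⟩
  | sUnion 𝒮 _ ih =>
    obtain ⟨B, hB, haB⟩ := ha
    obtain ⟨n, hn⟩ := ih B hB haB
    exact ⟨n, fun m hm => ⟨(hn m hm).1, (hn m hm).2.trans (subset_sUnion_of_mem hB)⟩⟩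

theorem isClosed_box (n : ℕ) (s t : 𝒯.Q n) : IsClosed (𝒯.box n s t) := by
  rw [← isOpen_compl_iff, isOpen_iff_forall_mem_open]
  intro a ha
  obtain ⟨m, hm⟩ := 𝒯.exists_R a
  have hm' := 𝒯.R_mono (le_max_right n m) hm
  refine ⟨_, ?_, 𝒯.isOpen_box (max n m) (𝒯.π _ a.range) (𝒯.π _ a.source), ⟨hm', rfl, rfl⟩⟩
  intro b hb hb'
  have h1 := 𝒯.box_subset (le_max_left n m) hb'
  rw [hb.2.1, hb.2.2] at h1
  exact ha (h1 ⟨hm', rfl, rfl⟩)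

/-- Along an ultrafilter on the box each coordinate of the range is constant, since `Q` is finite,
and `complete` produces a unit `x` with these coordinates. A related `y` over `t` exists by
`exists_rel`, and `coherent` forces the coordinates of the sources to be those of `y`; so the
ultrafilter converges to `(x, y)`. -/
theorem isCompact_box (n : ℕ) (s t : 𝒯.Q n) : IsCompact (𝒯.box n s t) := by
  rw [isCompact_iff_ultrafilter_le_nhds]
  intro F hF
  rw [le_principal_iff] at hF
  have h1 : ∀ j, ∃ q : 𝒯.Q (n + j), {a : G.Arrow | 𝒯.π (n + j) a.range = q} ∈ F := by
    intro j
    obtain ⟨q, hq⟩ := (F.map fun a => 𝒯.π (n + j) a.range).eq_pure_of_finite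
    refine ⟨q, ?_⟩
    have h2 : ({q} : Set (𝒯.Q (n + j))) ∈ F.map fun a => 𝒯.π (n + j) a.range := by
      rw [hq]
      exact mem_singleton q
    exact h2
  choose q hq using h1
  have hF' : 𝒯.box n s t ∈ F := hF
  have hσ : ∀ j, 𝒯.σ (n + j) (q (j + 1)) = q j := by
    intro j
    obtain ⟨a, ha1, ha2⟩ := F.nonempty_of_mem (inter_mem (hq j) (hq (j + 1)))
    rw [← show 𝒯.π (n + j) a.range = q j from ha1,
      ← show 𝒯.π (n + (j + 1)) a.range = q (j + 1) from ha2]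
    exact 𝒯.σ_π _ _
  obtain ⟨x, hx⟩ := 𝒯.complete n q hσ
  obtain ⟨a₀, ha₀, ha₀'⟩ := F.nonempty_of_mem (inter_mem hF' (hq 0))
  have hxs : 𝒯.π n x = s := (hx 0).trans (ha₀'.symm.trans ha₀.2.1)
  have hst : 𝒯.cell n s = 𝒯.cell n t := by
    have := 𝒯.cell_eq n _ _ ha₀.1
    rwa [ha₀.2.1, ha₀.2.2] at this
  obtain ⟨y, hxy, hyt⟩ := 𝒯.exists_rel n x t (by rw [hxs, hst])
  refine ⟨⟨(x, y), (𝒯.rel_iff _ _).2 ⟨n, hxy⟩⟩, ⟨hxy, hxs, hyt⟩, ?_⟩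
  intro O hO
  obtain ⟨O', hO'O, hO', hxO'⟩ := mem_nhds_iff.1 hO
  obtain ⟨m, hm⟩ := 𝒯.exists_box_subset hO' hxO'
  obtain ⟨h3, h4⟩ := hm (n + m) (Nat.le_add_left m n)
  refine F.sets_of_superset (inter_mem hF' (hq m)) (Subset.trans ?_ hO'O)
  rintro a ⟨ha1, ha2⟩
  refine h4 ⟨𝒯.R_mono (Nat.le_add_right n m) ha1.1, ha2.trans (hx m).symm, ?_⟩
  exact 𝒯.coherent n (n + m) (Nat.le_add_right n m) a.range a.source x y ha1.1 hxy
    (ha2.trans (hx m).symm) (ha1.2.2.trans hyt.symm)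

/-- `coherent` determines the later coordinates of the source from those of the range, and
`separated` then determines the source. With `eq_of_mem_box'`, boxes are bisections. -/
theorem eq_of_mem_box {n : ℕ} {s t : 𝒯.Q n} {a b : G.Arrow} (ha : a ∈ 𝒯.box n s t)
    (hb : b ∈ 𝒯.box n s t) (h : a.range = b.range) : a = b := by
  refine Subtype.ext (Prod.ext h (𝒯.separated n _ _ fun m hm => ?_))
  exact 𝒯.coherent n m hm _ _ _ _ ha.1 hb.1 (congrArg (𝒯.π m) h) (ha.2.2.trans hb.2.2.symm)

theorem eq_of_mem_box' {n : ℕ} {s t : 𝒯.Q n} {a b : G.Arrow} (ha : a ∈ 𝒯.box n s t)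
    (hb : b ∈ 𝒯.box n s t) (h : a.source = b.source) : a = b := by
  refine Subtype.ext (Prod.ext (𝒯.separated n _ _ fun m hm => ?_) h)
  exact 𝒯.coherent n m hm _ _ _ _ ((𝒯.R_equiv n).symm ha.1) ((𝒯.R_equiv n).symm hb.1)
    (congrArg (𝒯.π m) h) (ha.2.1.trans hb.2.1.symm)

/-! ### Matrix units of a tail equivalence relation -/

theorem exists_isRegularRep_of_box {n : ℕ} {s t : 𝒯.Q n} {f : G.Arrow → ℂ} {C : ℝ} (hC : 0 ≤ C)
    (hf : ∀ a, ‖f a‖ ≤ C) (hf0 : ∀ a, a ∉ 𝒯.box n s t → f a = 0) :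
    ∃ W, IsRegularRep f W ∧ ‖W‖ ≤ C := by
  have hb : ∀ a, f a ≠ 0 → a ∈ 𝒯.box n s t := fun a h => by_contra fun h' => h (hf0 a h')
  exact exists_isRegularRep f hC hf (fun a b ha hb' h => 𝒯.eq_of_mem_box (hb a ha) (hb b hb') h)
    (fun a b ha hb' h => 𝒯.eq_of_mem_box' (hb a ha) (hb b hb') h)

/-- The characteristic function of `[P, s, t]`. -/
def ind (n : ℕ) (s t : 𝒯.Q n) : G.Arrow → ℂ := (𝒯.box n s t).indicator fun _ => 1

theorem ind_of_mem {n : ℕ} {s t : 𝒯.Q n} {a : G.Arrow} (h : a ∈ 𝒯.box n s t) : 𝒯.ind n s t a = 1 :=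
  indicator_of_mem h _

theorem ind_of_notMem {n : ℕ} {s t : 𝒯.Q n} {a : G.Arrow} (h : a ∉ 𝒯.box n s t) :
    𝒯.ind n s t a = 0 :=
  indicator_of_notMem h _

theorem mem_of_ind_ne {n : ℕ} {s t : 𝒯.Q n} {a : G.Arrow} (h : 𝒯.ind n s t a ≠ 0) :
    a ∈ 𝒯.box n s t := by_contra fun h' => h (𝒯.ind_of_notMem h')

theorem exists_unit (n : ℕ) (s t : 𝒯.Q n) : ∃ x : G.reducedCStar,
    IsRegularRep (𝒯.ind n s t) x.1 := by
  obtain ⟨W, hW, -⟩ := 𝒯.exists_isRegularRep_of_box (n := n) (s := s) (t := t) (f := 𝒯.ind n s t)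
    zero_le_one (fun a => by
      by_cases h : a ∈ 𝒯.box n s t
      · rw [𝒯.ind_of_mem h, norm_one]
      · rw [𝒯.ind_of_notMem h, norm_zero]; exact zero_le_one) fun a h => 𝒯.ind_of_notMem h
  refine ⟨⟨W, mem_reducedCStar ?_ ?_ hW⟩, hW⟩
  · exact continuous_const.indicator fun a ha => by
      rw [IsClopen.frontier_eq ⟨𝒯.isClosed_box n s t, 𝒯.isOpen_box n s t⟩] at ha
      exact ha.elim
  · exact HasCompactSupport.intro' (𝒯.isCompact_box n s t) (𝒯.isClosed_box n s t)
      fun a h => 𝒯.ind_of_notMem h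

/-- The operator of the characteristic function of `[P, s, t]`. -/
def unit (n : ℕ) (s t : 𝒯.Q n) : G.reducedCStar := (𝒯.exists_unit n s t).choose

theorem isRegularRep_unit (n : ℕ) (s t : 𝒯.Q n) : IsRegularRep (𝒯.ind n s t) (𝒯.unit n s t).1 :=
  (𝒯.exists_unit n s t).choose_spec

theorem unit_eq {n : ℕ} {s t : 𝒯.Q n} {x : G.reducedCStar} (h : IsRegularRep (𝒯.ind n s t) x.1) :
    𝒯.unit n s t = x := Subtype.ext ((𝒯.isRegularRep_unit n s t).unique h)

theorem unit_eq_zero (n : ℕ) (s t : 𝒯.Q n) (h : 𝒯.cell n s ≠ 𝒯.cell n t) :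
    𝒯.unit n s t = 0 := by
  refine 𝒯.unit_eq ?_
  have : 𝒯.ind n s t = 0 := by
    ext a
    refine 𝒯.ind_of_notMem ?_
    rintro ⟨h1, rfl, rfl⟩
    exact h (𝒯.cell_eq _ _ _ h1)
  rw [this]
  exact IsRegularRep.zero

theorem unit_mul_same (n : ℕ) (r s t : 𝒯.Q n) (h : 𝒯.cell n r = 𝒯.cell n s) :
    𝒯.unit n r s * 𝒯.unit n s t = 𝒯.unit n r t := by
  refine (𝒯.unit_eq ((𝒯.isRegularRep_unit n r s).mul (𝒯.isRegularRep_unit n s t)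
    (fun a b ha hb => 𝒯.eq_of_mem_box' (𝒯.mem_of_ind_ne ha) (𝒯.mem_of_ind_ne hb)) ?_ ?_)).symm
  · intro b c hbc hb
    obtain ⟨h1, h2, h3⟩ := 𝒯.mem_of_ind_ne hb
    rw [𝒯.ind_of_mem (show b ∈ 𝒯.box n s t from ⟨h1, h2, h3⟩), mul_one]
    by_cases hc : c ∈ 𝒯.box n r t
    · rw [𝒯.ind_of_mem hc, 𝒯.ind_of_mem]
      exact ⟨(𝒯.R_equiv n).trans hc.1 (by rw [hbc]; exact (𝒯.R_equiv n).symm h1), hc.2.1, h2⟩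
    · rw [𝒯.ind_of_notMem hc, 𝒯.ind_of_notMem]
      rintro ⟨h4, h5, -⟩
      exact hc ⟨(𝒯.R_equiv n).trans h4 (by rw [hbc]; exact h1), h5, by rw [hbc]; exact h3⟩
  · intro c hc
    refine 𝒯.ind_of_notMem ?_
    rintro ⟨h1, h2, h3⟩
    obtain ⟨x, hx, hxs⟩ := 𝒯.exists_rel n c.range s (by rw [h2, h])
    have h4 : 𝒯.R n x c.source := (𝒯.R_equiv n).trans ((𝒯.R_equiv n).symm hx) h1
    have h5 := hc ⟨(x, c.source), (𝒯.rel_iff _ _).2 ⟨n, h4⟩⟩ rfl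
    exact one_ne_zero ((𝒯.ind_of_mem (a := ⟨(x, c.source), (𝒯.rel_iff _ _).2 ⟨n, h4⟩⟩)
      ⟨h4, hxs, h3⟩).symm.trans h5)

theorem unit_mul_ne (n : ℕ) (r s t u : 𝒯.Q n) (h : s ≠ t) :
    𝒯.unit n r s * 𝒯.unit n t u = 0 := by
  refine Subtype.ext (((𝒯.isRegularRep_unit n r s).mul (𝒯.isRegularRep_unit n t u) (k := 0)
    (fun a b ha hb => 𝒯.eq_of_mem_box' (𝒯.mem_of_ind_ne ha) (𝒯.mem_of_ind_ne hb)) ?_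
    (fun _ _ => rfl)).unique IsRegularRep.zero)
  intro b c hbc hb
  rw [𝒯.ind_of_notMem, zero_mul]
  · rfl
  · rintro ⟨-, -, h1⟩
    exact h (h1.symm.trans (𝒯.mem_of_ind_ne hb).2.1)

theorem star_unit (n : ℕ) (s t : 𝒯.Q n) : star (𝒯.unit n s t) = 𝒯.unit n t s := by
  refine (𝒯.unit_eq ?_).symm
  refine (congrArg (fun f => IsRegularRep f _) ?_).mpr (𝒯.isRegularRep_unit n s t).star
  ext a
  by_cases h : a ∈ 𝒯.box n t s
  · rw [𝒯.ind_of_mem h, 𝒯.ind_of_mem, star_one]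
    exact ⟨(𝒯.R_equiv n).symm h.1, h.2.2, h.2.1⟩
  · rw [𝒯.ind_of_notMem h, 𝒯.ind_of_notMem, star_zero]
    rintro ⟨h1, h2, h3⟩
    exact h ⟨(𝒯.R_equiv n).symm h1, h3, h2⟩

theorem isRegularRep_sum_unit {n : ℕ} {ι : Type*} (J : Finset ι) (c : ι → ℂ) (s t : ι → 𝒯.Q n) :
    IsRegularRep (∑ x ∈ J, c x • 𝒯.ind n (s x) (t x))
      (∑ x ∈ J, c x • 𝒯.unit n (s x) (t x)).1 := by
  rw [AddSubmonoidClass.coe_finsetSum]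
  exact IsRegularRep.sum fun x _ => (𝒯.isRegularRep_unit n _ _).smul _

/-- The value of a combination of characteristic functions. -/
theorem sum_ind_apply {n : ℕ} (c : 𝒯.Q n × 𝒯.Q n → ℂ) (a : G.Arrow) :
    (∑ x, c x • 𝒯.ind n x.1 x.2) a =
      if 𝒯.R n a.range a.source then c (𝒯.π n a.range, 𝒯.π n a.source) else 0 := by
  rw [Finset.sum_apply, Finset.sum_eq_single (𝒯.π n a.range, 𝒯.π n a.source)]
  · change c _ * _ = _
    split_ifs with h
    · rw [𝒯.ind_of_mem ⟨h, rfl, rfl⟩, mul_one]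
    · rw [𝒯.ind_of_notMem fun h' => h h'.1, mul_zero]
  · intro x _ hx
    change c _ * _ = _
    rw [𝒯.ind_of_notMem, mul_zero]
    rintro ⟨-, h1, h2⟩
    exact hx (Prod.ext h1.symm h2.symm)
  · simp

/-- The pairs of units of level `n + 1` that occur in `[P, s, t]`. -/
def refineCoeff (n : ℕ) (s t : 𝒯.Q n) (x : 𝒯.Q (n + 1) × 𝒯.Q (n + 1)) : ℂ :=
  if ∃ a ∈ 𝒯.box n s t, 𝒯.π (n + 1) a.range = x.1 ∧ 𝒯.π (n + 1) a.source = x.2 then 1 else 0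

/-- By `box_subset`, a box is the disjoint union of the boxes of the next level that it meets. -/
theorem unit_eq_sum (n : ℕ) (s t : 𝒯.Q n) :
    𝒯.unit n s t = ∑ x, 𝒯.refineCoeff n s t x • 𝒯.unit (n + 1) x.1 x.2 := by
  refine 𝒯.unit_eq ?_
  refine (congrArg (fun f => IsRegularRep f _) ?_).mpr
    (𝒯.isRegularRep_sum_unit Finset.univ (𝒯.refineCoeff n s t) Prod.fst Prod.snd)
  ext a
  rw [sum_ind_apply, refineCoeff]
  by_cases h : a ∈ 𝒯.box n s t
  · rw [𝒯.ind_of_mem h, if_pos (𝒯.R_succ _ _ _ h.1), if_pos ⟨a, h, rfl, rfl⟩]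
  · rw [𝒯.ind_of_notMem h]
    split_ifs with h1 h2
    · obtain ⟨b, hb, hb1, hb2⟩ := h2
      exact absurd (𝒯.box_subset (Nat.le_succ n) hb ⟨h1, hb1.symm, hb2.symm⟩) h
    · rfl
    · rfl

/-- A box on the diagonal contains identity arrows only, so splitting it amounts to splitting a set
of units by the next coordinate. -/
theorem unit_diag (n : ℕ) (t : 𝒯.Q n) :
    𝒯.unit n t t = ∑ s, if 𝒯.σ n s = t then 𝒯.unit (n + 1) s s else 0 := by
  have h0 : ∀ s, (if 𝒯.σ n s = t then 𝒯.unit (n + 1) s s else 0) =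
      (if 𝒯.σ n s = t then (1 : ℂ) else 0) • 𝒯.unit (n + 1) s s := by
    intro s
    split_ifs
    · rw [one_smul]
    · rw [zero_smul]
  simp only [h0]
  refine 𝒯.unit_eq ?_
  refine (congrArg (fun f => IsRegularRep f _) ?_).mpr
    (𝒯.isRegularRep_sum_unit Finset.univ _ _ _)
  have hdiag : ∀ n (t : 𝒯.Q n) (a : G.Arrow), a ∈ 𝒯.box n t t ↔
      a.range = a.source ∧ 𝒯.π n a.range = t := by
    intro n t a
    constructor
    · rintro ⟨h1, h2, h3⟩
      refine ⟨?_, h2⟩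
      have := 𝒯.eq_of_mem_box (a := a) (b := ⟨(a.range, a.range), G.rel.refl _⟩) ⟨h1, h2, h3⟩
        ⟨(𝒯.R_equiv n).refl _, h2, h2⟩ rfl
      exact (congrArg Arrow.source this).symm
    · rintro ⟨h1, h2⟩
      exact ⟨h1 ▸ (𝒯.R_equiv n).refl _, h2, h1 ▸ h2⟩
  ext a
  rw [Finset.sum_apply, Finset.sum_eq_single (𝒯.π (n + 1) a.range)]
  · change _ = (if _ then (1 : ℂ) else 0) * _
    rw [𝒯.σ_π]
    by_cases h : a ∈ 𝒯.box n t t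
    · have h1 := (hdiag _ _ _).1 h
      rw [𝒯.ind_of_mem h, if_pos h1.2, 𝒯.ind_of_mem ((hdiag _ _ _).2 ⟨h1.1, rfl⟩), mul_one]
    · rw [𝒯.ind_of_notMem h]
      by_cases h1 : 𝒯.π n a.range = t
      · rw [𝒯.ind_of_notMem, mul_zero]
        exact fun h2 => h ((hdiag _ _ _).2 ⟨((hdiag _ _ _).1 h2).1, h1⟩)
      · rw [if_neg h1, zero_mul]
  · intro s _ hs
    change (if _ then (1 : ℂ) else 0) * _ = _
    rw [𝒯.ind_of_notMem fun h => hs h.2.1.symm, mul_zero]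
  · simp

/-- If the generator of the cell of `t` never dies, then some point over `t` has the same property,
because `β` sends the generator to a finite sum. Iteration and `complete` give a unit over `t`,
whose identity arrow lies in the box of `(t, t)`, so the operator is not `0`. -/
theorem exists_seqMap_eq_zero (n : ℕ) (t : 𝒯.Q n) (ht : 𝒯.unit n t t = 0) :
    ∃ (m : ℕ) (h : n ≤ m), seqMap 𝒯.β n m h (Pi.single (𝒯.cell n t) 1) = 0 := by
  by_contra hne
  let good : ∀ m, 𝒯.Q m → Prop := fun m s =>
    ¬ ∃ (l : ℕ) (h : m ≤ l), seqMap 𝒯.β m l h (Pi.single (𝒯.cell m s) 1) = 0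
  have hlift : ∀ m s, good m s → ∃ s', 𝒯.σ m s' = s ∧ good (m + 1) s' := by
    intro m s hs
    by_contra h
    push Not at h
    have h1 : ∀ s', 𝒯.σ m s' = s → ∃ (l : ℕ) (h : m + 1 ≤ l),
        seqMap 𝒯.β (m + 1) l h (Pi.single (𝒯.cell (m + 1) s') 1) = 0 := fun s' hs' =>
      not_not.1 (h s' hs')
    choose! l hl h2 using h1
    let N := m + 1 + ∑ s', l s'
    have hN : ∀ s', l s' ≤ N := fun s' =>
      (Finset.single_le_sum (f := l) (fun _ _ => Nat.zero_le _) (Finset.mem_univ s')).trans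
        (Nat.le_add_left _ _)
    refine hs ⟨N, by omega, ?_⟩
    rw [← seqMap_seqMap 𝒯.β (Nat.le_succ m) (by omega : m + 1 ≤ N), seqMap_succ 𝒯.β le_rfl,
      seqMap_self, 𝒯.β_single, map_sum]
    refine Finset.sum_eq_zero fun s' _ => ?_
    split_ifs with hs'
    · rw [← seqMap_seqMap 𝒯.β (hl s' hs') (hN s'), h2 s' hs', map_zero]
    · exact map_zero _
  choose lift hlift1 hlift2 using hlift
  let q : ∀ j, {s : 𝒯.Q (n + j) // good (n + j) s} := fun j =>
    Nat.rec ⟨t, hne⟩ (fun j s => ⟨lift (n + j) s.1 s.2, hlift2 _ _ s.2⟩) j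
  obtain ⟨x, hx⟩ := 𝒯.complete n (fun j => (q j).1) fun j => hlift1 _ _ (q j).2
  have h1 := 𝒯.isRegularRep_unit n t t ⟨(x, x), G.rel.refl x⟩ ⟨(x, x), G.rel.refl x⟩
  rw [ht, dif_pos rfl, 𝒯.ind_of_mem ⟨(𝒯.R_equiv n).refl x, hx 0, hx 0⟩] at h1
  exact zero_ne_one h1

/-- The matrix units in the reduced C*-algebra of a tail equivalence relation. -/
def unitSystem : UnitSystem G.reducedCStar where
  V := 𝒯.V
  P := 𝒯.Q
  fintypeV := 𝒯.fintypeV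
  fintypeP := 𝒯.fintypeQ
  cell := 𝒯.cell
  cell_surjective := 𝒯.cell_surjective
  σ := 𝒯.σ
  E := 𝒯.unit
  E_eq_zero := 𝒯.unit_eq_zero
  mul_same := 𝒯.unit_mul_same
  mul_ne := 𝒯.unit_mul_ne
  star_E := 𝒯.star_unit
  E_mem n s t := by
    rw [𝒯.unit_eq_sum]
    exact sum_mem fun x _ => Submodule.smul_mem _ _ (Submodule.subset_span (mem_range_self x))
  E_diag := 𝒯.unit_diag
  β := 𝒯.β
  β_single n t := 𝒯.β_single n t
  dead := 𝒯.exists_seqMap_eq_zero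

end TailSystem

/-! ## Density of the matrix units -/

namespace TailSystem

open EqGroupoid
open Classical

variable {G : EqGroupoid} (𝒯 : TailSystem G)

/-- The unions of the boxes of level `m` on which `f` oscillates by at most `ε` are open and
increase with `m`; compactness of the support selects one level. -/
theorem exists_level_of_isCompact {f : G.Arrow → ℂ} (hf : Continuous f) (hc : HasCompactSupport f)
    {ε : ℝ} (hε : 0 < ε) (n : ℕ) : ∃ m ≥ n, ∀ a ∈ tsupport f, 𝒯.R m a.range a.source ∧
      ∀ b ∈ 𝒯.box m (𝒯.π m a.range) (𝒯.π m a.source), ‖f b - f a‖ ≤ ε := by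
  let O : ℕ → Set G.Arrow := fun m => ⋃ x ∈ {x : 𝒯.Q m × 𝒯.Q m |
    ∀ a ∈ 𝒯.box m x.1 x.2, ∀ b ∈ 𝒯.box m x.1 x.2, ‖f b - f a‖ ≤ ε}, 𝒯.box m x.1 x.2
  have hO : Monotone O := by
    intro l m hlm a ha
    simp only [O, mem_iUnion, exists_prop] at ha ⊢
    obtain ⟨x, hx, hax⟩ := ha
    have h1 := 𝒯.box_subset hlm hax
    exact ⟨(𝒯.π m a.range, 𝒯.π m a.source), fun b hb b' hb' => hx b (h1 hb) b' (h1 hb'),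
      𝒯.R_mono hlm hax.1, rfl, rfl⟩
  obtain ⟨m, hm⟩ := hc.isCompact.elim_directed_cover O
    (fun m => isOpen_biUnion fun x _ => 𝒯.isOpen_box m x.1 x.2) (by
      intro a _
      obtain ⟨m, hm⟩ := 𝒯.exists_box_subset (hf.isOpen_preimage _ (isOpen_ball (x := f a)
        (ε := ε / 2))) (mem_ball_self (half_pos hε) : f a ∈ ball (f a) (ε / 2))
      obtain ⟨h1, h2⟩ := hm m le_rfl
      simp only [O, mem_iUnion, exists_prop]
      refine ⟨m, (𝒯.π m a.range, 𝒯.π m a.source), fun b hb b' hb' => ?_, h1, rfl, rfl⟩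
      have h3 : dist (f b) (f a) < ε / 2 := h2 hb
      have h4 : dist (f b') (f a) < ε / 2 := h2 hb'
      rw [← dist_eq_norm]
      have := dist_triangle_right (f b') (f b) (f a)
      linarith) hO.directed_le
  refine ⟨max n m, le_max_left _ _, fun a ha => ?_⟩
  have h1 := hO (le_max_right n m) (hm ha)
  simp only [O, mem_iUnion, exists_prop] at h1
  obtain ⟨x, hx, h2, h3, h4⟩ := h1
  refine ⟨h2, fun b hb => hx a ⟨h2, h3, h4⟩ b ?_⟩
  rwa [h3, h4] at hb

/-- The level `n` is chosen before `ε`: all errors are supported on the same relation `R n`, so the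
constant in `norm_le_of_isRegularRep` stays fixed while `ε` tends to `0`. -/
theorem exists_sum_ind {f : G.Arrow → ℂ} (hf : Continuous f) (hc : HasCompactSupport f) :
    ∃ n, ∀ ε > 0, ∃ (m : ℕ) (c : 𝒯.Q m × 𝒯.Q m → ℂ), ∀ a,
      ‖(f - ∑ x, c x • 𝒯.ind m x.1 x.2) a‖ ≤ ε ∧
      (¬ 𝒯.R n a.range a.source → (f - ∑ x, c x • 𝒯.ind m x.1 x.2) a = 0) := by
  obtain ⟨n, -, hn⟩ := 𝒯.exists_level_of_isCompact hf hc one_pos 0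
  refine ⟨n, fun ε hε => ?_⟩
  obtain ⟨m, hnm, hm⟩ := 𝒯.exists_level_of_isCompact hf hc hε n
  refine ⟨m, fun x => if h : ∃ a ∈ 𝒯.box m x.1 x.2, f a ≠ 0 then f h.choose else 0, fun a => ?_⟩
  rw [Pi.sub_apply, sum_ind_apply]
  by_cases hR : 𝒯.R m a.range a.source
  · rw [if_pos hR]
    by_cases h : ∃ b ∈ 𝒯.box m (𝒯.π m a.range) (𝒯.π m a.source), f b ≠ 0
    · rw [dif_pos h]
      obtain ⟨h1, h2⟩ := h.choose_spec
      set b := h.choose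
      have h3 : b ∈ tsupport f := subset_tsupport _ h2
      have h4 : a ∈ 𝒯.box m (𝒯.π m b.range) (𝒯.π m b.source) := ⟨hR, h1.2.1.symm, h1.2.2.symm⟩
      have h5 : a ∈ 𝒯.box n (𝒯.π n b.range) (𝒯.π n b.source) :=
        𝒯.box_subset hnm ⟨(hn b h3).1, rfl, rfl⟩ h4
      exact ⟨(hm b h3).2 a h4, fun h6 => absurd h5.1 h6⟩
    · rw [dif_neg h]
      push Not at h
      rw [h a ⟨hR, rfl, rfl⟩, sub_zero, norm_zero]
      exact ⟨hε.le, fun _ => rfl⟩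
  · rw [if_neg hR]
    have h : f a = 0 := by
      by_contra h
      exact hR (hm a (subset_tsupport _ h)).1
    rw [h, sub_zero, norm_zero]
    exact ⟨hε.le, fun _ => rfl⟩

/-- The function is cut into its restrictions to the boxes of level `n`. These are bisections, so
each piece acts with norm at most `C`. -/
theorem norm_le_of_isRegularRep {n : ℕ} {f : G.Arrow → ℂ} {S : G.L2 →L[ℂ] G.L2}
    (hS : IsRegularRep f S) {C : ℝ} (hC : 0 ≤ C) (hf : ∀ a, ‖f a‖ ≤ C)
    (hf0 : ∀ a, ¬ 𝒯.R n a.range a.source → f a = 0) :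
    ‖S‖ ≤ Fintype.card (𝒯.Q n × 𝒯.Q n) * C := by
  have h1 : ∀ x : 𝒯.Q n × 𝒯.Q n, ∃ W, IsRegularRep ((𝒯.box n x.1 x.2).indicator f) W ∧ ‖W‖ ≤ C :=
    fun x => 𝒯.exists_isRegularRep_of_box hC
      (fun a => (norm_indicator_le_norm_self f a).trans (hf a)) fun a h => indicator_of_notMem h f
  choose W hW hWC using h1
  have h2 : f = ∑ x : 𝒯.Q n × 𝒯.Q n, (𝒯.box n x.1 x.2).indicator f := by
    ext a
    rw [Finset.sum_apply, Finset.sum_eq_single (𝒯.π n a.range, 𝒯.π n a.source)]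
    · by_cases h : 𝒯.R n a.range a.source
      · exact (indicator_of_mem (show a ∈ 𝒯.box n _ _ from ⟨h, rfl, rfl⟩) f).symm
      · rw [hf0 a h, indicator_of_notMem fun h' => h h'.1]
    · intro x _ hx
      refine indicator_of_notMem ?_ f
      rintro ⟨-, h3, h4⟩
      exact hx (Prod.ext h3.symm h4.symm)
    · simp
  rw [h2] at hS
  rw [hS.unique (IsRegularRep.sum fun x _ => hW x), ← nsmul_eq_mul]
  exact norm_sum_le_of_le _ (fun x _ => hWC x) |>.trans_eq (by simp)

/-- The operators that belong to the algebra of some level. -/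
def levels : NonUnitalStarSubalgebra ℂ (G.L2 →L[ℂ] G.L2) where
  carrier := {S | ∃ n, ∃ x ∈ 𝒯.unitSystem.level n, (x : G.L2 →L[ℂ] G.L2) = S}
  zero_mem' := ⟨0, 0, zero_mem _, rfl⟩
  add_mem' := by
    rintro _ _ ⟨n, x, hx, rfl⟩ ⟨m, y, hy, rfl⟩
    exact ⟨max n m, x + y, add_mem (𝒯.unitSystem.level_mono (le_max_left n m) hx)
      (𝒯.unitSystem.level_mono (le_max_right n m) hy), rfl⟩
  mul_mem' := by
    rintro _ _ ⟨n, x, hx, rfl⟩ ⟨m, y, hy, rfl⟩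
    exact ⟨max n m, x * y, mul_mem (𝒯.unitSystem.level_mono (le_max_left n m) hx)
      (𝒯.unitSystem.level_mono (le_max_right n m) hy), rfl⟩
  smul_mem' := by
    rintro c _ ⟨n, x, hx, rfl⟩
    exact ⟨n, c • x, SMulMemClass.smul_mem c hx, rfl⟩
  star_mem' := by
    rintro _ ⟨n, x, hx, rfl⟩
    exact ⟨n, star x, star_mem hx, rfl⟩

theorem isDense_unitSystem : 𝒯.unitSystem.IsDense := by
  have key : G.reducedCStar ≤ 𝒯.levels.topologicalClosure := by
    refine reducedCStar_le (NonUnitalStarSubalgebra.isClosed_topologicalClosure _) ?_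
    intro f S hf hc hS
    refine Metric.mem_closure_iff.2 fun ε hε => ?_
    obtain ⟨n, hn⟩ := 𝒯.exists_sum_ind hf hc
    have hN : (0 : ℝ) ≤ Fintype.card (𝒯.Q n × 𝒯.Q n) := Nat.cast_nonneg _
    generalize hNeq : (Fintype.card (𝒯.Q n × 𝒯.Q n) : ℝ) = N at hN
    obtain ⟨m, c, hm⟩ := hn (ε / (N + 1)) (by positivity)
    refine ⟨(∑ x, c x • 𝒯.unit m x.1 x.2 : G.reducedCStar).1, ⟨m, _, ?_, rfl⟩, ?_⟩
    · exact sum_mem fun x _ => SMulMemClass.smul_mem _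
        (𝒯.unitSystem.mem_level.2 (Submodule.subset_span (mem_range_self x)))
    · rw [dist_eq_norm]
      refine (𝒯.norm_le_of_isRegularRep (hS.sub (𝒯.isRegularRep_sum_unit Finset.univ c
        Prod.fst Prod.snd)) (by positivity) (fun a => (hm a).1) (fun a => (hm a).2)).trans_lt ?_
      rw [hNeq, mul_div_assoc', div_lt_iff₀ (by positivity)]
      nlinarith
  intro a ε hε
  obtain ⟨_, ⟨n, b, hb, rfl⟩, h⟩ := Metric.mem_closure_iff.1 (key a.2) ε hε
  refine ⟨n, b, hb, ?_⟩
  rw [dist_comm, dist_eq_norm] at h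
  exact h

end TailSystem

/-! ## The groupoids of punctures -/

namespace CellStructure

variable {d : ℕ} {S : Substitution d} {T : Tiling S} {X : CellStructure T}
  {pun : ℕ → Set (T.AP 0)} {k : ℕ}

theorem LimPuncture.ext_of_le {n : ℕ} {p q : X.LimPuncture pun k}
    (h : ∀ m ≥ n, p.1 m = q.1 m) : p = q := by
  refine Subtype.ext (funext fun m => ?_)
  rw [← p.down_eq (le_max_left m n), ← q.down_eq (le_max_left m n), h _ (le_max_right m n)]

/-- At a level `m > n` the terms of `p'` and `q'` have lifts to `ℝᵈ` in one open cell of level `n +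
1`. This cell embeds in `AP (n + 1)`, where the terms lie in one copy of a level-`n` cell, so the
lifts already lie in one open cell of level `n`. -/
theorem TailRel.of_succ {n : ℕ} {p q p' q' : X.LimPuncture pun k} (h : TailRel n p q)
    (h' : TailRel (n + 1) p' q') (hp : p.1 (n + 1) = p'.1 (n + 1))
    (hq : q.1 (n + 1) = q'.1 (n + 1)) : TailRel n p' q' := by
  have h1 : T.Copy n (n + 1) (p'.1 (n + 1)) (q'.1 (n + 1)) := hp ▸ hq ▸ h.copy n.le_succ
  intro m hm
  change T.Copy n m (p'.1 m) (q'.1 m)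
  obtain rfl | hm' := hm.eq_or_lt
  · have h2 := h1.down le_rfl n.le_succ
    rwa [p'.down_eq, q'.down_eq] at h2
  · have hm' : n + 1 ≤ m := hm'
    obtain ⟨y, hy⟩ := T.proj_surjective m (p'.1 m)
    have h2 := h'.copy hm'
    rw [← hy] at h2 ⊢
    obtain ⟨z, hz, hzq⟩ := (Tiling.copy_iff hm').1 h2
    have hy' : T.proj (n + 1) y = p'.1 (n + 1) := by
      rw [← p'.down_eq hm', ← hy, T.down_proj]
    have hz' : T.proj (n + 1) z = q'.1 (n + 1) := by
      rw [← q'.down_eq hm', ← hzq, T.down_proj]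
    rw [← hy', ← hz'] at h1
    obtain ⟨w, hw, hwz⟩ := (Tiling.copy_iff n.le_succ).1 h1
    have h3 := T.proj_injOn_openCellAt le_rfl y (T.openCellAt_subset_succ n y hw) hz hwz
    exact (Tiling.copy_iff hm).2 ⟨z, h3 ▸ hw, hzq⟩

theorem LimPuncture.exists_of_forall_ge (hpun : X.IsPuncturing pun) (hk : k ≤ d) {n : ℕ}
    (q : ∀ j, T.AP (n + j)) (hq : ∀ j, q j ∈ X.punctures pun (n + j) k)
    (hσ : ∀ j, T.σ (n + j) (q (j + 1)) = q j) :
    ∃ p : X.LimPuncture pun k, ∀ j, p.1 (n + j) = q j := by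
  have hd : ∀ {i j : ℕ} (h : i ≤ j), T.down (Nat.add_le_add_left h n) (q j) = q i := by
    intro i j h
    induction j, h using Nat.le_induction with
    | base => exact T.down_self _
    | succ j hj ih =>
      rw [← ih, ← hσ j, T.sigma_eq_down, T.down_down]
  refine ⟨⟨fun m => T.down (Nat.le_add_left m n) (q m), fun m => ?_, fun m =>
    down_mem_punctures hpun hk _ (hq m)⟩, fun j => hd (Nat.le_add_left j n)⟩
  change _ = T.down (Nat.le_add_left m n) (q m)
  rw [T.sigma_eq_down, T.down_down, ← hd m.le_succ, T.down_down]

/-- The cell of a puncture. -/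
def punctureCell {n : ℕ} (p : X.punctures pun n k) : X.Cell n k := p.2.1.choose

theorem mem_punctureCell {n : ℕ} (p : X.punctures pun n k) : p.1 ∈ X.openCell (punctureCell p) :=
  p.2.1.choose_spec

theorem punctureCell_eq {n : ℕ} {p : X.punctures pun n k} {e : X.Cell n k}
    (h : p.1 ∈ X.openCell e) : punctureCell p = e := X.cell_eq (mem_punctureCell p) h

theorem punctureCell_surjective (hpun : X.IsPuncturing pun) (hk : k ≤ d) (n : ℕ) :
    Function.Surjective (punctureCell : X.punctures pun n k → X.Cell n k) := fun e =>
  have ⟨p, hp, hpe⟩ := exists_puncture hpun hk n e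
  ⟨⟨p, hp⟩, punctureCell_eq hpe⟩

/-- Tail equivalence of punctures as a tail equivalence relation. -/
def tailSystem (h : X.IsCoherent k) (hpun : X.IsPuncturing pun) (hk : k ≤ d) :
    TailSystem (X.afGroupoid pun k) where
  V n := X.Cell n k
  Q n := X.punctures pun n k
  fintypeV _ := inferInstance
  fintypeQ n := (finite_punctures hpun hk n).fintype
  cell _ := punctureCell
  cell_surjective := punctureCell_surjective hpun hk
  σ n p := ⟨T.σ n p.1, sigma_mem_punctures hpun hk p.2⟩
  π n p := ⟨p.1 n, p.2.2 n⟩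
  σ_π n p := Subtype.ext (p.2.1 n)
  R n := TailRel n
  R_equiv n := ⟨fun _ _ _ _ => Iff.rfl, TailRel.symm, TailRel.trans⟩
  R_succ _ _ _ := TailRel.succ
  rel_iff _ _ := Iff.rfl
  top_eq := by
    refine le_antisymm ?_ (le_generateFrom ?_)
    · refine le_generateFrom ?_
      rintro _ ⟨n, s, t, rfl⟩
      refine TopologicalSpace.isOpen_generateFrom_of_mem ⟨n, s.1, t.1, Set.ext fun a => ?_⟩
      exact and_congr_right fun _ => and_congr Subtype.ext_iff Subtype.ext_iff
    · rintro B ⟨n, s, t, hB⟩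
      -- A generating set that names points other than `k`-punctures is empty.
      by_cases hst : s ∈ X.punctures pun n k ∧ t ∈ X.punctures pun n k
      · refine TopologicalSpace.isOpen_generateFrom_of_mem ⟨n, ⟨s, hst.1⟩, ⟨t, hst.2⟩,
          hB.trans (Set.ext fun a => ?_)⟩
        exact and_congr_right fun _ =>
          and_congr (Subtype.mk_eq_mk (h' := hst.1)).symm (Subtype.mk_eq_mk (h' := hst.2)).symm
      · obtain rfl : B = ∅ := by
          rw [eq_empty_iff_forall_notMem]
          intro a ha
          rw [hB] at ha
          obtain ⟨-, rfl, rfl⟩ := ha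
          exact hst ⟨a.1.1.2.2 n, a.1.2.2.2 n⟩
        exact @isOpen_empty _ (TopologicalSpace.generateFrom _)
  cell_eq n p q hpq := (punctureCell_eq
    ((X.copy_iff_mem_openCell (mem_punctureCell _)).1 (TailRel.copy hpq le_rfl))).symm
  coherent n m hm p q p' q' h h' hp hq := Subtype.ext
    (TailRel.eq_of_eq h h' hm (congrArg Subtype.val hp) (congrArg Subtype.val hq))
  exists_rel n p c hc := by
    obtain ⟨q, h1, h2⟩ := TailRel.exists_of_copy hpun hk p c.2
      ((X.copy_iff_mem_openCell (mem_punctureCell ⟨p.1 n, p.2.2 n⟩)).2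
        (hc ▸ mem_punctureCell c))
    exact ⟨q, h1, Subtype.ext h2⟩
  separated n p q hpq := LimPuncture.ext_of_le fun m hm => congrArg Subtype.val (hpq m hm)
  refine n p q p' q' h h' hp hq :=
    TailRel.of_succ h h' (congrArg Subtype.val hp) (congrArg Subtype.val hq)
  complete n q hq := by
    obtain ⟨p, hp⟩ := LimPuncture.exists_of_forall_ge hpun hk (fun j => (q j).1)
      (fun j => (q j).2) fun j => congrArg Subtype.val (hq j)
    exact ⟨p, fun j => Subtype.ext (hp j)⟩
  β n := X.sigmaT n k
  β_single n t := by
    intro _ _ _ _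
    convert h.sigmaT_single punctureCell mem_punctureCell t.2 (mem_punctureCell t) using 4
    exact Subtype.ext_iff

/-- `K₀` of the C*-algebra of an `AF`-groupoid of punctures is the group of cochains. -/
theorem nonempty_K0_afGroupoid_equiv (h : X.IsCoherent k) (hpun : X.IsPuncturing pun)
    (hk : k ≤ d) : Nonempty (K0 (X.afGroupoid pun k).reducedCStar ≃+ X.CochainLim k) :=
  (tailSystem h hpun hk).unitSystem.nonempty_K0_equiv (tailSystem h hpun hk).isDense_unitSystem

/-- The finite-dimensional groupoid of a level as a constant tail equivalence relation. -/
def levelSystem (hpun : X.IsPuncturing pun) (hk : k ≤ d) (n : ℕ) :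
    TailSystem (X.afLevel pun n k) where
  V _ := X.Cell n k
  Q _ := X.punctures pun n k
  fintypeV _ := inferInstance
  fintypeQ _ := (finite_punctures hpun hk n).fintype
  cell _ := punctureCell
  cell_surjective _ := punctureCell_surjective hpun hk n
  σ _ p := p
  π _ p := p
  σ_π _ _ := rfl
  R _ p q := (X.afLevel pun n k).rel p q
  R_equiv _ := (X.afLevel pun n k).rel.iseqv
  R_succ _ _ _ h := h
  rel_iff _ _ := ⟨fun h => ⟨0, h⟩, fun ⟨_, h⟩ => h⟩
  top_eq := by
    symm
    let _ := TopologicalSpace.generateFrom {B : Set {a : (X.afLevel pun n k).Unit ×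
      (X.afLevel pun n k).Unit // (X.afLevel pun n k).rel a.1 a.2} |
        ∃ (_ : ℕ) (s t : X.punctures pun n k),
          B = {a | (X.afLevel pun n k).rel a.1.1 a.1.2 ∧ a.1.1 = s ∧ a.1.2 = t}}
    refine eq_bot_of_singletons_open fun a => ?_
    refine TopologicalSpace.isOpen_generateFrom_of_mem ⟨0, a.1.1, a.1.2, ?_⟩
    ext b
    exact ⟨by rintro rfl; exact ⟨b.2, rfl, rfl⟩, fun h => Subtype.ext (Prod.ext h.2.1 h.2.2)⟩
  cell_eq _ p q h := (punctureCell_eq ((h _).1 (mem_punctureCell p))).symm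
  coherent _ _ _ _ _ _ _ _ _ _ h := h
  exists_rel _ p c h := ⟨c, fun e => ⟨fun h1 => by
    rw [← punctureCell_eq h1, h]; exact mem_punctureCell c, fun h1 => by
    rw [← punctureCell_eq h1, ← h]; exact mem_punctureCell p⟩, rfl⟩
  separated m _ _ h := h m le_rfl
  refine _ _ _ _ _ _ h _ _ := h
  complete m q hq := ⟨q 0, fun j => by
    induction j with
    | zero => rfl
    | succ j ih => exact ih.trans (hq j).symm⟩
  β _ := AddMonoidHom.id _
  β_single m t := by
    intro _ _ _ _
    rw [Finset.sum_ite_eq' Finset.univ t, if_pos (Finset.mem_univ t), AddMonoidHom.id_apply]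
    congr!

/-- In the constant system all maps between levels are identities, so the map from level `0` is
already an isomorphism onto `K₀`. Orientations play no role. -/
theorem exists_isCF (hpun : X.IsPuncturing pun) (hk : k ≤ d) (n : ℕ) :
    ∃ c : X.Cochain n k ≃+ K0 (X.afLevel pun n k).reducedCStar, X.IsCF pun c := by
  classical
  let 𝒯 := levelSystem hpun hk n
  refine ⟨AddEquiv.ofBijective (𝒯.unitSystem.toK0 0) (𝒯.unitSystem.bijective_toK0
    𝒯.isDense_unitSystem fun _ => Function.bijective_id), fun e t ht => ?_⟩
  refine ⟨𝒯.unit 0 t t, 𝒯.unitSystem.isStarProjection_E 0 t, ?_, ?_⟩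
  · refine (congrArg (fun f => EqGroupoid.IsRegularRep f _) ?_).mpr (𝒯.isRegularRep_unit 0 t t)
    ext a
    by_cases h : a.range = t ∧ a.source = t
    · rw [𝒯.ind_of_mem ⟨a.2, h⟩]
      convert if_pos h
    · rw [𝒯.ind_of_notMem fun h' => h h'.2]
      convert if_neg h
  · refine Eq.trans ?_ (K0.ofProj_eq _ _).symm
    refine Eq.trans ?_ (𝒯.unitSystem.toK0_single 0 t)
    rw [show 𝒯.unitSystem.cell 0 t = e from punctureCell_eq ht]
    change 𝒯.unitSystem.toK0 0 _ = _
    congr!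

end CellStructure

/-! ### Conjugate sequences and the conclusion -/

theorem nonempty_seqLim_congr {A B : ℕ → Type*} [∀ n, AddCommGroup (A n)]
    [∀ n, AddCommGroup (B n)] (f : ∀ n, A n →+ A (n + 1)) (c : ∀ n, A n ≃+ B n) :
    Nonempty (SeqLim (fun n => ((c (n + 1)).toAddMonoidHom.comp (f n)).comp
      (c n).symm.toAddMonoidHom) ≃+ SeqLim f) := by
  refine ⟨(AddCommGroup.DirectLimit.congr c fun n m h => ?_).symm⟩
  ext x
  induction m, h using Nat.le_induction with
  | base => simp [seqMap_self]
  | succ m h ih =>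
    have h1 : ∀ y, c (m + 1) (f m y) = ((c (m + 1)).toAddMonoidHom.comp (f m)).comp
      (c m).symm.toAddMonoidHom (c m y) := fun y => by simp
    simp only [AddMonoidHom.comp_apply, AddMonoidHom.coe_coe, AddEquiv.coe_toAddMonoidHom] at ih ⊢
    rw [seqMap_succ f h, h1, ih]
    rw [seqMap_succ _ h]

end SubstTiling

end

open SubstTiling in
theorem mainTheorem5 {d : ℕ} (S : Substitution d) (T : Tiling S)
    (hprim : S.IsPrimitive) (hflc : T.HasFLC) (haper : T.IsAperiodic)
    (X : CellStructure T) (hor : X.IsOriented)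
    (pun : ℕ → Set (T.AP 0)) (hpun : X.IsPuncturing pun) :
    Nonempty (K0 (X.afGroupoid pun d).reducedCStar ≃+ X.CochainLim d) ∧
    (∀ k < d, ∃ c : ∀ n, X.Cochain n k ≃+ K0 (X.afLevel pun n k).reducedCStar,
      (∀ n, X.IsCF pun (c n)) ∧
      Nonempty (SeqLim (fun n => ((c (n + 1)).toAddMonoidHom.comp (X.sigmaT n k)).comp
        (c n).symm.toAddMonoidHom) ≃+ X.CochainLim k)) ∧
    (X.BoundaryHyperplane →
      ∀ k < d, Nonempty (K0 (X.afGroupoid pun k).reducedCStar ≃+ X.CochainLim k)) := by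
  refine ⟨CellStructure.nonempty_K0_afGroupoid_equiv hor.isCoherent_top hpun le_rfl, fun k hk => ?_,
    fun hb k hk => CellStructure.nonempty_K0_afGroupoid_equiv
      (hor.isCoherent_of_boundaryHyperplane hb hk) hpun hk.le⟩
  choose c hc using fun n => CellStructure.exists_isCF (X := X) hpun hk.le n
  exact ⟨c, hc, nonempty_seqLim_congr (fun n => X.sigmaT n k) c⟩
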